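/- **Setting.** Let $\overline\mu,\overline s,\overline d\in\{1,2,\dots\}^r$, let $\chi(B)=\prod_{i=1}^r(1-B^{\mu_is_i})^{d_i}=\sum_{k=0}^{n}e(k)B^k$, where $B$ is the backward shift and $n=\sum_i\mu_is_id_i$, and put $$\chi(e^{-i\lambda})=\prod_{j=1}^r(1-e^{-i\lambda\mu_js_j})^{d_j},\qquad \beta(i\lambda)=\prod_{j=1}^r\prod_{k=-[s_j/2]}^{[s_j/2]}(i\lambda-2\pi ik/s_j)^{d_j}.$$ Below $\chi,\beta$ inside formulas in $\lambda$ stand for $\chi(e^{-i\lambda})$ and $\beta(i\lambda)$. Let $\vec\xi(m)$, $m\in\mathbb Z$, be a $T$-dimensional (complex) random sequence whose increments $\chi\vec\xi(m)=\chi(B)\vec\xi(m)$ are centred, square integrable and wide sense stationary with spectral density $f$, and let $\vec\eta(m)$ be a centred wide sense stationary sequence with spectral density $g$, uncorrelated with $\chi\vec\xi$. The matrices $f(\lambda),g(\lambda)$ are positive semidefinite and densities are normalized by $$\mathsf E\,\chi\xi_p(m+k)\overline{\chi\xi_q(k)}=\frac1{2\pi}\int_{-\pi}^{\pi}e^{im\lambda}\frac{|\chi|^2}{|\beta|^2}f_{pq}(\lambda)\,d\lambda,\qquad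 \mathsf E\,\eta_p(m+k)\overline{\eta_q(k)}=\frac1{2\pi}\int_{-\pi}^{\pi}e^{im\lambda}g_{pq}(\lambda)\,d\lambda .$$ Put $\vec\zeta=\vec\xi+\vec\eta$ and $p=f+|\beta|^2g$, and assume the minimality condition: $p(\lambda)$ is invertible for almost every $\lambda$ and $$\int_{-\pi}^{\pi}\operatorname{Tr}\Big[\frac{|\beta|^2}{|\chi|^2}\,p(\lambda)^{-1}\Big]d\lambda<\infty .$$ **Problem.** Let $N\ge0$, $\vec a(0),\dots,\vec a(N)\in\mathbb C^T$ and $A_N\vec\xi=\sum_{k=0}^N\vec a(k)^\top\vec\xi(k)$. Define $d(k)$ by $\sum_{k\ge0} d(k)x^k=\prod_i(\sum_{j\ge0}x^{\mu_is_ij})^{d_i}$, and $$\vec b(k)=\sum_{m=k}^Nd(m-k)\vec a(m)\ (0\le k\le N),\quad \vec v(k)=\sum_{l=0}^{\min(N,k+n)}e(l-k)\vec b(l)\ (-n\le k\le-1),\quad V_N\vec\zeta=\sum_{k=-n}^{-1}\vec v(k)^\top\vec\zeta(k).$$ A linear estimate of $A_N\vec\xi$ from observations of $\vec\zeta$ on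 $\mathbb Z\setminus\{0,\dots,N\}$ is a random variable $H-V_N\vec\zeta$, where $H$ belongs to the closed linear span in $L_2(\mathsf P)$ of the observed increments $\chi\zeta_l(k)$, $1\le l\le T$, $k\le-1$ or $k\ge N+n+1$; it is optimal if it minimizes the mean-square error in this class. **Notation.** Let $A(\lambda)=\sum_{k=0}^N\vec a(k)e^{i\lambda k}$ and $B(\lambda)=\sum_{k=0}^N\vec b(k)e^{i\lambda k}$. For $0\le j,k\le N+n$ (for $0\le j,k\le N$ in the case of $Q$) put $$T_{j,k}=\frac1{2\pi}\int_{-\pi}^{\pi}e^{i\lambda(k-j)}\frac{|\beta|^2}{\chi}\big[g\,p^{-1}\big]^\top d\lambda,\quad P_{j,k}=\frac1{2\pi}\int_{-\pi}^{\pi}e^{i\lambda(k-j)}\frac{|\beta|^2}{|\chi|^2}\big[p^{-1}\big]^\top d\lambda,\quad Q_{j,k}=\frac1{2\pi}\int_{-\pi}^{\pi}e^{i\lambda(k-j)}\big[f\,p^{-1}g\big]^\top d\lambda,$$ and let $\mathbf T,\mathbf P,\mathbf Q$ be the block matrices with these $T\times T$ blocks. Let $\mathbf a_N=(\vec a(0),\dots,\vec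 a(N))$, and let $\mathbf a=(\vec a(0),\dots,\vec a(N),0,\dots,0)$ and $[D\mathbf a]=(\vec b(0),\dots,\vec b(N),0,\dots,0)$, each with $n$ zero blocks appended. Write $\langle x,y\rangle=\sum_i x_i\overline{y_i}$. **Theorem.** The integrals defining $\mathbf T,\mathbf P,\mathbf Q$ converge absolutely and $\mathbf P$ is invertible. Put $$\mathbf c=\mathbf P^{-1}\big([D\mathbf a]-\mathbf T\mathbf a\big)=(\vec c(0),\dots,\vec c(N+n)),\qquad C(\lambda)=\sum_{k=0}^{N+n}\vec c(k)e^{i\lambda k},$$ $$\vec h(\lambda)^\top=B(\lambda)^\top\frac{\chi}{\beta}-A(\lambda)^\top g\,\overline{\beta}\,p^{-1}-C(\lambda)^\top\frac{\overline{\beta}}{\overline{\chi}}\,p^{-1}.$$ The increments of $\vec\zeta$ have a spectral representation $\chi\vec\zeta(m)=\int_{-\pi}^{\pi}e^{im\lambda}\frac{\chi}{\beta}\,d\vec Z(\lambda)$ with a centred vector stochastic measure $\vec Z$ on $[-\pi,\pi)$ (defined on the Borel sets on which $p$ is integrable), uncorrelated on disjoint sets and with structure matrix $\frac1{2\pi}p(\lambda)\,d\lambda$.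 For every such $\vec Z$, the almost surely unique optimal linear estimate of $A_N\vec\xi$ is $$\widehat A_N\vec\xi=\int_{-\pi}^{\pi}\vec h(\lambda)^\top d\vec Z(\lambda)-\sum_{k=-n}^{-1}\vec v(k)^\top\big(\vec\xi(k)+\vec\eta(k)\big).$$ Its mean-square error is finite and, with the row vectors $U=\overline{\chi}A^\top g+C^\top$ and $W=\overline{\chi}A^\top f-|\beta|^2C^\top$, $$\mathsf E\big|A_N\vec\xi-\widehat A_N\vec\xi\big|^2=\frac1{2\pi}\int_{-\pi}^{\pi}\frac{|\beta|^2}{|\chi|^2}\,U p^{-1}f\,p^{-1}U^*\,d\lambda+\frac1{2\pi}\int_{-\pi}^{\pi}\frac1{|\chi|^2}\,W p^{-1}g\,p^{-1}W^*\,d\lambda$$ $$=\big\langle[D\mathbf a]-\mathbf T\mathbf a,\ \mathbf P^{-1}\big([D\mathbf a]-\mathbf T\mathbf a\big)\big\rangle+\langle\mathbf Q\mathbf a_N,\mathbf a_N\rangle .$$ -/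

import Mathlib

open MeasureTheory Matrix
open scoped ComplexOrder ENNReal

noncomputable section

namespace GMInterpolation

/-- The parameters of a generalized multiple increment operator
`∏ i, (1 - B ^ (μ i * s i)) ^ (d i)`: steps `μ`, seasonal vector `s`, orders `d`. -/
structure Pattern (r : ℕ) where
  μ : Fin r → ℕ
  s : Fin r → ℕ
  d : Fin r → ℕ
  μ_pos : ∀ i, 0 < μ i
  s_pos : ∀ i, 0 < s i
  d_pos : ∀ i, 0 < d i

/-- Normalized Lebesgue measure `dθ / (2π)` on `[-π, π)`. -/
def circle : Measure ℝ :=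
  ENNReal.ofReal (1 / (2 * Real.pi)) • volume.restrict (Set.Ico (-Real.pi) Real.pi)

/-- The exponential `e^{i m θ}`. -/
def ex (m : ℤ) (θ : ℝ) : ℂ := Complex.exp (Complex.I * m * θ)

section Operator

variable {r : ℕ} (γ : Pattern r)

/-- The number `n(γ) = ∑ μ_i s_i d_i`. -/
def Pattern.n : ℕ := ∑ i, γ.μ i * γ.s i * γ.d i

/-- The GM increment `∏ i, (1 - B ^ (μ i * s i)) ^ (d i)` applied to a vector sequence `x`,
written out by the binomial theorem. -/
def Pattern.incr {Ω : Type*} {T : ℕ} (x : ℤ → Fin T → Ω → ℂ) (m : ℤ) (p : Fin T) (ω : Ω) : ℂ :=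
  ∑ l ∈ Fintype.piFinset (fun i => Finset.range (γ.d i + 1)),
    (∏ i, (-1 : ℂ) ^ (l i) * ((γ.d i).choose (l i) : ℂ)) *
      x (m - ∑ i, (γ.μ i * γ.s i * l i : ℤ)) p ω

/-- The coefficients `e(k)` of the increment operator, as a polynomial in the backward shift. -/
def Pattern.e (k : ℕ) : ℂ :=
  (∏ i, (1 - Polynomial.X ^ (γ.μ i * γ.s i)) ^ (γ.d i) : Polynomial ℂ).coeff k

/-- The coefficients of the power series `∏ i, (∑ j, x ^ (μ i * s i * j)) ^ (d i)`. -/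
def Pattern.dcoef (k : ℕ) : ℂ :=
  PowerSeries.coeff k
    (∏ i, (PowerSeries.mk fun j => if γ.μ i * γ.s i ∣ j then (1 : ℂ) else 0) ^ (γ.d i))

/-- `χ(e^{-iθ}) = ∏ j, (1 - e^{-i θ μ_j s_j}) ^ (d_j)`. -/
def Pattern.chi (θ : ℝ) : ℂ :=
  ∏ j, (1 - Complex.exp (-(Complex.I * θ * (γ.μ j * γ.s j : ℕ)))) ^ (γ.d j)

/-- `β(iθ) = ∏ j, ∏_{|k| ≤ [s_j / 2]} (iθ - 2πik / s_j) ^ (d_j)`. -/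
def Pattern.beta (θ : ℝ) : ℂ :=
  ∏ j, ∏ k ∈ Finset.Icc (-((γ.s j / 2 : ℕ) : ℤ)) ((γ.s j / 2 : ℕ) : ℤ),
    (Complex.I * θ - 2 * Real.pi * Complex.I * k / (γ.s j)) ^ (γ.d j)

/-- The weight `|β(iθ)|² / |χ(e^{-iθ})|²`. -/
def Pattern.weight (θ : ℝ) : ℂ := ((‖γ.beta θ‖ ^ 2 / ‖γ.chi θ‖ ^ 2 : ℝ) : ℂ)

end Operator

section Processes

variable {Ω : Type*} [MeasurableSpace Ω] (P : Measure Ω) {T r : ℕ}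

/-- `ξ` is a sequence whose GM increments are square integrable, centred and wide sense stationary
with an absolutely continuous spectral function, of spectral density `f`:
`E χξ_p(m + k) conj(χξ_q(k)) = (1/2π) ∫ e^{imθ} |χ|² / |β|² f_{pq}(θ) dθ`.
The variables `ξ_p(m)` themselves need not have moments. -/
structure HasIncrementDensity (γ : Pattern r) (ξ : ℤ → Fin T → Ω → ℂ)
    (f : ℝ → Matrix (Fin T) (Fin T) ℂ) : Prop where
  meas : ∀ m p, AEStronglyMeasurable (ξ m p) P
  memLp : ∀ m p, MemLp (γ.incr ξ m p) 2 P
  mean : ∀ m p, ∫ ω, γ.incr ξ m p ω ∂P = 0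
  posSemidef : ∀ᵐ θ ∂circle, (f θ).PosSemidef
  integrable : ∀ p q, Integrable
    (fun θ => ((‖γ.chi θ‖ ^ 2 / ‖γ.beta θ‖ ^ 2 : ℝ) : ℂ) * f θ p q) circle
  cov : ∀ m k p q, ∫ ω, γ.incr ξ (m + k) p ω * star (γ.incr ξ k q ω) ∂P =
    ∫ θ, ex m θ * ((‖γ.chi θ‖ ^ 2 / ‖γ.beta θ‖ ^ 2 : ℝ) : ℂ) * f θ p q ∂circle

/-- `η` is a centred wide sense stationary sequence with spectral density `g`:
`E η_p(m + k) conj(η_q(k)) = (1/2π) ∫ e^{imθ} g_{pq}(θ) dθ`. -/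
structure HasDensity (η : ℤ → Fin T → Ω → ℂ) (g : ℝ → Matrix (Fin T) (Fin T) ℂ) : Prop where
  memLp : ∀ m p, MemLp (η m p) 2 P
  mean : ∀ m p, ∫ ω, η m p ω ∂P = 0
  posSemidef : ∀ᵐ θ ∂circle, (g θ).PosSemidef
  integrable : ∀ p q, Integrable (fun θ => g θ p q) circle
  cov : ∀ m k p q, ∫ ω, η (m + k) p ω * star (η k q ω) ∂P = ∫ θ, ex m θ * g θ p q ∂circle

/-- The noise `η` is uncorrelated with (the increments of) `ξ`. -/
def Uncorrelated (γ : Pattern r) (ξ η : ℤ → Fin T → Ω → ℂ) : Prop :=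
  ∀ m k p q, ∫ ω, γ.incr ξ m p ω * star (η k q ω) ∂P = 0

/-- The density `p = f + |β|² g` of the observed sequence. -/
def obsDensity (γ : Pattern r) (f g : ℝ → Matrix (Fin T) (Fin T) ℂ) (θ : ℝ) :
    Matrix (Fin T) (Fin T) ℂ :=
  f θ + ((‖γ.beta θ‖ ^ 2 : ℝ) : ℂ) • g θ

/-- Minimality: `p` is invertible almost everywhere and `∫ Tr (|β|² / |χ|² p⁻¹) dθ < ∞`. -/
def Minimality (γ : Pattern r) (f g : ℝ → Matrix (Fin T) (Fin T) ℂ) : Prop :=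
  (∀ᵐ θ ∂circle, IsUnit (obsDensity γ f g θ).det) ∧
    Integrable (fun θ => (γ.weight θ • (obsDensity γ f g θ)⁻¹).trace) circle

/-! ### Vector stochastic measures with uncorrelated values and their integrals -/

/-- Borel subsets of `[-π, π)` on which the matrix density `p` is integrable. -/
def FiniteMass (p : ℝ → Matrix (Fin T) (Fin T) ℂ) (A : Set ℝ) : Prop :=
  MeasurableSet A ∧ A ⊆ Set.Ico (-Real.pi) Real.pi ∧
    ∀ k l, IntegrableOn (fun θ => p θ k l) A circle

/-- `Z` is a centred vector stochastic measure with uncorrelated values on disjoint sets, with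
structure matrix `dF = p dθ / (2π)`; `Z A` is the increment over `A` of the corresponding process
with uncorrelated increments. Additivity in mean square follows from `cov`. -/
structure IsStochasticMeasure (p : ℝ → Matrix (Fin T) (Fin T) ℂ)
    (Z : Set ℝ → Fin T → Ω → ℂ) : Prop where
  memLp : ∀ A, FiniteMass p A → ∀ k, MemLp (Z A k) 2 P
  mean : ∀ A, FiniteMass p A → ∀ k, ∫ ω, Z A k ω ∂P = 0
  cov : ∀ A B, FiniteMass p A → FiniteMass p B → ∀ k l,
    ∫ ω, Z A k ω * star (Z B l ω) ∂P = ∫ θ in A ∩ B, p θ k l ∂circle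

/-- The squared norm `(1/2π) ∫ φᵀ p conj(φ) dθ` of `φ` in `L₂(p)`. -/
def sqNorm (p : ℝ → Matrix (Fin T) (Fin T) ℂ) (φ : ℝ → Fin T → ℂ) : ℝ≥0∞ :=
  ∫⁻ θ, ENNReal.ofReal (φ θ ⬝ᵥ (p θ *ᵥ star (φ θ))).re ∂circle

/-- `Y = ∫ φᵀ dZ`: the mean square limit of integrals `∑ j, v_jᵀ Z(A_j)` of simple functions
`∑ j, v_j 1_{A_j}` that approximate `φ` in `L₂(p)`. -/
def IsStochasticIntegral (p : ℝ → Matrix (Fin T) (Fin T) ℂ) (Z : Set ℝ → Fin T → Ω → ℂ)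
    (φ : ℝ → Fin T → ℂ) (Y : Ω → ℂ) : Prop :=
  (∀ l, AEMeasurable (fun θ => φ θ l) circle) ∧ MemLp Y 2 P ∧
    ∀ ε : ℝ≥0∞, 0 < ε → ∃ (J : ℕ) (A : Fin J → Set ℝ) (v : Fin J → Fin T → ℂ),
      (∀ j, FiniteMass p (A j)) ∧
      sqNorm p (fun θ => φ θ - ∑ j, (A j).indicator (fun _ => v j) θ) < ε ∧
      eLpNorm (fun ω => Y ω - ∑ j, v j ⬝ᵥ fun l => Z (A j) l ω) 2 P < ε

/-- `Z` is the stochastic measure in the spectral representation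
`χζ(m) = ∫ e^{imθ} χ(e^{-iθ}) / β(iθ) dZ(θ)` of the increments of `ζ`, with structure
density `p`. -/
def IsSpectralMeasure (γ : Pattern r) (ζ : ℤ → Fin T → Ω → ℂ)
    (p : ℝ → Matrix (Fin T) (Fin T) ℂ) (Z : Set ℝ → Fin T → Ω → ℂ) : Prop :=
  IsStochasticMeasure P p Z ∧
    ∀ m l, IsStochasticIntegral P p Z
      (fun θ => Pi.single l (ex m θ * γ.chi θ / γ.beta θ)) (γ.incr ζ m l)

/-! ### The interpolation problem -/

/-- `A_N ξ = ∑_{k ≤ N} a(k)ᵀ ξ(k)`. -/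
def functional (N : ℕ) (a : ℕ → Fin T → ℂ) (ξ : ℤ → Fin T → Ω → ℂ) (ω : Ω) : ℂ :=
  ∑ k ∈ Finset.range (N + 1), a k ⬝ᵥ fun p => ξ k p ω

/-- `b_N(k) = ∑_{m = k}^N d(m - k) a(m)`, the vector `D a`; it vanishes for `k > N`. -/
def bvec (γ : Pattern r) (N : ℕ) (a : ℕ → Fin T → ℂ) (k : ℕ) : Fin T → ℂ :=
  ∑ m ∈ Finset.Icc k N, γ.dcoef (m - k) • a m

/-- `v_N(-k) = ∑_{l = 0}^{min N (n - k)} e(l + k) b_N(l)` for `1 ≤ k ≤ n`. -/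
def vvec (γ : Pattern r) (N : ℕ) (a : ℕ → Fin T → ℂ) (k : ℕ) : Fin T → ℂ :=
  ∑ l ∈ Finset.range (min N (γ.n - k) + 1), γ.e (l + k) • bvec γ N a l

/-- The initial value term `V_N ζ = ∑_{k = -n}^{-1} v_N(k)ᵀ ζ(k)`. -/
def initialTerm (γ : Pattern r) (N : ℕ) (a : ℕ → Fin T → ℂ) (ζ : ℤ → Fin T → Ω → ℂ) (ω : Ω) : ℂ :=
  ∑ k ∈ Finset.Icc 1 γ.n, vvec γ N a k ⬝ᵥ fun p => ζ (-(k : ℤ)) p ω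

/-- The increments of `ζ` that involve only its values outside `{0, …, N}`. -/
def observedIncrements (γ : Pattern r) (N : ℕ) (ζ : ℤ → Fin T → Ω → ℂ) : Set (Ω → ℂ) :=
  {X | ∃ (k : ℤ) (p : Fin T), (k ≤ -1 ∨ (N : ℤ) + γ.n + 1 ≤ k) ∧ X = γ.incr ζ k p}

/-- The closed linear span in `L₂(P)` of a set of random variables. -/
def closedSpan (S : Set (Ω → ℂ)) : Set (Ω → ℂ) :=
  {Y | MemLp Y 2 P ∧ ∀ ε : ℝ≥0∞, 0 < ε → ∃ X ∈ Submodule.span ℂ S, eLpNorm (Y - X) 2 P < ε}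

/-- Linear estimates of `A_N ξ`: an element of the closed span of the observed increments, minus
the initial value term `V_N ζ`. -/
def IsLinearEstimate (γ : Pattern r) (N : ℕ) (a : ℕ → Fin T → ℂ) (ζ : ℤ → Fin T → Ω → ℂ)
    (X : Ω → ℂ) : Prop :=
  ∃ H ∈ closedSpan P (observedIncrements γ N ζ), X =ᵐ[P] fun ω => H ω - initialTerm γ N a ζ ω

/-- Mean square optimal linear estimates of `A_N ξ` from observations of `ζ`. -/
def IsOptimalEstimate (γ : Pattern r) (N : ℕ) (a : ℕ → Fin T → ℂ) (ξ ζ : ℤ → Fin T → Ω → ℂ)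
    (X : Ω → ℂ) : Prop :=
  IsLinearEstimate P γ N a ζ X ∧ ∀ X', IsLinearEstimate P γ N a ζ X' →
    eLpNorm (functional N a ξ - X) 2 P ≤ eLpNorm (functional N a ξ - X') 2 P

end Processes

section Formulas

variable {T r : ℕ} (γ : Pattern r) (f g : ℝ → Matrix (Fin T) (Fin T) ℂ) (N : ℕ)
  (a : ℕ → Fin T → ℂ)

/-- `|β|² / χ(e^{-iθ}) · g p⁻¹`. -/
def kernelT (θ : ℝ) : Matrix (Fin T) (Fin T) ℂ :=
  (((‖γ.beta θ‖ ^ 2 : ℝ) : ℂ) / γ.chi θ) • (g θ * (obsDensity γ f g θ)⁻¹)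

/-- `|β|² / |χ|² · p⁻¹`. -/
def kernelP (θ : ℝ) : Matrix (Fin T) (Fin T) ℂ := γ.weight θ • (obsDensity γ f g θ)⁻¹

/-- `f p⁻¹ g`. -/
def kernelQ (θ : ℝ) : Matrix (Fin T) (Fin T) ℂ := f θ * (obsDensity γ f g θ)⁻¹ * g θ

/-- The block matrix with blocks `(1/2π) ∫ e^{iθ(k-j)} K(θ)ᵀ dθ`, `0 ≤ j, k < M`. -/
def blockFourier (K : ℝ → Matrix (Fin T) (Fin T) ℂ) (M : ℕ) :
    Matrix (Fin M × Fin T) (Fin M × Fin T) ℂ :=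
  fun jp kq => ∫ θ, ex ((kq.1 : ℤ) - (jp.1 : ℤ)) θ * K θ kq.2 jp.2 ∂circle

def matT : Matrix (Fin (N + γ.n + 1) × Fin T) (Fin (N + γ.n + 1) × Fin T) ℂ :=
  blockFourier (kernelT γ f g) (N + γ.n + 1)

def matP : Matrix (Fin (N + γ.n + 1) × Fin T) (Fin (N + γ.n + 1) × Fin T) ℂ :=
  blockFourier (kernelP γ f g) (N + γ.n + 1)

def matQ : Matrix (Fin (N + 1) × Fin T) (Fin (N + 1) × Fin T) ℂ :=
  blockFourier (kernelQ γ f g) (N + 1)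

/-- The vector `(a(0), …, a(N))`. -/
def aStack : Fin (N + 1) × Fin T → ℂ := fun k => a k.1 k.2

/-- The vector `(a(0), …, a(N), 0, …, 0)` with `n` zero blocks. -/
def aPadded : Fin (N + γ.n + 1) × Fin T → ℂ := fun k => if (k.1 : ℕ) ≤ N then a k.1 k.2 else 0

/-- The vector `[D a]`, i.e. `(b_N(0), …, b_N(N), 0, …, 0)` with `n` zero blocks. -/
def bPadded : Fin (N + γ.n + 1) × Fin T → ℂ :=
  fun k => if (k.1 : ℕ) ≤ N then bvec γ N a k.1 k.2 else 0

/-- The right hand side `[D a] - T a` of the linear system. -/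
def rhs : Fin (N + γ.n + 1) × Fin T → ℂ :=
  bPadded γ N a - matT γ f g N *ᵥ aPadded γ N a

/-- The coefficients `c = P⁻¹ ([D a] - T a)`. -/
def cvec : Fin (N + γ.n + 1) × Fin T → ℂ := (matP γ f g N)⁻¹ *ᵥ rhs γ f g N a

/-- `A_N(e^{iθ})`. -/
def polyA (θ : ℝ) : Fin T → ℂ := ∑ k ∈ Finset.range (N + 1), ex k θ • a k

/-- `B_N(e^{iθ})`. -/
def polyB (θ : ℝ) : Fin T → ℂ := ∑ k ∈ Finset.range (N + 1), ex k θ • bvec γ N a k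

/-- `C_N(e^{iθ})`. -/
def polyC (θ : ℝ) : Fin T → ℂ := fun p => ∑ k : Fin (N + γ.n + 1), ex (k : ℕ) θ * cvec γ f g N a (k, p)

/-- The spectral characteristic
`hᵀ = Bᵀ χ / β - conj(β) Aᵀ g p⁻¹ - (conj(β) / conj(χ)) Cᵀ p⁻¹`. -/
def specChar (θ : ℝ) : Fin T → ℂ :=
  (γ.chi θ / γ.beta θ) • polyB γ N a θ
    - star (γ.beta θ) • (polyA N a θ ᵥ* (g θ * (obsDensity γ f g θ)⁻¹))
    - (star (γ.beta θ) / star (γ.chi θ)) • (polyC γ f g N a θ ᵥ* (obsDensity γ f g θ)⁻¹)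

/-- The contribution of `ξ` to the density of the mean square error:
`|β|² / |χ|² · U p⁻¹ f p⁻¹ U*` with `U = conj(χ) Aᵀ g + Cᵀ`. -/
def errXi (θ : ℝ) : ℂ :=
  let U : Fin T → ℂ := star (γ.chi θ) • (polyA N a θ ᵥ* g θ) + polyC γ f g N a θ
  γ.weight θ *
    ((U ᵥ* ((obsDensity γ f g θ)⁻¹ * f θ * (obsDensity γ f g θ)⁻¹)) ⬝ᵥ star U)

/-- The contribution of `η` to the density of the mean square error:
`1 / |χ|² · W p⁻¹ g p⁻¹ W*` with `W = conj(χ) Aᵀ f - |β|² Cᵀ`. -/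
def errEta (θ : ℝ) : ℂ :=
  let W : Fin T → ℂ := star (γ.chi θ) • (polyA N a θ ᵥ* f θ)
    - ((‖γ.beta θ‖ ^ 2 : ℝ) : ℂ) • polyC γ f g N a θ
  ((1 / ‖γ.chi θ‖ ^ 2 : ℝ) : ℂ) *
    ((W ᵥ* ((obsDensity γ f g θ)⁻¹ * g θ * (obsDensity γ f g θ)⁻¹)) ⬝ᵥ star W)

end Formulas

end GMInterpolation

end

/-!
The increments `χζ` of the observed sequence are modelled in a weighted `L₂` space over the circle,
where the prediction problem becomes the computation of an orthogonal projection.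

Put `p = f + |β|² g`. A row vector function `φ` is represented by `φᵀ p^{1/2}` in the unweighted
Hilbert space of square integrable vector functions, so that `⟪φ, ψ⟫ = ∫ ψᵀ p conj φ`. The functions
`e^{imθ} χ / β e_l` have the same Gram matrix as the increments `χζ_l(m)` in `L₂(P)`, and they are
total: a function orthogonal to all of them gives an integrable function all of whose Fourier
coefficients vanish. Hence there is a unique linear isometry `U` into `L₂(P)` that matches the two
families (`ObservedModel.exists_isometry`). It yields a stochastic measure by `Z(A)_k = U(1_A e_k)`
(`exists_isSpectralMeasure`); conversely integration against any spectral measure is an isometry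
with the same values on the total family, so it is `U` (`represents_of_isSpectralMeasure`).

Because `D` inverts the increment operator as a power series, `A_N ξ + V_N ζ` is the difference of
`∑ b(k)ᵀ χζ(k)` and `A_N η` (`target_eq`). Modulo the initial term, the optimal estimate is
therefore the projection of this square integrable variable on the closed span of the observed
increments. The adjoint of `U` takes `A_N η` to `Aᵀ g conj(β) p⁻¹` (`inner_isometry_noise`). Under
minimality the orthogonal complement of the observed increments consists exactly of the functions
`(conj(β) / conj(χ)) Cᵀ p⁻¹` with a trigonometric polynomial `C` of degrees `0, …, N + n`
(`exists_eq_sum_dualRow`), since `e^{ikθ} (conj(β) / conj(χ)) p⁻¹` is biorthogonal to the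
increments. The matrix `P` is the Gram matrix of these functions, nonsingular because of that
biorthogonality, and `T` is their mixed Gram matrix with the noise terms, so `P c = [Da] - T a` says
that `h` is orthogonal to the complement (`inner_dual_specChar`), i.e. that `h` is the projection.

The residual is `U` applied to the `C`-term minus the part of `A_N η` orthogonal to the range of
`U`, so the mean square error is `⟨P c, c⟩ + ⟨Q a, a⟩` (`inner_residual_self`). The spectral form of the
error follows from the pointwise identity `GoodPoint.errXi_add_errEta`, which says that its two
integrands add up to `C (|β|² / |χ|²) p⁻¹ C* + A f p⁻¹ g A*`.
-/

noncomputable section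

namespace GMInterpolation

/-! ### Square roots of matrices and isometries with prescribed values -/

section
open scoped MatrixOrder Matrix.Norms.L2Operator

/-- The positive square root of `|A| = (Aᴴ A)^{1/2}`. For a positive semidefinite `A` it is the
square root of `A`; in this form it depends continuously on every matrix `A`, so that roots of
measurable densities are measurable. -/
def matrixRoot {T : ℕ} (A : Matrix (Fin T) (Fin T) ℂ) : Matrix (Fin T) (Fin T) ℂ :=
  CFC.sqrt (CFC.sqrt (Aᴴ * A))

theorem matrixRoot_mul_self {T : ℕ} {A : Matrix (Fin T) (Fin T) ℂ} (hA : A.PosSemidef) :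
    matrixRoot A * matrixRoot A = A := by
  rw [matrixRoot, CFC.sqrt_mul_sqrt_self _ (CFC.sqrt_nonneg _), hA.1.eq,
    CFC.sqrt_mul_self A hA.nonneg]

theorem conjTranspose_matrixRoot {T : ℕ} (A : Matrix (Fin T) (Fin T) ℂ) :
    (matrixRoot A)ᴴ = matrixRoot A :=
  (CFC.sqrt_nonneg (CFC.sqrt (Aᴴ * A))).posSemidef.1

theorem continuous_matrixRoot {T : ℕ} :
    Continuous (matrixRoot : Matrix (Fin T) (Fin T) ℂ → Matrix (Fin T) (Fin T) ℂ) := by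
  have h : ∀ F : Matrix (Fin T) (Fin T) ℂ → Matrix (Fin T) (Fin T) ℂ, Continuous F →
      (∀ A, 0 ≤ F A) → Continuous fun A => CFC.sqrt (F A) := by
    intro F hF h0
    simp_rw [CFC.sqrt_eq_cfc]
    exact Continuous.cfc_nnreal_of_mem_nhdsSet (s := Set.univ) _ (by simp) hF h0
      (by fun_prop)
  exact h _ (h _ (by fun_prop) fun A => (posSemidef_conjTranspose_mul_self A).nonneg)
    fun A => CFC.sqrt_nonneg _

end

section
variable {I E F : Type*} [NormedAddCommGroup E] [InnerProductSpace ℂ E]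
  [NormedAddCommGroup F] [InnerProductSpace ℂ F] [CompleteSpace F]

/-- Families with the same Gram matrix, the first of them total, are matched by an isometry. -/
theorem exists_linearIsometry_of_gram_eq (x : I → E) (y : I → F)
    (hx : (Submodule.span ℂ (Set.range x)).topologicalClosure = ⊤)
    (h : ∀ i j, inner ℂ (x i) (x j) = inner ℂ (y i) (y j)) :
    ∃ U : E →ₗᵢ[ℂ] F, ∀ i, U (x i) = y i := by
  set e := Finsupp.linearCombination ℂ x
  set f := Finsupp.linearCombination ℂ y
  have hinner : ∀ c, inner ℂ (e c) (e c) = inner ℂ (f c) (f c) := by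
    intro c
    simp only [e, f, Finsupp.linearCombination_apply, Finsupp.sum, sum_inner, inner_sum,
      inner_smul_left, inner_smul_right, h]
  have hnorm : ∀ c, ‖f c‖ = ‖e c‖ := by
    intro c
    rw [@norm_eq_sqrt_re_inner ℂ, @norm_eq_sqrt_re_inner ℂ, hinner]
  have hd : DenseRange e := by
    have : (Set.range e) = (Submodule.span ℂ (Set.range x) : Set E) := by
      rw [← Finsupp.range_linearCombination]; rfl
    rw [DenseRange, this]
    exact Submodule.dense_iff_topologicalClosure_eq_top.2 hx
  have hb : ∃ C : ℝ, ∀ c, ‖f c‖ ≤ C * ‖e c‖ := ⟨1, fun c => by rw [hnorm, one_mul]⟩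
  have heq := LinearMap.extendOfNorm_eq hd hb
  refine ⟨⟨(f.extendOfNorm e).toLinearMap, fun z => ?_⟩, fun i => ?_⟩
  · refine hd.induction_on (p := fun z => ‖f.extendOfNorm e z‖ = ‖z‖) z
      (isClosed_eq (by fun_prop) (by fun_prop)) fun c => ?_
    rw [heq, hnorm]
  · have := heq (Finsupp.single i 1)
    simpa [e, f] using this

omit [CompleteSpace F] in
theorem linearIsometry_ext_of_dense {U V : E →ₗᵢ[ℂ] F} {x : I → E}
    (hx : (Submodule.span ℂ (Set.range x)).topologicalClosure = ⊤)
    (h : ∀ i, U (x i) = V (x i)) : U = V := by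
  have : U.toContinuousLinearMap = V.toContinuousLinearMap :=
    ContinuousLinearMap.ext_on (Submodule.dense_iff_topologicalClosure_eq_top.2 hx) (by
      rintro _ ⟨i, rfl⟩; exact h i)
  ext z
  exact congrArg (fun L : E →L[ℂ] F => L z) this
end

/-! ### Fourier series on the circle -/

instance : IsProbabilityMeasure circle := by
  constructor
  have := Real.pi_pos
  simp only [circle, Measure.smul_apply, Measure.restrict_apply MeasurableSet.univ,
    Set.univ_inter, Real.volume_Ico, smul_eq_mul]
  rw [← ENNReal.ofReal_mul (by positivity)]
  simp
  field_simp; ring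

theorem circle_absolutelyContinuous : circle ≪ volume :=
  Measure.smul_absolutelyContinuous.trans Measure.restrict_le_self.absolutelyContinuous

theorem integral_circle (F : ℝ → ℂ) : ∫ θ, F θ ∂circle =
    (1 / (2 * Real.pi) : ℝ) • ∫ θ in (-Real.pi)..Real.pi, F θ := by
  have := Real.pi_pos
  rw [circle, integral_smul_measure, intervalIntegral.integral_of_le (by linarith),
    ENNReal.toReal_ofReal (by positivity), integral_Ico_eq_integral_Ioc]

theorem ex_add (m k : ℤ) (θ : ℝ) : ex (m + k) θ = ex m θ * ex k θ := by
  simp only [ex, ← Complex.exp_add]; congr 1; push_cast; ring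

@[simp] theorem ex_zero (θ : ℝ) : ex 0 θ = 1 := by simp [ex]

theorem star_ex (m : ℤ) (θ : ℝ) : star (ex m θ) = ex (-m) θ := by
  simp only [ex, Complex.star_def, ← Complex.exp_conj]
  simp

@[simp] theorem norm_ex (m : ℤ) (θ : ℝ) : ‖ex m θ‖ = 1 := by
  rw [ex, show Complex.I * m * θ = ((m * θ : ℝ) : ℂ) * Complex.I by push_cast; ring,
    Complex.norm_exp_ofReal_mul_I]

@[fun_prop] theorem continuous_ex (m : ℤ) : Continuous (ex m) := by
  unfold ex; fun_prop

theorem integral_ex (m : ℤ) : ∫ θ, ex m θ ∂circle = if m = 0 then 1 else 0 := by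
  have := Real.pi_pos
  split_ifs with h
  · simp [h]
  · have hm : Complex.I * m ≠ 0 := by simp [h]
    rw [integral_circle]
    simp only [ex]
    rw [integral_exp_mul_complex hm]
    have h2 : Complex.exp (Complex.I * m * (Real.pi : ℝ)) =
        Complex.exp (Complex.I * m * ((-Real.pi : ℝ) : ℂ)) := by
      rw [Complex.exp_eq_exp_iff_exists_int]
      exact ⟨m, by push_cast; ring⟩
    rw [h2]; simp

/-- Uniqueness of Fourier coefficients in `L₁`: trigonometric polynomials are uniformly dense in the
continuous functions on the circle, and these contain the test functions on `(-π, π)`. -/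
theorem ae_eq_zero_of_fourier_eq_zero {F : ℝ → ℂ} (hF : Integrable F circle)
    (h : ∀ m : ℤ, ∫ θ, ex m θ * F θ ∂circle = 0) : F =ᵐ[circle] 0 := by
  have hpi := Real.pi_pos
  have : Fact (0 < 2 * Real.pi) := ⟨by positivity⟩
  -- integrals against all continuous functions on the circle vanish
  have hcont : ∀ G : C(AddCircle (2 * Real.pi), ℂ), ∫ θ, G (θ : AddCircle (2 * Real.pi)) * F θ ∂circle = 0 := by
    have hint : ∀ G : C(AddCircle (2 * Real.pi), ℂ),
        Integrable (fun θ : ℝ => G (θ : AddCircle (2 * Real.pi)) * F θ) circle := fun G =>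
      hF.bdd_mul (c := ‖G‖) (by
        exact (G.continuous.comp (AddCircle.continuous_mk' _)).aestronglyMeasurable)
        (Filter.Eventually.of_forall fun θ => G.norm_coe_le_norm _)
    let Λ : C(AddCircle (2 * Real.pi), ℂ) →ₗ[ℂ] ℂ :=
      { toFun := fun G => ∫ θ, G (θ : AddCircle (2 * Real.pi)) * F θ ∂circle
        map_add' := fun G G' => by
          simp only [ContinuousMap.add_apply, add_mul]
          exact integral_add (hint G) (hint G')
        map_smul' := fun c G => by
          simp only [ContinuousMap.smul_apply, smul_eq_mul, mul_assoc, RingHom.id_apply]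
          exact integral_const_mul _ _ }
    let Λ' : C(AddCircle (2 * Real.pi), ℂ) →L[ℂ] ℂ := Λ.mkContinuous (∫ θ, ‖F θ‖ ∂circle) fun G => by
      have h1 : ‖Λ G‖ ≤ ∫ θ, ‖G‖ * ‖F θ‖ ∂circle := by
        refine norm_integral_le_of_norm_le (hF.norm.const_mul _) (Filter.Eventually.of_forall fun θ => ?_)
        rw [norm_mul]
        exact mul_le_mul_of_nonneg_right (G.norm_coe_le_norm _) (norm_nonneg _)
      rw [integral_const_mul] at h1
      exact h1.trans_eq (mul_comm _ _)
    have hzero : Λ' = 0 := by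
      refine ContinuousLinearMap.ext_on
        (Submodule.dense_iff_topologicalClosure_eq_top.2 (span_fourier_closure_eq_top (T := 2 * Real.pi))) ?_
      rintro _ ⟨m, rfl⟩
      change ∫ θ, fourier m (θ : AddCircle (2 * Real.pi)) * F θ ∂circle = 0
      rw [← h m]
      congr 1; ext θ
      rw [fourier_coe_apply, ex]
      congr 2
      push_cast; field_simp
    intro G
    exact congrArg (fun L : C(AddCircle (2 * Real.pi), ℂ) →L[ℂ] ℂ => L G) hzero
  have hFv : IntegrableOn F (Set.Ioo (-Real.pi) Real.pi) := by
    rw [circle, integrable_smul_measure (by simp [hpi]) (by simp)] at hF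
    exact IntegrableOn.mono_set hF Set.Ioo_subset_Ico_self
  have key := isOpen_Ioo.ae_eq_zero_of_integral_contDiff_smul_eq_zero
    (hFv.locallyIntegrableOn) (fun φ hφ _ hsupp => ?_)
  · rw [circle]
    refine Measure.ae_smul_measure ?_ _
    rw [← restrict_Ioo_eq_restrict_Ico]
    exact (ae_restrict_iff' measurableSet_Ioo).2 key
  · have hout : ∀ x, x ∉ Set.Ioo (-Real.pi) Real.pi → φ x = 0 := fun x hx =>
      image_eq_zero_of_notMem_tsupport fun hx' => hx (hsupp hx')
    let G : C(AddCircle (2 * Real.pi), ℂ) :=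
      ⟨AddCircle.liftIco (2 * Real.pi) (-Real.pi) (fun x => (φ x : ℂ)),
        AddCircle.liftIco_continuous (by
          rw [hout _ (by simp), hout _ (by simp; intros; linarith)])
          (Complex.continuous_ofReal.comp hφ.continuous).continuousOn⟩
    have h1 := hcont G
    rw [circle, integral_smul_measure] at h1
    have h2 : ∫ θ in Set.Ico (-Real.pi) Real.pi, G (θ : AddCircle (2 * Real.pi)) * F θ = 0 := by
      refine (smul_eq_zero.1 h1).resolve_left ?_
      rw [ENNReal.toReal_ofReal (by positivity)]; positivity
    rw [← h2, ← setIntegral_eq_integral_of_forall_compl_eq_zero (s := Set.Ico (-Real.pi) Real.pi)]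
    · refine setIntegral_congr_fun measurableSet_Ico fun x hx => ?_
      have : G (x : AddCircle (2 * Real.pi)) = φ x :=
        AddCircle.liftIco_coe_apply (f := fun x => (φ x : ℂ))
          (show x ∈ Set.Ico (-Real.pi) (-Real.pi + 2 * Real.pi) by
            rwa [show -Real.pi + 2 * Real.pi = Real.pi by ring])
      simp [this]
    · intro x hx
      rw [hout x fun h' => hx (Set.Ioo_subset_Ico_self h'), zero_smul]

/-- An integrable function whose Fourier coefficients vanish outside `{0, …, M - 1}` is a
trigonometric polynomial with these degrees. -/
theorem ae_eq_trigPoly {F : ℝ → ℂ} (hF : Integrable F circle) (M : ℕ)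
    (h : ∀ m : ℤ, (m ≤ -1 ∨ (M : ℤ) ≤ m) → ∫ θ, ex (-m) θ * F θ ∂circle = 0) :
    ∃ c : Fin M → ℂ, F =ᵐ[circle] fun θ => ∑ k : Fin M, c k * ex (k : ℕ) θ := by
  let c : ℤ → ℂ := fun k => ∫ θ, ex (-k) θ * F θ ∂circle
  refine ⟨fun k => c (k : ℕ), ?_⟩
  have hint : ∀ k : Fin M, Integrable (fun θ => c (k : ℕ) * ex (k : ℕ) θ) circle := fun k =>
    Integrable.const_mul (Integrable.of_bound (C := 1) (by fun_prop) (by simp)) _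
  have hs : Integrable (fun θ => ∑ k : Fin M, c (k : ℕ) * ex (k : ℕ) θ) circle :=
    integrable_finsetSum _ fun k _ => hint k
  have := ae_eq_zero_of_fourier_eq_zero (hF.sub hs) fun m => ?_
  · filter_upwards [this] with θ hθ
    simpa [sub_eq_zero] using hθ
  · have hb : ∀ {G : ℝ → ℂ}, Integrable G circle → Integrable (fun θ => ex m θ * G θ) circle :=
      fun hG => hG.bdd_mul (c := 1) (by fun_prop) (by simp)
    simp only [Pi.sub_apply, mul_sub]
    rw [integral_sub (hb hF) (hb hs)]
    have : ∫ θ, ex m θ * ∑ k : Fin M, c (k : ℕ) * ex (k : ℕ) θ ∂circle =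
        ∑ k : Fin M, c (k : ℕ) * if m + (k : ℕ) = 0 then 1 else 0 := by
      simp only [Finset.mul_sum]
      rw [integral_finsetSum _ fun k _ => hb (hint k)]
      refine Finset.sum_congr rfl fun k _ => ?_
      rw [← integral_ex, ← integral_const_mul]
      congr 1; ext θ; rw [ex_add]; ring
    rw [this]
    by_cases hm : -m ≤ -1 ∨ (M : ℤ) ≤ -m
    · have h0 := h (-m) hm
      rw [neg_neg] at h0
      rw [h0, Finset.sum_eq_zero, sub_zero]
      intro k _
      rw [if_neg, mul_zero]
      have := k.2
      omega
    · have hk : (-m).toNat < M := by omega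
      rw [Finset.sum_eq_single ⟨(-m).toNat, hk⟩]
      · have : ((-m).toNat : ℤ) = -m := by omega
        simp [c, this]
      · intro k _ hk
        rw [if_neg, mul_zero]
        intro h'
        apply hk
        ext
        simp only
        omega
      · simp

/-! ### The space of vector functions with a matrix weight -/

section Weighted

variable {T : ℕ}

/-- The Hilbert space of square integrable vector functions on the circle. -/
abbrev VecL2 (T : ℕ) := Lp (EuclideanSpace ℂ (Fin T)) 2 circle

/-- A matrix density that is measurable, positive semidefinite and invertible almost everywhere. -/
structure IsRegularDensity (p : ℝ → Matrix (Fin T) (Fin T) ℂ) : Prop where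
  aesm : AEStronglyMeasurable p circle
  posSemidef : ∀ᵐ θ ∂circle, (p θ).PosSemidef
  isUnit : ∀ᵐ θ ∂circle, IsUnit (p θ).det

/-- The row `φᵀ p^{1/2}`, whose Euclidean norm is the norm of `φ` in the metric given by `p`. -/
def weightedVec (p : ℝ → Matrix (Fin T) (Fin T) ℂ) (φ : ℝ → Fin T → ℂ) (θ : ℝ) :
    EuclideanSpace ℂ (Fin T) :=
  WithLp.toLp 2 (φ θ ᵥ* matrixRoot (p θ))

/-- Membership of `φ` in `L₂(p)`. -/
abbrev MemWeighted (p : ℝ → Matrix (Fin T) (Fin T) ℂ) (φ : ℝ → Fin T → ℂ) : Prop :=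
  MemLp (weightedVec p φ) 2 circle

open Classical in
/-- The class of `φ ∈ L₂(p)` under the embedding `φ ↦ φᵀ p^{1/2}` into the unweighted space, and
`0` if `φ` is not in `L₂(p)`. -/
def emb (p : ℝ → Matrix (Fin T) (Fin T) ℂ) (φ : ℝ → Fin T → ℂ) : VecL2 T :=
  if h : MemWeighted p φ then h.toLp else 0

variable {p : ℝ → Matrix (Fin T) (Fin T) ℂ} {φ ψ : ℝ → Fin T → ℂ}

theorem emb_of_mem (h : MemWeighted p φ) : emb p φ = h.toLp := dif_pos h

theorem coeFn_emb (h : MemWeighted p φ) : emb p φ =ᵐ[circle] weightedVec p φ := by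
  rw [emb_of_mem h]; exact h.coeFn_toLp

theorem weightedVec_add : weightedVec p (φ + ψ) = weightedVec p φ + weightedVec p ψ := by
  ext θ i; simp [weightedVec, add_vecMul]

theorem weightedVec_smul (c : ℂ) : weightedVec p (c • φ) = c • weightedVec p φ := by
  ext θ i; simp [weightedVec, smul_vecMul]

theorem weightedVec_sub : weightedVec p (φ - ψ) = weightedVec p φ - weightedVec p ψ := by
  ext θ i; simp [weightedVec, sub_vecMul]

theorem weightedVec_zero : weightedVec p 0 = 0 := by
  ext θ i; simp [weightedVec]

theorem MemWeighted.add (h : MemWeighted p φ) (h' : MemWeighted p ψ) : MemWeighted p (φ + ψ) := by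
  rw [MemWeighted, weightedVec_add]; exact MemLp.add h h'

theorem MemWeighted.sub (h : MemWeighted p φ) (h' : MemWeighted p ψ) : MemWeighted p (φ - ψ) := by
  rw [MemWeighted, weightedVec_sub]; exact MemLp.sub h h'

theorem MemWeighted.smul (c : ℂ) (h : MemWeighted p φ) : MemWeighted p (c • φ) := by
  rw [MemWeighted, weightedVec_smul]; exact MemLp.const_smul h c

theorem memWeighted_zero : MemWeighted p 0 := by
  rw [MemWeighted, weightedVec_zero]; exact MemLp.zero

theorem memWeighted_sum {ι : Type*} (s : Finset ι) {F : ι → ℝ → Fin T → ℂ}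
    (h : ∀ i ∈ s, MemWeighted p (F i)) : MemWeighted p (∑ i ∈ s, F i) :=
  Finset.sum_induction _ _ (fun _ _ h h' => h.add h') memWeighted_zero h

theorem emb_add (h : MemWeighted p φ) (h' : MemWeighted p ψ) :
    emb p (φ + ψ) = emb p φ + emb p ψ := by
  rw [emb_of_mem h, emb_of_mem h', emb_of_mem (h.add h'), ← MemLp.toLp_add]
  congr 1; exact weightedVec_add

theorem emb_sub (h : MemWeighted p φ) (h' : MemWeighted p ψ) :
    emb p (φ - ψ) = emb p φ - emb p ψ := by
  rw [emb_of_mem h, emb_of_mem h', emb_of_mem (h.sub h'), ← MemLp.toLp_sub]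
  congr 1; exact weightedVec_sub

theorem emb_smul (c : ℂ) (h : MemWeighted p φ) : emb p (c • φ) = c • emb p φ := by
  rw [emb_of_mem h, emb_of_mem (h.smul c), ← MemLp.toLp_const_smul]
  congr 1; exact weightedVec_smul c

theorem emb_zero : emb p 0 = 0 := by
  rw [emb_of_mem memWeighted_zero]
  simp only [weightedVec_zero]; exact MemLp.toLp_zero _

theorem emb_sum {ι : Type*} (s : Finset ι) {F : ι → ℝ → Fin T → ℂ}
    (h : ∀ i ∈ s, MemWeighted p (F i)) : emb p (∑ i ∈ s, F i) = ∑ i ∈ s, emb p (F i) := by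
  classical
  induction s using Finset.induction_on with
  | empty => simp [emb_zero]
  | insert i s hi ih =>
    have hs : ∀ j ∈ s, MemWeighted p (F j) := fun j hj => h j (Finset.mem_insert_of_mem hj)
    rw [Finset.sum_insert hi, Finset.sum_insert hi,
      emb_add (h i (Finset.mem_insert_self _ _)) (memWeighted_sum s hs), ih hs]

theorem inner_weightedVec {θ : ℝ} (hp : (p θ).PosSemidef) :
    inner ℂ (weightedVec p φ θ) (weightedVec p ψ θ) = ψ θ ⬝ᵥ (p θ *ᵥ star (φ θ)) := by
  rw [weightedVec, weightedVec, EuclideanSpace.inner_toLp_toLp, star_vecMul,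
    conjTranspose_matrixRoot, ← dotProduct_mulVec, mulVec_mulVec, matrixRoot_mul_self hp]

theorem aestronglyMeasurable_vec {n : ℕ} {φ : ℝ → Fin n → ℂ} {μ : Measure ℝ}
    (h : ∀ i, AEStronglyMeasurable (fun θ => φ θ i) μ) : AEStronglyMeasurable φ μ :=
  (aemeasurable_pi_iff.2 fun i => (h i).aemeasurable).aestronglyMeasurable

theorem aestronglyMeasurable_matrix {n : ℕ} {M : ℝ → Matrix (Fin n) (Fin n) ℂ} {μ : Measure ℝ}
    (h : ∀ i j, AEStronglyMeasurable (fun θ => M θ i j) μ) : AEStronglyMeasurable M μ := by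
  have : AEStronglyMeasurable (fun θ => (M θ : Fin n → Fin n → ℂ)) μ :=
    (aemeasurable_pi_iff.2 fun i => aemeasurable_pi_iff.2 fun j =>
      (h i j).aemeasurable).aestronglyMeasurable
  exact this

theorem aestronglyMeasurable_weightedVec (hp : AEStronglyMeasurable p circle)
    (hφ : AEStronglyMeasurable φ circle) : AEStronglyMeasurable (weightedVec p φ) circle := by
  have hc : Continuous fun x : (Fin T → ℂ) × Matrix (Fin T) (Fin T) ℂ =>
      (WithLp.toLp 2 (x.1 ᵥ* matrixRoot x.2) : EuclideanSpace ℂ (Fin T)) :=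
    (PiLp.continuous_toLp 2 _).comp
      (continuous_fst.matrix_vecMul (continuous_matrixRoot.comp continuous_snd))
  exact hc.comp_aestronglyMeasurable (hφ.prodMk hp)

theorem memWeighted_of_integrable (hp : AEStronglyMeasurable p circle)
    (hpos : ∀ᵐ θ ∂circle, (p θ).PosSemidef) (hφ : AEStronglyMeasurable φ circle)
    (h : Integrable (fun θ => φ θ ⬝ᵥ (p θ *ᵥ star (φ θ))) circle) : MemWeighted p φ := by
  refine (memLp_two_iff_integrable_sq_norm (aestronglyMeasurable_weightedVec hp hφ)).2 ?_
  refine h.re.congr ?_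
  filter_upwards [hpos] with θ hθ
  rw [← inner_weightedVec hθ]
  exact inner_self_eq_norm_sq (𝕜 := ℂ) _

theorem integrable_quadratic (hpos : ∀ᵐ θ ∂circle, (p θ).PosSemidef) (hφ : MemWeighted p φ)
    (hψ : MemWeighted p ψ) : Integrable (fun θ => ψ θ ⬝ᵥ (p θ *ᵥ star (φ θ))) circle := by
  refine (L2.integrable_inner (𝕜 := ℂ) (emb p φ) (emb p ψ)).congr ?_
  filter_upwards [hpos, coeFn_emb hφ, coeFn_emb hψ] with θ h h1 h2
  rw [h1, h2, inner_weightedVec h]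

theorem inner_emb (hpos : ∀ᵐ θ ∂circle, (p θ).PosSemidef) (hφ : MemWeighted p φ)
    (hψ : MemWeighted p ψ) :
    inner ℂ (emb p φ) (emb p ψ) = ∫ θ, ψ θ ⬝ᵥ (p θ *ᵥ star (φ θ)) ∂circle := by
  rw [L2.inner_def]
  refine integral_congr_ae ?_
  filter_upwards [hpos, coeFn_emb hφ, coeFn_emb hψ] with θ h h1 h2
  rw [h1, h2, inner_weightedVec h]

theorem sqNorm_eq (hpos : ∀ᵐ θ ∂circle, (p θ).PosSemidef) :
    sqNorm p φ = eLpNorm (weightedVec p φ) 2 circle ^ 2 := by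
  have h2 := eLpNorm_nnreal_pow_eq_lintegral (μ := circle) (f := weightedVec p φ) (p := 2) (by simp)
  simp only [ENNReal.coe_ofNat, NNReal.coe_ofNat, ENNReal.rpow_ofNat] at h2
  rw [h2, sqNorm]
  refine lintegral_congr_ae ?_
  filter_upwards [hpos] with θ h
  rw [← inner_weightedVec (ψ := φ) h, ← ofReal_norm, ← ENNReal.ofReal_pow (norm_nonneg _)]
  congr 1
  exact inner_self_eq_norm_sq (𝕜 := ℂ) _

theorem sqNorm_eq_enorm (hpos : ∀ᵐ θ ∂circle, (p θ).PosSemidef) (h : MemWeighted p φ) :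
    sqNorm p φ = ‖emb p φ‖ₑ ^ 2 := by
  rw [sqNorm_eq hpos, emb_of_mem h, Lp.enorm_toLp]

/-- The row `φᵀ p` in terms of the element `ρ = φᵀ p^{1/2}`. -/
def dualVec (p : ℝ → Matrix (Fin T) (Fin T) ℂ) (ρ : VecL2 T) : ℝ → Fin T → ℂ :=
  fun θ => WithLp.ofLp (ρ θ) ᵥ* matrixRoot (p θ)

theorem inner_emb_left (hφ : MemWeighted p φ) (ρ : VecL2 T) :
    inner ℂ (emb p φ) ρ = ∫ θ, dualVec p ρ θ ⬝ᵥ star (φ θ) ∂circle ∧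
    Integrable (fun θ => dualVec p ρ θ ⬝ᵥ star (φ θ)) circle := by
  have h : (fun θ => inner ℂ (emb p φ θ) (ρ θ)) =ᵐ[circle]
      fun θ => dualVec p ρ θ ⬝ᵥ star (φ θ) := by
    filter_upwards [coeFn_emb hφ] with θ h1
    rw [h1, weightedVec, EuclideanSpace.inner_eq_star_dotProduct, star_vecMul,
      conjTranspose_matrixRoot, dotProduct_mulVec, dualVec]
  exact ⟨by rw [L2.inner_def]; exact integral_congr_ae h, (L2.integrable_inner _ _).congr h⟩

theorem isUnit_det_matrixRoot {A : Matrix (Fin T) (Fin T) ℂ} (hA : A.PosSemidef)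
    (h : IsUnit A.det) : IsUnit (matrixRoot A).det := by
  have h' := matrixRoot_mul_self hA
  generalize matrixRoot A = R at h' ⊢
  rw [← h', det_mul] at h
  exact isUnit_of_mul_isUnit_left h

/-- As `p` is invertible almost everywhere, every element of the unweighted space is determined by
its `dualVec`. -/
theorem eq_emb_of_dualVec_eq (hp : IsRegularDensity p) (ρ : VecL2 T)
    (h : dualVec p ρ =ᵐ[circle] fun θ => φ θ ᵥ* p θ) : MemWeighted p φ ∧ ρ = emb p φ := by
  have hv : ρ =ᵐ[circle] weightedVec p φ := by
    filter_upwards [h, hp.posSemidef, hp.isUnit] with θ h1 h2 h3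
    have hu := isUnit_det_matrixRoot h2 h3
    have h5 : WithLp.ofLp (ρ θ) ᵥ* matrixRoot (p θ) =
        (φ θ ᵥ* matrixRoot (p θ)) ᵥ* matrixRoot (p θ) := by
      rw [vecMul_vecMul, matrixRoot_mul_self h2]; exact h1
    have h4 : WithLp.ofLp (ρ θ) = φ θ ᵥ* matrixRoot (p θ) :=
      vecMul_injective_of_isUnit ((isUnit_iff_isUnit_det _).2 hu) h5
    ext i
    simp [weightedVec, h4]
  have hm : MemWeighted p φ := (memLp_congr_ae hv).1 (Lp.memLp ρ)
  refine ⟨hm, ?_⟩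
  apply Lp.ext
  exact hv.trans (coeFn_emb hm).symm

end Weighted

/-! ### Stochastic integrals as isometries -/

section Stochastic

variable {T : ℕ} {p : ℝ → Matrix (Fin T) (Fin T) ℂ} {φ : ℝ → Fin T → ℂ}

theorem indicator_eq_sum (A : Set ℝ) (v : Fin T → ℂ) :
    A.indicator (fun _ => v) = ∑ k, v k • A.indicator fun _ => (Pi.single k 1 : Fin T → ℂ) := by
  ext θ l
  by_cases h : θ ∈ A
  · simp [h, Pi.single_apply]
  · simp [h]

theorem indicator_quadratic (A B : Set ℝ) (k l : Fin T) (θ : ℝ) :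
    B.indicator (fun _ => (Pi.single l 1 : Fin T → ℂ)) θ ⬝ᵥ
      (p θ *ᵥ star (A.indicator (fun _ => (Pi.single k 1 : Fin T → ℂ)) θ)) =
    (B ∩ A).indicator (fun θ => p θ l k) θ := by
  by_cases hA : θ ∈ A <;> by_cases hB : θ ∈ B <;>
    simp [hA, hB, Pi.star_single]

theorem memWeighted_indicator_single (hp : IsRegularDensity p) {A : Set ℝ} (hA : FiniteMass p A)
    (k : Fin T) : MemWeighted p (A.indicator fun _ => Pi.single k 1) := by
  refine memWeighted_of_integrable hp.aesm hp.posSemidef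
    (aestronglyMeasurable_const.indicator hA.1) ?_
  simp only [indicator_quadratic, Set.inter_self]
  exact (integrable_indicator_iff hA.1).2 (hA.2.2 k k)

theorem memWeighted_indicator (hp : IsRegularDensity p) {A : Set ℝ} (hA : FiniteMass p A)
    (v : Fin T → ℂ) : MemWeighted p (A.indicator fun _ => v) := by
  rw [indicator_eq_sum]
  exact memWeighted_sum _ fun k _ => (memWeighted_indicator_single hp hA k).smul _

theorem emb_indicator (hp : IsRegularDensity p) {A : Set ℝ} (hA : FiniteMass p A)
    (v : Fin T → ℂ) : emb p (A.indicator fun _ => v) =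
      ∑ k, v k • emb p (A.indicator fun _ => Pi.single k 1) := by
  rw [indicator_eq_sum, emb_sum _ fun k _ => (memWeighted_indicator_single hp hA k).smul _]
  exact Finset.sum_congr rfl fun k _ => emb_smul _ (memWeighted_indicator_single hp hA k)

/-- The element `1_A e_k` of `L₂(p)`. -/
def indicatorEmb (p : ℝ → Matrix (Fin T) (Fin T) ℂ) (i : {A : Set ℝ // FiniteMass p A} × Fin T) :
    VecL2 T := emb p ((i.1 : Set ℝ).indicator fun _ => Pi.single i.2 1)

/-- Almost all of the circle is covered by countably many sets on which `p` is bounded. The density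
`p` itself need not be integrable, so that `FiniteMass` can fail for the whole circle. -/
theorem exists_finiteMass_cover (hp : AEStronglyMeasurable p circle) :
    ∃ B : ℕ → Set ℝ, (∀ n A, MeasurableSet A → FiniteMass p (A ∩ B n)) ∧
      ∀ᵐ θ ∂circle, ∃ n, θ ∈ B n := by
  obtain ⟨q, hq, hpq⟩ := hp
  have hqm : ∀ k l, StronglyMeasurable fun θ => q θ k l := fun k l =>
    (continuous_id.matrix_elem k l).comp_stronglyMeasurable hq
  let C : ℕ → Set ℝ := fun n => {θ | ∀ k l, ‖q θ k l‖ ≤ n}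
  have hC : ∀ n, MeasurableSet (C n) := fun n => by
    simp only [C, Set.ofPred_forall]
    exact MeasurableSet.iInter fun k => MeasurableSet.iInter fun l =>
      measurableSet_le (hqm k l).norm.measurable measurable_const
  refine ⟨fun n => Set.Ico (-Real.pi) Real.pi ∩ C n, fun n A hA => ⟨?_, ?_, ?_⟩, ?_⟩
  · exact hA.inter (measurableSet_Ico.inter (hC n))
  · exact fun θ h => h.2.1
  · intro k l
    have hm : MeasurableSet (A ∩ (Set.Ico (-Real.pi) Real.pi ∩ C n)) :=
      hA.inter (measurableSet_Ico.inter (hC n))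
    have h : IntegrableOn (fun θ => q θ k l) (A ∩ (Set.Ico (-Real.pi) Real.pi ∩ C n)) circle := by
      refine Integrable.of_bound (C := n) (hqm k l).aestronglyMeasurable ?_
      exact (ae_restrict_iff' hm).2 (Filter.Eventually.of_forall fun θ h => h.2.2 k l)
    refine h.congr_fun_ae (ae_restrict_of_ae ?_)
    filter_upwards [hpq] with θ h
    rw [h]
  · have h1 : ∀ᵐ θ ∂circle, θ ∈ Set.Ico (-Real.pi) Real.pi :=
      Measure.ae_smul_measure (ae_restrict_mem measurableSet_Ico) _
    filter_upwards [h1] with θ h1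
    obtain ⟨n, hn⟩ := exists_nat_ge (∑ k, ∑ l, ‖q θ k l‖)
    refine ⟨n, h1, fun k l => le_trans ?_ hn⟩
    exact (Finset.single_le_sum (f := fun l => ‖q θ k l‖) (fun _ _ => norm_nonneg _)
      (Finset.mem_univ l)).trans (Finset.single_le_sum (f := fun k => ∑ l, ‖q θ k l‖)
        (fun _ _ => Finset.sum_nonneg fun _ _ => norm_nonneg _) (Finset.mem_univ k))

theorem span_indicatorEmb_dense (hp : IsRegularDensity p) :
    (Submodule.span ℂ (Set.range (indicatorEmb p))).topologicalClosure = ⊤ := by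
  rw [Submodule.topologicalClosure_eq_top_iff, Submodule.eq_bot_iff]
  intro ρ hρ
  have h0 : ∀ A, FiniteMass p A → ∀ k,
      ∫ θ, A.indicator (fun θ => dualVec p ρ θ k) θ ∂circle = 0 ∧
      Integrable (A.indicator fun θ => dualVec p ρ θ k) circle := by
    intro A hA k
    have h1 := inner_emb_left (memWeighted_indicator_single hp hA k) ρ
    have h2 : ∀ θ, dualVec p ρ θ ⬝ᵥ star (A.indicator (fun _ => (Pi.single k 1 : Fin T → ℂ)) θ)
        = A.indicator (fun θ => dualVec p ρ θ k) θ := by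
      intro θ
      by_cases h : θ ∈ A <;> simp [h, Pi.star_single]
    simp only [h2] at h1
    refine ⟨?_, h1.2⟩
    rw [← h1.1]
    exact (Submodule.mem_orthogonal _ _).1 hρ _ (Submodule.subset_span ⟨(⟨A, hA⟩, k), rfl⟩)
  obtain ⟨B, hB, hcov⟩ := exists_finiteMass_cover hp.aesm
  have hz : ∀ n k, (B n).indicator (fun θ => dualVec p ρ θ k) =ᵐ[circle] 0 := by
    intro n k
    have hBn : FiniteMass p (B n) := by simpa using hB n Set.univ MeasurableSet.univ
    refine (h0 _ hBn k).2.ae_eq_zero_of_forall_setIntegral_eq_zero fun A hA _ => ?_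
    rw [← integral_indicator hA, Set.indicator_indicator]
    exact (h0 _ (hB n A hA) k).1
  have hall : ∀ᵐ θ ∂circle, ∀ n k, (B n).indicator (fun θ => dualVec p ρ θ k) θ = 0 :=
    ae_all_iff.2 fun n => ae_all_iff.2 fun k => hz n k
  have := (eq_emb_of_dualVec_eq (φ := 0) hp ρ (by
    filter_upwards [hall, hcov] with θ h1 ⟨n, hn⟩
    ext k
    have := h1 n k
    rw [Set.indicator_of_mem hn] at this
    simp [this])).2
  rw [this, emb_zero]

variable {Ω : Type*} [MeasurableSpace Ω] {P : Measure Ω}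

/-- The isometry `V` is integration against `Z`: it sends `1_A e_k` to `Z(A)_k`. -/
def Represents (P : Measure Ω) (p : ℝ → Matrix (Fin T) (Fin T) ℂ) (V : VecL2 T →ₗᵢ[ℂ] Lp ℂ 2 P)
    (Z : Set ℝ → Fin T → Ω → ℂ) : Prop :=
  ∀ A, FiniteMass p A → ∀ k, V (emb p (A.indicator fun _ => Pi.single k 1)) =ᵐ[P] Z A k

theorem inner_toLp {X Y : Ω → ℂ} (hX : MemLp X 2 P) (hY : MemLp Y 2 P) :
    inner ℂ hX.toLp hY.toLp = ∫ ω, Y ω * star (X ω) ∂P := by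
  rw [L2.inner_def]
  refine integral_congr_ae ?_
  filter_upwards [hX.coeFn_toLp, hY.coeFn_toLp] with ω h1 h2
  rw [h1, h2]; rfl

theorem inner_indicatorEmb (hp : IsRegularDensity p) {A B : Set ℝ} (hA : FiniteMass p A)
    (hB : FiniteMass p B) (k l : Fin T) :
    inner ℂ (emb p (A.indicator fun _ => Pi.single k 1))
      (emb p (B.indicator fun _ => Pi.single l 1)) = ∫ θ in B ∩ A, p θ l k ∂circle := by
  rw [inner_emb hp.posSemidef (memWeighted_indicator_single hp hA k)
    (memWeighted_indicator_single hp hB l), ← integral_indicator (hB.1.inter hA.1)]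
  simp only [indicator_quadratic]

theorem IsStochasticMeasure.exists_represents (hp : IsRegularDensity p)
    {Z : Set ℝ → Fin T → Ω → ℂ} (hZ : IsStochasticMeasure P p Z) :
    ∃ V, Represents P p V Z := by
  obtain ⟨V, hV⟩ := exists_linearIsometry_of_gram_eq (indicatorEmb p)
    (fun i => (hZ.memLp i.1 i.1.2 i.2).toLp) (span_indicatorEmb_dense hp) (by
      rintro ⟨⟨A, hA⟩, k⟩ ⟨⟨B, hB⟩, l⟩
      rw [indicatorEmb, indicatorEmb, inner_indicatorEmb hp hA hB, inner_toLp, hZ.cov B A hB hA])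
  refine ⟨V, fun A hA k => ?_⟩
  have := hV (⟨A, hA⟩, k)
  rw [indicatorEmb] at this
  rw [this]
  exact MemLp.coeFn_toLp _

variable {Z : Set ℝ → Fin T → Ω → ℂ} {V : VecL2 T →ₗᵢ[ℂ] Lp ℂ 2 P}

theorem memWeighted_simple (hp : IsRegularDensity p) {J : ℕ} {A : Fin J → Set ℝ}
    (hA : ∀ j, FiniteMass p (A j)) (v : Fin J → Fin T → ℂ) :
    MemWeighted p (∑ j, (A j).indicator fun _ => v j) :=
  memWeighted_sum _ fun j _ => memWeighted_indicator hp (hA j) _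

theorem coeFn_sum {ι : Type*} (s : Finset ι) (F : ι → Lp ℂ 2 P) :
    (∑ i ∈ s, F i : Lp ℂ 2 P) =ᵐ[P] fun ω => ∑ i ∈ s, F i ω := by
  classical
  induction s using Finset.induction_on with
  | empty =>
    simp only [Finset.sum_empty]
    exact Lp.coeFn_zero ℂ 2 P
  | insert i s hi ih =>
    simp only [Finset.sum_insert hi]
    filter_upwards [Lp.coeFn_add (F i) (∑ i ∈ s, F i), ih] with ω h1 h2
    rw [h1, Pi.add_apply, h2]

theorem Represents.apply_simple (hp : IsRegularDensity p) (hV : Represents P p V Z) {J : ℕ}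
    {A : Fin J → Set ℝ} (hA : ∀ j, FiniteMass p (A j)) (v : Fin J → Fin T → ℂ) :
    V (emb p (∑ j, (A j).indicator fun _ => v j)) =ᵐ[P]
      fun ω => ∑ j, v j ⬝ᵥ fun l => Z (A j) l ω := by
  rw [emb_sum _ fun j _ => memWeighted_indicator hp (hA j) _, map_sum]
  refine (coeFn_sum _ _).trans ?_
  have h1 : ∀ j, V (emb p ((A j).indicator fun _ => v j)) =ᵐ[P]
      fun ω => v j ⬝ᵥ fun l => Z (A j) l ω := by
    intro j
    rw [emb_indicator hp (hA j), map_sum]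
    refine (coeFn_sum _ _).trans ?_
    have h2 : ∀ᵐ ω ∂P, ∀ k, (V (v j k • emb p ((A j).indicator fun _ => Pi.single k 1)) : Ω → ℂ) ω =
        v j k * Z (A j) k ω := ae_all_iff.2 fun k => by
      rw [map_smul]
      filter_upwards [hV (A j) (hA j) k,
        Lp.coeFn_smul (v j k) (V (emb p ((A j).indicator fun _ => Pi.single k 1)))] with ω h1 h2
      rw [h2, Pi.smul_apply, h1, smul_eq_mul]
    filter_upwards [h2] with ω h2
    simp only [h2, dotProduct]
  filter_upwards [ae_all_iff.2 h1] with ω h1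
  simp [h1]

theorem simple_apply {J : ℕ} (A : Fin J → Set ℝ) (v : Fin J → Fin T → ℂ) :
    (fun θ => φ θ - ∑ j, (A j).indicator (fun _ => v j) θ) =
      φ - ∑ j, (A j).indicator fun _ => v j := by
  ext θ l; simp

/-- Two approximations of `φ` enter the definition of the integral only through their distance to
`φ`, so that the integral is unique and is the value of the isometry. -/
theorem Represents.ae_eq_of_isStochasticIntegral (hp : IsRegularDensity p)
    (hV : Represents P p V Z) (hφ : MemWeighted p φ) {Y : Ω → ℂ}
    (h : IsStochasticIntegral P p Z φ Y) : V (emb p φ) =ᵐ[P] Y := by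
  obtain ⟨-, hY, happ⟩ := h
  have hle : ‖hY.toLp - V (emb p φ)‖ₑ ≤ 0 := by
    refine ENNReal.le_of_forall_pos_le_add fun ε hε _ => ?_
    set δ : ℝ≥0∞ := min 1 ((ε : ℝ≥0∞) / 2) with hδ
    have hδ0 : 0 < δ := by simp [hδ, hε.ne']
    -- `sqNorm` is a squared norm, while the distance in `L₂(P)` is not: `δ ^ 2 ≤ δ` serves both
    obtain ⟨J, A, v, hA, h1, h2⟩ := happ (δ ^ 2) (by positivity)
    set s := ∑ j, (A j).indicator fun _ => v j with hs
    have hsm : MemWeighted p s := memWeighted_simple hp hA v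
    rw [simple_apply, sqNorm_eq_enorm hp.posSemidef (hφ.sub hsm)] at h1
    have h3 : ‖emb p (φ - s)‖ₑ < δ := lt_of_pow_lt_pow_left' 2 h1
    have h4 : ‖hY.toLp - V (emb p s)‖ₑ < δ ^ 2 := by
      refine lt_of_eq_of_lt ?_ h2
      rw [Lp.enorm_def]
      refine eLpNorm_congr_ae ?_
      filter_upwards [Lp.coeFn_sub hY.toLp (V (emb p s)), hY.coeFn_toLp,
        hV.apply_simple hp hA v] with ω e1 e2 e3
      rw [e1, Pi.sub_apply, e2, e3]
    have h5 : δ ^ 2 ≤ δ := by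
      rw [pow_two]; exact mul_le_of_le_one_left' (min_le_left _ _)
    have h6 : ‖V (emb p s) - V (emb p φ)‖ₑ = ‖emb p (φ - s)‖ₑ := by
      rw [← map_sub, ← emb_sub hsm hφ, ← neg_sub φ s, ← neg_one_smul ℂ (φ - s),
        emb_smul _ (hφ.sub hsm)]
      simp only [enorm_eq_nnnorm, LinearIsometry.nnnorm_map]
      simp
    calc ‖hY.toLp - V (emb p φ)‖ₑ
        = ‖(hY.toLp - V (emb p s)) + (V (emb p s) - V (emb p φ))‖ₑ := by
          rw [sub_add_sub_cancel]
      _ ≤ ‖hY.toLp - V (emb p s)‖ₑ + ‖V (emb p s) - V (emb p φ)‖ₑ := enorm_add_le _ _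
      _ ≤ δ + δ := add_le_add (h4.le.trans h5) (h6 ▸ h3.le)
      _ ≤ ε / 2 + ε / 2 := add_le_add (min_le_right _ _) (min_le_right _ _)
      _ = 0 + ε := by rw [ENNReal.add_halves, zero_add]
  have : hY.toLp = V (emb p φ) := by
    rw [← sub_eq_zero, ← enorm_eq_zero]; exact le_antisymm hle bot_le
  rw [← this]; exact hY.coeFn_toLp

theorem Represents.isStochasticIntegral (hp : IsRegularDensity p)
    (hV : Represents P p V Z) (hm : ∀ l, AEMeasurable (fun θ => φ θ l) circle)
    (hφ : MemWeighted p φ) {Y : Ω → ℂ}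
    (h : V (emb p φ) =ᵐ[P] Y) : IsStochasticIntegral P p Z φ Y := by
  refine ⟨hm, (memLp_congr_ae h).1 (Lp.memLp _), fun ε hε => ?_⟩
  have hd : emb p φ ∈ closure (Submodule.span ℂ (Set.range (indicatorEmb p)) : Set (VecL2 T)) := by
    rw [← Submodule.topologicalClosure_coe, span_indicatorEmb_dense hp]; trivial
  obtain ⟨s, hs, hlt⟩ := EMetric.mem_closure_iff.1 hd (min 1 ε) (by simp [hε])
  obtain ⟨c, rfl⟩ := (Finsupp.mem_span_range_iff_exists_finsupp).1 hs
  let e := c.support.equivFin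
  let A : Fin c.support.card → Set ℝ := fun j => (e.symm j).1.1
  let v : Fin c.support.card → Fin T → ℂ := fun j => c (e.symm j).1 • Pi.single (e.symm j).1.2 1
  have hA : ∀ j, FiniteMass p (A j) := fun j => (e.symm j).1.1.2
  have heq : emb p (∑ j, (A j).indicator fun _ => v j) = c.sum fun i a => a • indicatorEmb p i := by
    rw [emb_sum _ fun j _ => memWeighted_indicator hp (hA j) _, Finsupp.sum,
      ← Finset.sum_coe_sort c.support, ← e.symm.sum_comp]
    refine Finset.sum_congr rfl fun j _ => ?_
    rw [indicatorEmb, ← emb_smul _ (memWeighted_indicator_single hp (e.symm j).1.1.2 _)]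
    congr 1
    ext θ l
    by_cases hθ : θ ∈ ((e.symm j).1.1 : Set ℝ) <;> simp [A, v, hθ]
  rw [← heq, edist_eq_enorm_sub, ← emb_sub hφ (memWeighted_simple hp hA v)] at hlt
  refine ⟨_, A, v, hA, ?_, ?_⟩
  · rw [simple_apply, sqNorm_eq_enorm hp.posSemidef (hφ.sub (memWeighted_simple hp hA v)), pow_two]
    exact (mul_le_of_le_one_left' (hlt.le.trans (min_le_left _ _))).trans_lt
      (hlt.trans_le (min_le_right _ _))
  · refine lt_of_eq_of_lt ?_ (hlt.trans_le (min_le_right _ _))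
    rw [← V.enorm_map, emb_sub hφ (memWeighted_simple hp hA v), map_sub, Lp.enorm_def]
    refine eLpNorm_congr_ae ?_
    filter_upwards [Lp.coeFn_sub (V (emb p φ)) (V (emb p (∑ j, (A j).indicator fun _ => v j))), h,
      hV.apply_simple hp hA v] with ω e1 e2 e3
    rw [e1, Pi.sub_apply, e2, e3]

end Stochastic

/-! ### The increment operator and its inverse -/

section PatternAlgebra

variable {r : ℕ} (γ : Pattern r)

/-- The increment operator as a polynomial in the backward shift. -/
def Pattern.poly : Polynomial ℂ :=
  ∏ i, (1 - Polynomial.X ^ (γ.μ i * γ.s i)) ^ (γ.d i)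

theorem Pattern.natDegree_poly_le : γ.poly.natDegree ≤ γ.n := by
  refine (Polynomial.natDegree_prod_le _ _).trans (Finset.sum_le_sum fun i _ => ?_)
  refine Polynomial.natDegree_pow_le.trans ?_
  rw [mul_comm]
  refine Nat.mul_le_mul_right _ ?_
  refine (Polynomial.natDegree_sub_le _ _).trans ?_
  simp

theorem Pattern.e_eq_zero {k : ℕ} (h : γ.n < k) : γ.e k = 0 :=
  Polynomial.coeff_eq_zero_of_natDegree_lt (γ.natDegree_poly_le.trans_lt h)

theorem Pattern.poly_eq_sum : γ.poly =
    ∑ l ∈ Fintype.piFinset (fun i => Finset.range (γ.d i + 1)),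
      Polynomial.monomial (∑ i, γ.μ i * γ.s i * l i)
        (∏ i, (-1 : ℂ) ^ (l i) * ((γ.d i).choose (l i) : ℂ)) := by
  have h : ∀ i, ((1 : Polynomial ℂ) - Polynomial.X ^ (γ.μ i * γ.s i)) ^ (γ.d i) =
      ∑ j ∈ Finset.range (γ.d i + 1), Polynomial.monomial (γ.μ i * γ.s i * j)
        ((-1 : ℂ) ^ j * ((γ.d i).choose j : ℂ)) := by
    intro i
    rw [sub_eq_neg_add, add_pow]
    refine Finset.sum_congr rfl fun j _ => ?_
    rw [← Polynomial.C_mul_X_pow_eq_monomial, neg_pow, pow_mul]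
    simp only [one_pow, mul_one, map_mul, map_pow, map_neg, map_one, map_natCast]
    ring
  rw [Pattern.poly, Finset.prod_congr rfl fun i _ => h i, Finset.prod_univ_sum]
  refine Finset.sum_congr rfl fun l _ => ?_
  simp only [← Polynomial.C_mul_X_pow_eq_monomial, Finset.prod_mul_distrib, map_prod, map_mul]
  rw [Finset.prod_pow_eq_pow_sum]

theorem Pattern.incr_eq_sum {Ω : Type*} {T : ℕ} (x : ℤ → Fin T → Ω → ℂ) (m : ℤ) (p : Fin T)
    (ω : Ω) : γ.incr x m p ω = ∑ j ∈ Finset.range (γ.n + 1), γ.e j * x (m - j) p ω := by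
  let Φ : Polynomial ℂ →ₗ[ℂ] ℂ := Polynomial.lsum fun j => (LinearMap.id : ℂ →ₗ[ℂ] ℂ).smulRight (x (m - j) p ω)
  have hΦ : ∀ q : Polynomial ℂ, Φ q = q.sum fun j a => a * x (m - j) p ω := fun q => by
    simp [Φ, Polynomial.lsum_apply]
  have h1 : Φ γ.poly = ∑ j ∈ Finset.range (γ.n + 1), γ.e j * x (m - j) p ω := by
    rw [hΦ, Polynomial.sum_over_range' _ (by simp) _ (Nat.lt_succ_of_le γ.natDegree_poly_le)]
    rfl
  rw [← h1, γ.poly_eq_sum, map_sum, Pattern.incr]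
  refine Finset.sum_congr rfl fun l _ => ?_
  rw [hΦ, Polynomial.sum_monomial_index _ _ (by simp)]
  push_cast
  rfl

theorem Pattern.chi_eq_sum (θ : ℝ) :
    γ.chi θ = ∑ j ∈ Finset.range (γ.n + 1), γ.e j * ex (-(j : ℤ)) θ := by
  have h : γ.chi θ = γ.poly.eval (Complex.exp (-(Complex.I * θ))) := by
    rw [Pattern.chi, Pattern.poly, Polynomial.eval_prod]
    refine Finset.prod_congr rfl fun i _ => ?_
    simp only [Polynomial.eval_pow, Polynomial.eval_sub, Polynomial.eval_one, Polynomial.eval_X,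
      ← Complex.exp_nat_mul]
    congr 3; ring
  rw [h, Polynomial.eval_eq_sum_range' (Nat.lt_succ_of_le γ.natDegree_poly_le)]
  refine Finset.sum_congr rfl fun j _ => ?_
  rw [← Complex.exp_nat_mul, ex]
  congr 2; push_cast; ring

theorem one_sub_X_pow_mul_mk {c : ℕ} (hc : 0 < c) :
    (1 - PowerSeries.X ^ c) * (PowerSeries.mk fun j => if c ∣ j then (1 : ℂ) else 0) = 1 := by
  ext k
  rw [sub_mul, one_mul, map_sub, PowerSeries.coeff_X_pow_mul', PowerSeries.coeff_mk,
    PowerSeries.coeff_one]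
  by_cases hk : c ≤ k
  · rw [if_pos hk, PowerSeries.coeff_mk, if_neg (by omega : k ≠ 0)]
    simp [Nat.dvd_sub_iff_left hk dvd_rfl]
  · rw [if_neg hk, sub_zero]
    by_cases h0 : k = 0
    · simp [h0]
    · rw [if_neg h0, if_neg fun h => hk (Nat.le_of_dvd (by omega) h)]

theorem Pattern.sum_e_mul_dcoef (k : ℕ) :
    ∑ ij ∈ Finset.HasAntidiagonal.antidiagonal k, γ.e ij.1 * γ.dcoef ij.2 = if k = 0 then 1 else 0 := by
  have h : (γ.poly : PowerSeries ℂ) * ∏ i, (PowerSeries.mk fun j =>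
      if γ.μ i * γ.s i ∣ j then (1 : ℂ) else 0) ^ (γ.d i) = 1 := by
    have h1 : (γ.poly : PowerSeries ℂ) =
        ∏ i, (1 - PowerSeries.X ^ (γ.μ i * γ.s i)) ^ (γ.d i) := by
      rw [Pattern.poly, ← Polynomial.coeToPowerSeries.ringHom_apply, map_prod]
      simp
    rw [h1, ← Finset.prod_mul_distrib]
    refine Finset.prod_eq_one fun i _ => ?_
    rw [← mul_pow, one_sub_X_pow_mul_mk (Nat.mul_pos (γ.μ_pos i) (γ.s_pos i)), one_pow]
  have h2 := congrArg (PowerSeries.coeff k) h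
  rw [PowerSeries.coeff_mul, PowerSeries.coeff_one] at h2
  rw [← h2]
  refine Finset.sum_congr rfl fun ij _ => ?_
  rw [Polynomial.coeff_coe]; rfl

theorem Pattern.sum_Icc_e_mul_dcoef {m M : ℕ} (h : m ≤ M) :
    ∑ k ∈ Finset.Icc m M, γ.e (k - m) * γ.dcoef (M - k) = if M = m then 1 else 0 := by
  have h1 := γ.sum_e_mul_dcoef (M - m)
  rw [Finset.Nat.sum_antidiagonal_eq_sum_range_succ (fun i j => γ.e i * γ.dcoef j)] at h1
  rw [← Finset.Ico_add_one_right_eq_Icc, Finset.sum_Ico_eq_sum_range, show M + 1 - m = (M - m).succ by omega]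
  rw [if_congr (show M - m = 0 ↔ M = m by omega) rfl rfl] at h1
  rw [← h1]
  refine Finset.sum_congr rfl fun k _ => ?_
  congr 2 <;> omega

/-- The increment at time `k ≥ 0`, split into the values at nonnegative and at negative times. -/
theorem Pattern.sum_e_split (y : ℤ → ℂ) (k : ℕ) :
    ∑ j ∈ Finset.range (γ.n + 1), γ.e j * y (k - j) =
      ∑ m ∈ Finset.range (k + 1), γ.e (k - m) * y m +
        ∑ i ∈ Finset.Icc 1 γ.n, γ.e (i + k) * y (-(i : ℤ)) := by
  have h1 : ∑ j ∈ Finset.range (γ.n + 1), γ.e j * y (k - j) =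
      ∑ j ∈ Finset.range (k + 1 + γ.n), γ.e j * y (k - j) := by
    refine Finset.sum_subset (fun j hj => ?_) fun j _ hj => ?_
    · simp only [Finset.mem_range] at hj ⊢; omega
    · rw [γ.e_eq_zero (by simpa using hj), zero_mul]
  rw [h1, Finset.sum_range_add]
  congr 1
  · rw [← Finset.sum_range_reflect]
    refine Finset.sum_congr rfl fun j hj => ?_
    have := Finset.mem_range.1 hj
    congr 2; omega
  · rw [← Finset.Ico_add_one_right_eq_Icc, Finset.sum_Ico_eq_sum_range]
    refine Finset.sum_congr (by simp) fun j _ => ?_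
    congr 2
    · omega
    · push_cast; ring

/-- The increment operator inverts `D`. -/
theorem Pattern.sum_Icc_e_smul_bvec {T : ℕ} {N m : ℕ} (a : ℕ → Fin T → ℂ) (hm : m ≤ N) (p : Fin T) :
    ∑ k ∈ Finset.Icc m N, γ.e (k - m) * bvec γ N a k p = a m p := by
  simp only [bvec, Finset.sum_apply, Pi.smul_apply, smul_eq_mul, Finset.mul_sum]
  rw [Finset.sum_comm' (t' := Finset.Icc m N) (s' := fun M => Finset.Icc m M) (by
    intro x y; simp only [Finset.mem_Icc]; omega)]
  have h : ∀ M ∈ Finset.Icc m N, ∑ k ∈ Finset.Icc m M, γ.e (k - m) * (γ.dcoef (M - k) * a M p) =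
      (if M = m then 1 else 0) * a M p := by
    intro M hM
    rw [← γ.sum_Icc_e_mul_dcoef (Finset.mem_Icc.1 hM).1, Finset.sum_mul]
    exact Finset.sum_congr rfl fun k _ => by ring
  rw [Finset.sum_congr rfl h]
  simp [hm]

theorem vvec_eq_sum {T : ℕ} (N : ℕ) (a : ℕ → Fin T → ℂ) (i : ℕ) (p : Fin T) :
    vvec γ N a i p = ∑ k ∈ Finset.range (N + 1), γ.e (i + k) * bvec γ N a k p := by
  simp only [vvec, Finset.sum_apply, Pi.smul_apply, smul_eq_mul]
  refine (Finset.sum_congr rfl fun k _ => by rw [add_comm k i]).trans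
    (Finset.sum_subset (fun j hj => ?_) fun j hj hj' => ?_)
  · simp only [Finset.mem_range] at hj ⊢; omega
  · simp only [Finset.mem_range] at hj hj'
    rw [γ.e_eq_zero (by omega), zero_mul]

/-- Expressing a functional of the sequence through its increments and the initial values: the sum
of the increments with weights `b(k)` reproduces `A_N`, and the values at negative times that it
involves form `V_N`. -/
theorem functional_add_initialTerm {Ω : Type*} {T : ℕ} (N : ℕ) (a : ℕ → Fin T → ℂ)
    (x : ℤ → Fin T → Ω → ℂ) (ω : Ω) :
    functional N a x ω + initialTerm γ N a x ω =
      ∑ k ∈ Finset.range (N + 1), bvec γ N a k ⬝ᵥ fun p => γ.incr x k p ω := by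
  simp only [functional, initialTerm, dotProduct, vvec_eq_sum]
  rw [Finset.sum_comm, Finset.sum_comm (s := Finset.Icc 1 γ.n),
    Finset.sum_comm (s := Finset.range (N + 1)) (t := Finset.univ) (f := fun k p => bvec γ N a k p * _),
    ← Finset.sum_add_distrib]
  refine Finset.sum_congr rfl fun p _ => ?_
  simp only [γ.incr_eq_sum]
  simp only [γ.sum_e_split (fun m => x m p ω), mul_add, Finset.sum_add_distrib]
  congr 1
  · simp only [Finset.mul_sum]
    rw [Finset.sum_comm' (t' := Finset.range (N + 1)) (s' := fun m => Finset.Icc m N) (by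
      intro x y; simp only [Finset.mem_range, Finset.mem_Icc]; omega)]
    refine Finset.sum_congr rfl fun m hm => ?_
    rw [← γ.sum_Icc_e_smul_bvec a (Nat.lt_succ_iff.1 (Finset.mem_range.1 hm)) p, Finset.sum_mul]
    exact Finset.sum_congr rfl fun k _ => by ring
  · simp only [Finset.mul_sum, Finset.sum_mul]
    rw [Finset.sum_comm]
    exact Finset.sum_congr rfl fun k _ => Finset.sum_congr rfl fun i _ => by ring

@[fun_prop] theorem Pattern.continuous_chi : Continuous γ.chi := by
  unfold Pattern.chi; fun_prop

@[fun_prop] theorem Pattern.continuous_beta : Continuous γ.beta := by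
  unfold Pattern.beta; fun_prop

theorem ae_circle_of_countable {s : Set ℝ} (hs : s.Countable) : ∀ᵐ θ ∂circle, θ ∉ s :=
  circle_absolutelyContinuous.ae_le (measure_eq_zero_iff_ae_notMem.1 (hs.measure_zero volume))

theorem Pattern.ae_beta_ne_zero : ∀ᵐ θ ∂circle, γ.beta θ ≠ 0 := by
  have h : ({θ | γ.beta θ = 0} : Set ℝ).Countable := by
    refine Set.Countable.mono ?_ (Set.countable_range fun x : Fin r × ℤ => 2 * Real.pi * x.2 / γ.s x.1)
    intro θ hθ
    simp only [Set.mem_ofPred_eq, Pattern.beta, Finset.prod_eq_zero_iff] at hθ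
    obtain ⟨j, -, k, -, hk⟩ := hθ
    have hk := pow_eq_zero_iff (γ.d_pos j).ne' |>.1 hk
    refine ⟨(j, k), ?_⟩
    have h2 : Complex.I * (θ - 2 * Real.pi * k / γ.s j) = 0 := by rw [← hk]; ring
    have h3 := (mul_eq_zero.1 h2).resolve_left Complex.I_ne_zero
    have h4 : ((θ - 2 * Real.pi * k / γ.s j : ℝ) : ℂ) = 0 := by push_cast; exact h3
    have h5 := Complex.ofReal_eq_zero.1 h4
    simp only
    linarith
  exact ae_circle_of_countable h

theorem Pattern.ae_chi_ne_zero : ∀ᵐ θ ∂circle, γ.chi θ ≠ 0 := by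
  have h : ({θ | γ.chi θ = 0} : Set ℝ).Countable := by
    refine Set.Countable.mono ?_ (Set.countable_range fun x : Fin r × ℤ =>
      2 * Real.pi * x.2 / (γ.μ x.1 * γ.s x.1 : ℕ))
    intro θ hθ
    simp only [Set.mem_ofPred_eq, Pattern.chi, Finset.prod_eq_zero_iff] at hθ
    obtain ⟨j, -, hk⟩ := hθ
    have hk := pow_eq_zero_iff (γ.d_pos j).ne' |>.1 hk
    obtain ⟨k, hk⟩ := Complex.exp_eq_one_iff.1 (sub_eq_zero.1 hk).symm
    have hc : ((γ.μ j * γ.s j : ℕ) : ℝ) ≠ 0 := by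
      exact_mod_cast (Nat.mul_pos (γ.μ_pos j) (γ.s_pos j)).ne'
    refine ⟨(j, -k), ?_⟩
    have h2 : Complex.I * (θ * (γ.μ j * γ.s j : ℕ) + k * (2 * Real.pi)) = 0 := by
      linear_combination -hk
    have h3 := (mul_eq_zero.1 h2).resolve_left Complex.I_ne_zero
    have h4 : ((θ * (γ.μ j * γ.s j : ℕ) + k * (2 * Real.pi) : ℝ) : ℂ) = 0 := by
      push_cast at h3 ⊢; exact h3
    have h5 := Complex.ofReal_eq_zero.1 h4
    simp only
    rw [div_eq_iff hc]
    push_cast at h5 ⊢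
    linarith
  exact ae_circle_of_countable h

end PatternAlgebra

/-! ### Spectral characteristics of increments and noise -/

section Model

variable {T r : ℕ}

/-- The assumptions on the densities alone. -/
structure AdmissibleDensities (γ : Pattern r) (f g : ℝ → Matrix (Fin T) (Fin T) ℂ) : Prop where
  posSemidef_f : ∀ᵐ θ ∂circle, (f θ).PosSemidef
  integrable_f : ∀ p q, Integrable
    (fun θ => ((‖γ.chi θ‖ ^ 2 / ‖γ.beta θ‖ ^ 2 : ℝ) : ℂ) * f θ p q) circle
  posSemidef_g : ∀ᵐ θ ∂circle, (g θ).PosSemidef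
  integrable_g : ∀ p q, Integrable (fun θ => g θ p q) circle
  minimality : Minimality γ f g

/-- The values of the densities at a point where nothing degenerates. -/
structure GoodPoint (γ : Pattern r) (f g : ℝ → Matrix (Fin T) (Fin T) ℂ) (θ : ℝ) : Prop where
  chi_ne : γ.chi θ ≠ 0
  beta_ne : γ.beta θ ≠ 0
  posSemidef_f : (f θ).PosSemidef
  posSemidef_g : (g θ).PosSemidef
  isUnit : IsUnit (obsDensity γ f g θ).det

variable {γ : Pattern r} {f g : ℝ → Matrix (Fin T) (Fin T) ℂ}

theorem AdmissibleDensities.ae_goodPoint (h : AdmissibleDensities γ f g) :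
    ∀ᵐ θ ∂circle, GoodPoint γ f g θ := by
  filter_upwards [γ.ae_chi_ne_zero, γ.ae_beta_ne_zero, h.posSemidef_f, h.posSemidef_g,
    h.minimality.1] with θ h1 h2 h3 h4 h5
  exact ⟨h1, h2, h3, h4, h5⟩

namespace GoodPoint

variable {θ : ℝ} (h : GoodPoint γ f g θ)
include h

theorem posSemidef : (obsDensity γ f g θ).PosSemidef :=
  h.posSemidef_f.add (h.posSemidef_g.smul (by
    rw [Complex.zero_le_real]; positivity))

theorem isHermitian_inv : ((obsDensity γ f g θ)⁻¹)ᴴ = (obsDensity γ f g θ)⁻¹ := by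
  rw [conjTranspose_nonsing_inv, h.posSemidef.1.eq]

theorem normSq_beta_ne : ((‖γ.beta θ‖ ^ 2 : ℝ) : ℂ) ≠ 0 := by
  exact_mod_cast (pow_ne_zero 2 (norm_ne_zero_iff.2 h.beta_ne))

theorem mul_inv : obsDensity γ f g θ * (obsDensity γ f g θ)⁻¹ = 1 := mul_nonsing_inv _ h.isUnit

theorem inv_mul : (obsDensity γ f g θ)⁻¹ * obsDensity γ f g θ = 1 := nonsing_inv_mul _ h.isUnit

omit h in
theorem f_eq : f θ = obsDensity γ f g θ - ((‖γ.beta θ‖ ^ 2 : ℝ) : ℂ) • g θ := by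
  simp [obsDensity]

/-- `f p⁻¹ g = g - |β|² g p⁻¹ g`. -/
theorem kernelQ_eq : f θ * (obsDensity γ f g θ)⁻¹ * g θ =
    g θ - ((‖γ.beta θ‖ ^ 2 : ℝ) : ℂ) • (g θ * (obsDensity γ f g θ)⁻¹ * g θ) := by
  rw [f_eq (γ := γ) (f := f) (g := g) (θ := θ), sub_mul, sub_mul, h.mul_inv, one_mul]
  simp

/-- `g p⁻¹ f = f p⁻¹ g`: the parallel sum of `f` and `|β|² g` is symmetric. -/
theorem kernelQ_comm : g θ * (obsDensity γ f g θ)⁻¹ * f θ =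
    f θ * (obsDensity γ f g θ)⁻¹ * g θ := by
  rw [h.kernelQ_eq]
  conv_lhs => rw [f_eq (γ := γ) (f := f) (g := g) (θ := θ)]
  rw [mul_sub, mul_assoc, h.inv_mul, mul_one]
  simp

theorem kernelQ_split : ((‖γ.beta θ‖ ^ 2 : ℝ) : ℂ) •
      (g θ * ((obsDensity γ f g θ)⁻¹ * f θ * (obsDensity γ f g θ)⁻¹) * g θ) +
    f θ * ((obsDensity γ f g θ)⁻¹ * g θ * (obsDensity γ f g θ)⁻¹) * f θ =
    f θ * (obsDensity γ f g θ)⁻¹ * g θ := by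
  have h1 : f θ * ((obsDensity γ f g θ)⁻¹ * g θ * (obsDensity γ f g θ)⁻¹) * f θ =
      f θ * (obsDensity γ f g θ)⁻¹ * (f θ * (obsDensity γ f g θ)⁻¹ * g θ) := by
    rw [← h.kernelQ_comm]; simp only [mul_assoc]
  have h2 : f θ * (obsDensity γ f g θ)⁻¹ =
      1 - ((‖γ.beta θ‖ ^ 2 : ℝ) : ℂ) • (g θ * (obsDensity γ f g θ)⁻¹) := by
    rw [f_eq (γ := γ) (f := f) (g := g) (θ := θ), sub_mul, h.mul_inv, smul_mul_assoc]
  have h3 : f θ * (obsDensity γ f g θ)⁻¹ * (f θ * (obsDensity γ f g θ)⁻¹ * g θ) =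
      f θ * (obsDensity γ f g θ)⁻¹ * g θ - ((‖γ.beta θ‖ ^ 2 : ℝ) : ℂ) •
        (g θ * (obsDensity γ f g θ)⁻¹ * (f θ * (obsDensity γ f g θ)⁻¹ * g θ)) := by
    conv_lhs => rw [← mul_assoc, h2, mul_assoc, sub_mul, one_mul, ← h2, smul_mul_assoc]
  rw [h1, h3]
  simp only [mul_assoc, add_sub_cancel]

theorem inv_split : (obsDensity γ f g θ)⁻¹ * f θ * (obsDensity γ f g θ)⁻¹ +
    ((‖γ.beta θ‖ ^ 2 : ℝ) : ℂ) • ((obsDensity γ f g θ)⁻¹ * g θ * (obsDensity γ f g θ)⁻¹) =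
    (obsDensity γ f g θ)⁻¹ := by
  have : (obsDensity γ f g θ)⁻¹ * obsDensity γ f g θ * (obsDensity γ f g θ)⁻¹ =
    (obsDensity γ f g θ)⁻¹ := by rw [h.inv_mul, one_mul]
  conv_rhs => rw [← this]
  conv_rhs => arg 1; arg 2; rw [obsDensity]
  simp only [mul_add, add_mul, mul_smul_comm, smul_mul_assoc]

theorem posSemidef_kernelQ : (f θ * (obsDensity γ f g θ)⁻¹ * g θ).PosSemidef := by
  rw [← h.kernelQ_split]
  refine PosSemidef.add (PosSemidef.smul ?_ (by rw [Complex.zero_le_real]; positivity)) ?_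
  · have := h.posSemidef_f.mul_mul_conjTranspose_same (g θ * (obsDensity γ f g θ)⁻¹)
    rw [conjTranspose_mul, h.isHermitian_inv, h.posSemidef_g.1.eq] at this
    simpa only [mul_assoc] using this
  · have := h.posSemidef_g.mul_mul_conjTranspose_same (f θ * (obsDensity γ f g θ)⁻¹)
    rw [conjTranspose_mul, h.isHermitian_inv, h.posSemidef_f.1.eq] at this
    simpa only [mul_assoc] using this

end GoodPoint

theorem norm_le_norm_of_nonneg {a b : ℂ} (ha : 0 ≤ a) (hab : a ≤ b) : ‖a‖ ≤ ‖b‖ := by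
  have h1 := hab
  rw [Complex.eq_coe_norm_of_nonneg ha, Complex.eq_coe_norm_of_nonneg (ha.trans hab)] at h1
  exact_mod_cast h1

theorem aestronglyMeasurable_mul {M L : ℝ → Matrix (Fin T) (Fin T) ℂ}
    (hM : AEStronglyMeasurable M circle) (hL : AEStronglyMeasurable L circle) :
    AEStronglyMeasurable (fun θ => M θ * L θ) circle :=
  (Continuous.matrix_mul continuous_fst continuous_snd :
    Continuous fun x : Matrix (Fin T) (Fin T) ℂ × Matrix (Fin T) (Fin T) ℂ => x.1 * x.2
    ).comp_aestronglyMeasurable (hM.prodMk hL)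

theorem aestronglyMeasurable_vecMul {v : ℝ → Fin T → ℂ} {L : ℝ → Matrix (Fin T) (Fin T) ℂ}
    (hv : AEStronglyMeasurable v circle) (hL : AEStronglyMeasurable L circle) :
    AEStronglyMeasurable (fun θ => v θ ᵥ* L θ) circle :=
  (Continuous.matrix_vecMul continuous_fst continuous_snd :
    Continuous fun x : (Fin T → ℂ) × Matrix (Fin T) (Fin T) ℂ => x.1 ᵥ* x.2
    ).comp_aestronglyMeasurable (hv.prodMk hL)

theorem aestronglyMeasurable_dotProduct_star {v u : ℝ → Fin T → ℂ}
    (hv : AEStronglyMeasurable v circle) (hu : AEStronglyMeasurable u circle) :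
    AEStronglyMeasurable (fun θ => v θ ⬝ᵥ star (u θ)) circle :=
  (Continuous.dotProduct continuous_fst continuous_snd.star :
    Continuous fun x : (Fin T → ℂ) × (Fin T → ℂ) => x.1 ⬝ᵥ star x.2
    ).comp_aestronglyMeasurable (hv.prodMk hu)

theorem aestronglyMeasurable_apply {M : ℝ → Matrix (Fin T) (Fin T) ℂ}
    (hM : AEStronglyMeasurable M circle) (i j : Fin T) :
    AEStronglyMeasurable (fun θ => M θ i j) circle :=
  (continuous_id.matrix_elem i j).comp_aestronglyMeasurable hM

theorem aestronglyMeasurable_matrix_inv {M : ℝ → Matrix (Fin T) (Fin T) ℂ}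
    (hM : AEStronglyMeasurable M circle) : AEStronglyMeasurable (fun θ => (M θ)⁻¹) circle := by
  simp only [Matrix.inv_def, Ring.inverse_eq_inv']
  have h1 : AEStronglyMeasurable (fun θ => (M θ).det) circle :=
    continuous_id.matrix_det.comp_aestronglyMeasurable hM
  have h2 : AEStronglyMeasurable (fun θ => (M θ).adjugate) circle :=
    continuous_id.matrix_adjugate.comp_aestronglyMeasurable hM
  exact h1.aemeasurable.inv.aestronglyMeasurable.smul h2

namespace AdmissibleDensities

variable (h : AdmissibleDensities γ f g)
include h

theorem aesm_g : AEStronglyMeasurable g circle :=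
  aestronglyMeasurable_matrix fun i j => (h.integrable_g i j).aestronglyMeasurable

theorem aesm_f : AEStronglyMeasurable f circle := by
  refine aestronglyMeasurable_matrix fun i j => ?_
  have h1 : AEStronglyMeasurable (fun θ => ((‖γ.beta θ‖ ^ 2 / ‖γ.chi θ‖ ^ 2 : ℝ) : ℂ) *
      (((‖γ.chi θ‖ ^ 2 / ‖γ.beta θ‖ ^ 2 : ℝ) : ℂ) * f θ i j)) circle := by
    refine AEStronglyMeasurable.mul (Measurable.aestronglyMeasurable ?_)
      (h.integrable_f i j).aestronglyMeasurable
    exact Complex.measurable_ofReal.comp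
      (((γ.continuous_beta.norm.pow 2).measurable).div ((γ.continuous_chi.norm.pow 2).measurable))
  refine h1.congr ?_
  filter_upwards [γ.ae_chi_ne_zero, γ.ae_beta_ne_zero] with θ h2 h3
  have h2 := norm_ne_zero_iff.2 h2
  have h3 := norm_ne_zero_iff.2 h3
  rw [← mul_assoc, ← Complex.ofReal_mul, show (‖γ.beta θ‖ ^ 2 / ‖γ.chi θ‖ ^ 2) *
    (‖γ.chi θ‖ ^ 2 / ‖γ.beta θ‖ ^ 2) = 1 by field_simp, Complex.ofReal_one, one_mul]

theorem isRegularDensity : IsRegularDensity (obsDensity γ f g) where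
  aesm := by
    have h1 : AEStronglyMeasurable (fun θ => ((‖γ.beta θ‖ ^ 2 : ℝ) : ℂ)) circle :=
      (by fun_prop : Continuous (fun θ => ((‖γ.beta θ‖ ^ 2 : ℝ) : ℂ))).aestronglyMeasurable
    exact h.aesm_f.add (h1.smul h.aesm_g)
  posSemidef := h.ae_goodPoint.mono fun θ h => h.posSemidef
  isUnit := h.minimality.1

theorem aesm_inv : AEStronglyMeasurable (fun θ => (obsDensity γ f g θ)⁻¹) circle :=
  aestronglyMeasurable_matrix_inv h.isRegularDensity.aesm

end AdmissibleDensities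

/-- The `k`-th row of `M`, multiplied by the scalar function `c`. -/
def scaledRow (c : ℝ → ℂ) (M : ℝ → Matrix (Fin T) (Fin T) ℂ) (k : Fin T) : ℝ → Fin T → ℂ :=
  fun θ => c θ • M θ k

theorem scaledRow_quadratic (c d : ℝ → ℂ) (M L : ℝ → Matrix (Fin T) (Fin T) ℂ) (k l : Fin T)
    (A : Matrix (Fin T) (Fin T) ℂ) (θ : ℝ) :
    scaledRow d L l θ ⬝ᵥ (A *ᵥ star (scaledRow c M k θ)) =
      d θ * star (c θ) * (L θ * A * (M θ)ᴴ) l k := by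
  have h1 : (L θ * A * (M θ)ᴴ) l k = L θ l ⬝ᵥ (A *ᵥ star (M θ k)) := by
    rw [mul_assoc, Matrix.mul_apply]
    rfl
  rw [h1, scaledRow, scaledRow, star_smul, mulVec_smul, dotProduct_smul, smul_dotProduct]
  simp only [smul_eq_mul]; ring

theorem aestronglyMeasurable_scaledRow {c : ℝ → ℂ} {M : ℝ → Matrix (Fin T) (Fin T) ℂ}
    (hc : AEStronglyMeasurable c circle) (hM : AEStronglyMeasurable M circle) (k : Fin T) :
    AEStronglyMeasurable (scaledRow c M k) circle :=
  aestronglyMeasurable_vec fun i => hc.mul (aestronglyMeasurable_apply hM k i)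

/-- The spectral characteristic `e^{imθ} χ / β e_l` of the increment `χζ_l(m)`. -/
def incrVec (γ : Pattern r) (m : ℤ) (l : Fin T) : ℝ → Fin T → ℂ :=
  scaledRow (fun θ => ex m θ * γ.chi θ / γ.beta θ) (fun _ => 1) l

/-- The row `e^{imθ} (conj(β) / conj(χ)) e_lᵀ p⁻¹`. These functions are biorthogonal to the spectral
characteristics of the increments; minimality says that they belong to `L₂(p)`. -/
def dualRow (γ : Pattern r) (f g : ℝ → Matrix (Fin T) (Fin T) ℂ) (m : ℤ) (l : Fin T) :
    ℝ → Fin T → ℂ :=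
  scaledRow (fun θ => star (γ.beta θ) / star (γ.chi θ) * ex m θ)
    (fun θ => (obsDensity γ f g θ)⁻¹) l

/-- The row `e^{imθ} conj(β) e_lᵀ g p⁻¹`, the spectral characteristic of the projection of
`η_l(m)` on the span of all increments of the observed sequence. -/
def noiseVec (γ : Pattern r) (f g : ℝ → Matrix (Fin T) (Fin T) ℂ) (m : ℤ) (l : Fin T) :
    ℝ → Fin T → ℂ :=
  scaledRow (fun θ => star (γ.beta θ) * ex m θ) (fun θ => g θ * (obsDensity γ f g θ)⁻¹) l

theorem incrVec_eq (γ : Pattern r) (m : ℤ) (l : Fin T) :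
    incrVec γ m l = fun θ => Pi.single l (ex m θ * γ.chi θ / γ.beta θ) := by
  ext θ i
  simp only [incrVec, scaledRow, Pi.smul_apply, smul_eq_mul]
  by_cases hi : i = l
  · subst hi; simp
  · simp [hi, Matrix.one_apply_ne (Ne.symm hi)]

theorem mul_star_self (z : ℂ) : z * star z = ((‖z‖ ^ 2 : ℝ) : ℂ) := by
  rw [Complex.star_def, Complex.mul_conj, Complex.normSq_eq_norm_sq]

theorem ex_mul_star_ex (m k : ℤ) (θ : ℝ) : ex m θ * star (ex k θ) = ex (m - k) θ := by
  rw [star_ex, ← ex_add, sub_eq_add_neg]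

theorem measurable_coeff_incr (γ : Pattern r) (m : ℤ) :
    Measurable fun θ => ex m θ * γ.chi θ / γ.beta θ :=
  ((continuous_ex m).mul γ.continuous_chi).measurable.div γ.continuous_beta.measurable

theorem measurable_coeff_dual (γ : Pattern r) (m : ℤ) :
    Measurable fun θ => star (γ.beta θ) / star (γ.chi θ) * ex m θ :=
  (γ.continuous_beta.star.measurable.div γ.continuous_chi.star.measurable).mul
    (continuous_ex m).measurable

theorem continuous_coeff_noise (γ : Pattern r) (m : ℤ) :
    Continuous fun θ => star (γ.beta θ) * ex m θ :=
  γ.continuous_beta.star.mul (continuous_ex m)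

theorem integrable_continuous_mul {G F : ℝ → ℂ} (hG : Continuous G) (hF : Integrable F circle) :
    Integrable (fun θ => G θ * F θ) circle := by
  obtain ⟨C, hC⟩ := (isCompact_Icc (a := -Real.pi) (b := Real.pi)).exists_bound_of_continuousOn
    hG.continuousOn
  refine hF.bdd_mul (c := C) hG.aestronglyMeasurable ?_
  exact Measure.ae_smul_measure ((ae_restrict_iff' measurableSet_Ico).2
    (Filter.Eventually.of_forall fun θ hθ => hC θ ⟨hθ.1, hθ.2.le⟩)) _

theorem integrable_ex_mul {F : ℝ → ℂ} (hF : Integrable F circle) (m : ℤ) :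
    Integrable (fun θ => ex m θ * F θ) circle :=
  integrable_continuous_mul (continuous_ex m) hF

namespace GoodPoint

variable {θ : ℝ} (h : GoodPoint γ f g θ)
include h

theorem incrVec_incrVec (m k : ℤ) (l q : Fin T) :
    incrVec γ k q θ ⬝ᵥ (obsDensity γ f g θ *ᵥ star (incrVec γ m l θ)) =
      ex (k - m) θ * (((‖γ.chi θ‖ ^ 2 / ‖γ.beta θ‖ ^ 2 : ℝ) : ℂ) * f θ q l) +
        ex (k - m) θ * γ.chi θ * star (γ.chi θ) * g θ q l := by
  have hb := h.normSq_beta_ne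
  rw [incrVec, incrVec, scaledRow_quadratic, one_mul, conjTranspose_one, mul_one]
  rw [obsDensity, Matrix.add_apply, Matrix.smul_apply, smul_eq_mul, ← ex_mul_star_ex,
    Complex.ofReal_div, ← mul_star_self (γ.chi θ)]
  simp only [star_div₀, star_mul']
  have h2 : ((‖γ.beta θ‖ ^ 2 : ℝ) : ℂ) = γ.beta θ * star (γ.beta θ) := (mul_star_self _).symm
  rw [h2] at hb ⊢
  have h3 := h.beta_ne
  have h4 : star (γ.beta θ) ≠ 0 := star_ne_zero.2 h3
  field_simp

theorem incrVec_dualRow (m k : ℤ) (l q : Fin T) :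
    dualRow γ f g k q θ ⬝ᵥ (obsDensity γ f g θ *ᵥ star (incrVec γ m l θ)) =
      ex (k - m) θ * (1 : Matrix (Fin T) (Fin T) ℂ) q l := by
  rw [incrVec, dualRow, scaledRow_quadratic, conjTranspose_one, mul_one, h.inv_mul,
    ← ex_mul_star_ex]
  simp only [star_div₀, star_mul']
  have h3 : star (γ.beta θ) ≠ 0 := star_ne_zero.2 h.beta_ne
  have h4 : star (γ.chi θ) ≠ 0 := star_ne_zero.2 h.chi_ne
  field_simp

theorem incrVec_noiseVec (m k : ℤ) (l q : Fin T) :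
    noiseVec γ f g k q θ ⬝ᵥ (obsDensity γ f g θ *ᵥ star (incrVec γ m l θ)) =
      ex (k - m) θ * star (γ.chi θ) * g θ q l := by
  rw [incrVec, noiseVec, scaledRow_quadratic, conjTranspose_one, mul_one, mul_assoc (g θ),
    h.inv_mul, mul_one, ← ex_mul_star_ex]
  simp only [star_div₀, star_mul']
  have h3 : star (γ.beta θ) ≠ 0 := star_ne_zero.2 h.beta_ne
  field_simp

theorem dualRow_dualRow (m k : ℤ) (l q : Fin T) :
    dualRow γ f g k q θ ⬝ᵥ (obsDensity γ f g θ *ᵥ star (dualRow γ f g m l θ)) =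
      ex (k - m) θ * kernelP γ f g θ q l := by
  rw [dualRow, dualRow, scaledRow_quadratic, h.isHermitian_inv, h.inv_mul, one_mul,
    ← ex_mul_star_ex, kernelP, Matrix.smul_apply, smul_eq_mul, Pattern.weight, Complex.ofReal_div,
    ← mul_star_self, ← mul_star_self]
  simp only [star_div₀, star_mul', star_star]
  have h3 : star (γ.chi θ) ≠ 0 := star_ne_zero.2 h.chi_ne
  have h4 := h.chi_ne
  field_simp

theorem dualRow_noiseVec (m k : ℤ) (l q : Fin T) :
    noiseVec γ f g k q θ ⬝ᵥ (obsDensity γ f g θ *ᵥ star (dualRow γ f g m l θ)) =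
      ex (k - m) θ * kernelT γ f g θ q l := by
  rw [dualRow, noiseVec, scaledRow_quadratic, h.isHermitian_inv, mul_assoc (g θ), h.inv_mul,
    mul_one, ← ex_mul_star_ex, kernelT, Matrix.smul_apply, smul_eq_mul, ← mul_star_self]
  simp only [star_div₀, star_mul', star_star]
  have h4 := h.chi_ne
  field_simp

theorem noiseVec_noiseVec (m k : ℤ) (l q : Fin T) :
    noiseVec γ f g k q θ ⬝ᵥ (obsDensity γ f g θ *ᵥ star (noiseVec γ f g m l θ)) =
      ex (k - m) θ * g θ q l - ex (k - m) θ * kernelQ γ f g θ q l := by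
  rw [noiseVec, noiseVec, scaledRow_quadratic, conjTranspose_mul, h.isHermitian_inv,
    h.posSemidef_g.1.eq, mul_assoc (g θ), h.inv_mul, mul_one, ← ex_mul_star_ex, kernelQ,
    h.kernelQ_eq, Matrix.sub_apply, Matrix.smul_apply, smul_eq_mul, ← mul_star_self, ← mul_assoc]
  simp only [star_mul', star_star]
  ring

end GoodPoint

namespace AdmissibleDensities

variable (h : AdmissibleDensities γ f g)
include h

theorem integrable_chi_mul_g (q l : Fin T) :
    Integrable (fun θ => γ.chi θ * star (γ.chi θ) * g θ q l) circle :=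
  integrable_continuous_mul (by fun_prop) (h.integrable_g q l)

theorem memWeighted_incrVec (m : ℤ) (l : Fin T) :
    MemWeighted (obsDensity γ f g) (incrVec γ m l) := by
  refine memWeighted_of_integrable h.isRegularDensity.aesm h.isRegularDensity.posSemidef
    (aestronglyMeasurable_scaledRow (measurable_coeff_incr γ m).aestronglyMeasurable
      aestronglyMeasurable_const l) ?_
  refine ((h.integrable_f l l).add (h.integrable_chi_mul_g l l)).congr ?_
  filter_upwards [h.ae_goodPoint] with θ hθ
  rw [hθ.incrVec_incrVec]
  simp

theorem memWeighted_dualRow (m : ℤ) (l : Fin T) :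
    MemWeighted (obsDensity γ f g) (dualRow γ f g m l) := by
  refine memWeighted_of_integrable h.isRegularDensity.aesm h.isRegularDensity.posSemidef
    (aestronglyMeasurable_scaledRow (measurable_coeff_dual γ m).aestronglyMeasurable
      h.aesm_inv l) ?_
  have hm : AEStronglyMeasurable (fun θ => kernelP γ f g θ l l) circle := by
    refine AEStronglyMeasurable.mul (Measurable.aestronglyMeasurable ?_)
      (aestronglyMeasurable_apply h.aesm_inv l l)
    exact Complex.measurable_ofReal.comp
      (((γ.continuous_beta.norm.pow 2).measurable).div ((γ.continuous_chi.norm.pow 2).measurable))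
  have h1 : Integrable (fun θ => kernelP γ f g θ l l) circle := by
    refine Integrable.mono' h.minimality.2.norm hm ?_
    filter_upwards [h.ae_goodPoint] with θ hθ
    have hps : (kernelP γ f g θ).PosSemidef :=
      hθ.posSemidef.inv.smul (by rw [Pattern.weight, Complex.zero_le_real]; positivity)
    have h2 : kernelP γ f g θ l l ≤ (kernelP γ f g θ).trace :=
      Finset.single_le_sum (f := fun i => kernelP γ f g θ i i) (fun i _ => hps.diag_nonneg)
        (Finset.mem_univ l)
    exact norm_le_norm_of_nonneg hps.diag_nonneg h2
  refine h1.congr ?_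
  filter_upwards [h.ae_goodPoint] with θ hθ
  rw [hθ.dualRow_dualRow]
  simp

theorem memWeighted_noiseVec (m : ℤ) (l : Fin T) :
    MemWeighted (obsDensity γ f g) (noiseVec γ f g m l) := by
  refine memWeighted_of_integrable h.isRegularDensity.aesm h.isRegularDensity.posSemidef
    (aestronglyMeasurable_scaledRow (continuous_coeff_noise γ m).aestronglyMeasurable
      (aestronglyMeasurable_mul h.aesm_g h.aesm_inv) l) ?_
  have h1 : Integrable (fun θ => g θ l l - kernelQ γ f g θ l l) circle := by
    have hm : AEStronglyMeasurable (fun θ => g θ l l - kernelQ γ f g θ l l) circle :=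
      (aestronglyMeasurable_apply h.aesm_g l l).sub (aestronglyMeasurable_apply
        (aestronglyMeasurable_mul (aestronglyMeasurable_mul h.aesm_f h.aesm_inv) h.aesm_g) l l)
    refine Integrable.mono' (h.integrable_g l l).norm hm ?_
    filter_upwards [h.ae_goodPoint] with θ hθ
    have h0 : (0 : ℂ) ≤ kernelQ γ f g θ l l := hθ.posSemidef_kernelQ.diag_nonneg
    have h2 : (0 : ℂ) ≤ g θ l l - kernelQ γ f g θ l l := by
      have h3 : (((‖γ.beta θ‖ ^ 2 : ℝ) : ℂ) •
          (g θ * (obsDensity γ f g θ)⁻¹ * g θ)).PosSemidef := by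
        refine PosSemidef.smul ?_ (by rw [Complex.zero_le_real]; positivity)
        have := hθ.posSemidef.inv.mul_mul_conjTranspose_same (g θ)
        rwa [hθ.posSemidef_g.1.eq] at this
      have h4 := h3.diag_nonneg (i := l)
      rw [kernelQ, hθ.kernelQ_eq, Matrix.sub_apply, sub_sub_cancel]
      exact h4
    exact norm_le_norm_of_nonneg h2 (sub_le_self _ h0)
  refine h1.congr ?_
  filter_upwards [h.ae_goodPoint] with θ hθ
  rw [hθ.noiseVec_noiseVec]
  simp

theorem integrable_kernelP (q l : Fin T) : Integrable (fun θ => kernelP γ f g θ q l) circle := by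
  refine (integrable_quadratic h.isRegularDensity.posSemidef (h.memWeighted_dualRow 0 l)
    (h.memWeighted_dualRow 0 q)).congr ?_
  filter_upwards [h.ae_goodPoint] with θ hθ
  rw [hθ.dualRow_dualRow]
  simp

theorem integrable_kernelT (q l : Fin T) : Integrable (fun θ => kernelT γ f g θ q l) circle := by
  refine (integrable_quadratic h.isRegularDensity.posSemidef (h.memWeighted_dualRow 0 l)
    (h.memWeighted_noiseVec 0 q)).congr ?_
  filter_upwards [h.ae_goodPoint] with θ hθ
  rw [hθ.dualRow_noiseVec]
  simp

theorem integrable_kernelQ (q l : Fin T) : Integrable (fun θ => kernelQ γ f g θ q l) circle := by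
  refine ((h.integrable_g q l).sub (integrable_quadratic h.isRegularDensity.posSemidef
    (h.memWeighted_noiseVec 0 l) (h.memWeighted_noiseVec 0 q))).congr ?_
  filter_upwards [h.ae_goodPoint] with θ hθ
  rw [Pi.sub_apply, hθ.noiseVec_noiseVec]
  simp

theorem inner_incr_dual (m k : ℤ) (l q : Fin T) :
    inner ℂ (emb (obsDensity γ f g) (incrVec γ m l)) (emb (obsDensity γ f g) (dualRow γ f g k q)) =
      if k = m ∧ q = l then 1 else 0 := by
  rw [inner_emb h.isRegularDensity.posSemidef (h.memWeighted_incrVec m l)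
    (h.memWeighted_dualRow k q), integral_congr_ae (h.ae_goodPoint.mono fun θ hθ =>
      hθ.incrVec_dualRow m k l q), integral_mul_const, integral_ex, Matrix.one_apply]
  simp only [sub_eq_zero]
  split_ifs <;> simp_all

theorem inner_dual_dual (m k : ℤ) (l q : Fin T) :
    inner ℂ (emb (obsDensity γ f g) (dualRow γ f g m l))
      (emb (obsDensity γ f g) (dualRow γ f g k q)) =
      ∫ θ, ex (k - m) θ * kernelP γ f g θ q l ∂circle := by
  rw [inner_emb h.isRegularDensity.posSemidef (h.memWeighted_dualRow m l)
    (h.memWeighted_dualRow k q)]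
  exact integral_congr_ae (h.ae_goodPoint.mono fun θ hθ => hθ.dualRow_dualRow m k l q)

theorem inner_dual_noise (m k : ℤ) (l q : Fin T) :
    inner ℂ (emb (obsDensity γ f g) (dualRow γ f g m l))
      (emb (obsDensity γ f g) (noiseVec γ f g k q)) =
      ∫ θ, ex (k - m) θ * kernelT γ f g θ q l ∂circle := by
  rw [inner_emb h.isRegularDensity.posSemidef (h.memWeighted_dualRow m l)
    (h.memWeighted_noiseVec k q)]
  exact integral_congr_ae (h.ae_goodPoint.mono fun θ hθ => hθ.dualRow_noiseVec m k l q)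

theorem inner_incr_noise (m k : ℤ) (l q : Fin T) :
    inner ℂ (emb (obsDensity γ f g) (incrVec γ m l))
      (emb (obsDensity γ f g) (noiseVec γ f g k q)) =
      ∫ θ, ex (k - m) θ * star (γ.chi θ) * g θ q l ∂circle := by
  rw [inner_emb h.isRegularDensity.posSemidef (h.memWeighted_incrVec m l)
    (h.memWeighted_noiseVec k q)]
  exact integral_congr_ae (h.ae_goodPoint.mono fun θ hθ => hθ.incrVec_noiseVec m k l q)

theorem inner_noise_noise (m k : ℤ) (l q : Fin T) :
    inner ℂ (emb (obsDensity γ f g) (noiseVec γ f g m l))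
      (emb (obsDensity γ f g) (noiseVec γ f g k q)) =
      ∫ θ, ex (k - m) θ * g θ q l ∂circle - ∫ θ, ex (k - m) θ * kernelQ γ f g θ q l ∂circle := by
  rw [inner_emb h.isRegularDensity.posSemidef (h.memWeighted_noiseVec m l)
    (h.memWeighted_noiseVec k q), ← integral_sub (integrable_ex_mul (h.integrable_g q l) _)
      (integrable_ex_mul (h.integrable_kernelQ q l) _)]
  exact integral_congr_ae (h.ae_goodPoint.mono fun θ hθ => hθ.noiseVec_noiseVec m k l q)

theorem inner_incr_incr (m k : ℤ) (l q : Fin T) :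
    inner ℂ (emb (obsDensity γ f g) (incrVec γ m l))
      (emb (obsDensity γ f g) (incrVec γ k q)) =
      ∫ θ, ex (k - m) θ * (((‖γ.chi θ‖ ^ 2 / ‖γ.beta θ‖ ^ 2 : ℝ) : ℂ) * f θ q l) ∂circle +
      ∫ θ, ex (k - m) θ * (γ.chi θ * star (γ.chi θ) * g θ q l) ∂circle := by
  rw [inner_emb h.isRegularDensity.posSemidef (h.memWeighted_incrVec m l)
    (h.memWeighted_incrVec k q), ← integral_add (integrable_ex_mul (h.integrable_f q l) _)
      (integrable_ex_mul (h.integrable_chi_mul_g q l) _)]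
  refine integral_congr_ae (h.ae_goodPoint.mono fun θ hθ => ?_)
  simp only [hθ.incrVec_incrVec m k l q]
  ring

/-- A function orthogonal to the increments outside the times `{0, …, M - 1}` is a combination of
the dual rows of these times: multiplied by `p` and `conj(χ / β)` it becomes an integrable function
with Fourier coefficients in `{0, …, M - 1}`. -/
theorem exists_eq_sum_dualRow (M : ℕ) (ρ : VecL2 T)
    (hρ : ∀ m : ℤ, (m ≤ -1 ∨ (M : ℤ) ≤ m) → ∀ l,
      inner ℂ (emb (obsDensity γ f g) (incrVec γ m l)) ρ = 0) :
    ∃ c : Fin M × Fin T → ℂ,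
      ρ = ∑ x, c x • emb (obsDensity γ f g) (dualRow γ f g (x.1 : ℕ) x.2) := by
  have hdot : ∀ (m : ℤ) (l : Fin T) θ,
      dualVec (obsDensity γ f g) ρ θ ⬝ᵥ star (incrVec γ m l θ) =
        ex (-m) θ * (star (γ.chi θ / γ.beta θ) * dualVec (obsDensity γ f g) ρ θ l) := by
    intro m l θ
    rw [incrVec_eq, Pi.star_single, dotProduct_single, mul_div_assoc, star_mul', star_ex]
    ring
  have hF : ∀ l, ∃ c : Fin M → ℂ, (fun θ => star (γ.chi θ / γ.beta θ) *
      dualVec (obsDensity γ f g) ρ θ l) =ᵐ[circle] fun θ => ∑ k : Fin M, c k * ex (k : ℕ) θ := by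
    intro l
    refine ae_eq_trigPoly ?_ M fun m hm => ?_
    · have := (inner_emb_left (h.memWeighted_incrVec 0 l) ρ).2
      simpa [hdot] using this
    · have := (inner_emb_left (h.memWeighted_incrVec m l) ρ).1
      rw [hρ m hm l] at this
      simp only [hdot] at this
      exact this.symm
  choose c hc using hF
  refine ⟨fun x => c x.2 x.1, ?_⟩
  have hmem : ∀ x : Fin M × Fin T, MemWeighted (obsDensity γ f g)
      (dualRow γ f g (x.1 : ℕ) x.2) := fun x => h.memWeighted_dualRow _ _
  have hae : dualVec (obsDensity γ f g) ρ =ᵐ[circle] fun θ =>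
      (∑ x : Fin M × Fin T, c x.2 x.1 • dualRow γ f g (x.1 : ℕ) x.2) θ ᵥ* obsDensity γ f g θ := by
    filter_upwards [h.ae_goodPoint, ae_all_iff.2 hc] with θ hθ hcθ
    have h1 : ∀ (k : ℤ) (l : Fin T), dualRow γ f g k l θ ᵥ* obsDensity γ f g θ =
        Pi.single l (star (γ.beta θ) / star (γ.chi θ) * ex k θ) := by
      intro k l
      have : (obsDensity γ f g θ)⁻¹ l ᵥ* obsDensity γ f g θ = (1 : Matrix (Fin T) (Fin T) ℂ) l := by
        rw [← hθ.inv_mul]; rfl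
      rw [dualRow, scaledRow, smul_vecMul, this]
      ext i
      by_cases hi : i = l
      · subst hi; simp
      · simp [hi, Matrix.one_apply_ne (Ne.symm hi)]
    ext l
    simp only [Finset.sum_apply, Pi.smul_apply, sum_vecMul, smul_vecMul, h1, Fintype.sum_prod_type]
    have h2 := hcθ l
    have h3 : star (γ.beta θ) ≠ 0 := star_ne_zero.2 hθ.beta_ne
    have h4 : star (γ.chi θ) ≠ 0 := star_ne_zero.2 hθ.chi_ne
    have h5 : dualVec (obsDensity γ f g) ρ θ l = star (γ.beta θ) / star (γ.chi θ) *
        ∑ k : Fin M, c l k * ex (k : ℕ) θ := by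
      rw [← h2, star_div₀]
      field_simp
    rw [h5, Finset.mul_sum]
    refine Finset.sum_congr rfl fun k _ => ?_
    rw [Finset.sum_eq_single l]
    · simp; ring
    · intro b _ hb
      simp [Pi.single_eq_of_ne (Ne.symm hb)]
    · simp
  rw [(eq_emb_of_dualVec_eq h.isRegularDensity ρ hae).2,
    emb_sum _ fun x _ => (hmem x).smul _]
  exact Finset.sum_congr rfl fun x _ => emb_smul _ (hmem x)

/-- No function is orthogonal to all increments: the case of an empty set of exceptional times. -/
theorem span_incrVec_dense : (Submodule.span ℂ (Set.range fun i : ℤ × Fin T =>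
    emb (obsDensity γ f g) (incrVec γ i.1 i.2))).topologicalClosure = ⊤ := by
  rw [Submodule.topologicalClosure_eq_top_iff, Submodule.eq_bot_iff]
  intro ρ hρ
  obtain ⟨c, hc⟩ := h.exists_eq_sum_dualRow 0 ρ fun m _ l =>
    (Submodule.mem_orthogonal _ _).1 hρ _ (Submodule.subset_span ⟨(m, l), rfl⟩)
  simpa using hc

end AdmissibleDensities

end Model

/-! ### The observed sequence in `L₂(P)` -/

section ObservedSequence

variable {T r : ℕ} {Ω : Type*} [MeasurableSpace Ω] {P : Measure Ω}
  {γ : Pattern r} {ξ η : ℤ → Fin T → Ω → ℂ} {f g : ℝ → Matrix (Fin T) (Fin T) ℂ}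

/-- The signal `ξ` has increments with spectral density `f`, the noise `η` is stationary with
density `g` and uncorrelated with the increments, and the minimality condition holds. -/
structure ObservedModel (P : Measure Ω) (γ : Pattern r) (ξ η : ℤ → Fin T → Ω → ℂ)
    (f g : ℝ → Matrix (Fin T) (Fin T) ℂ) : Prop where
  hξ : HasIncrementDensity P γ ξ f
  hη : HasDensity P η g
  hξη : Uncorrelated P γ ξ η
  hmin : Minimality γ f g

omit [MeasurableSpace Ω] in
theorem incr_add (ξ η : ℤ → Fin T → Ω → ℂ) (m : ℤ) (l : Fin T) :
    γ.incr (ξ + η) m l = γ.incr ξ m l + γ.incr η m l := by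
  ext ω
  simp only [Pi.add_apply, γ.incr_eq_sum, mul_add, Finset.sum_add_distrib]

omit [MeasurableSpace Ω] in
theorem incr_eq_sum_fun (η : ℤ → Fin T → Ω → ℂ) (m : ℤ) (l : Fin T) :
    γ.incr η m l = ∑ j ∈ Finset.range (γ.n + 1), γ.e j • η (m - j) l := by
  ext ω
  simp [γ.incr_eq_sum]

theorem toLp_sum {ι : Type*} (s : Finset ι) {X : ι → Ω → ℂ} (c : ι → ℂ) (hX : ∀ i, MemLp (X i) 2 P)
    (h : MemLp (∑ i ∈ s, c i • X i) 2 P) : h.toLp = ∑ i ∈ s, c i • (hX i).toLp := by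
  apply Lp.ext
  refine h.coeFn_toLp.trans (Filter.EventuallyEq.trans ?_ (coeFn_sum s _).symm)
  have h1 : ∀ i, (c i • (hX i).toLp : Lp ℂ 2 P) =ᵐ[P] c i • X i := fun i => by
    filter_upwards [Lp.coeFn_smul (c i) (hX i).toLp, (hX i).coeFn_toLp] with ω e1 e2
    rw [e1, Pi.smul_apply, Pi.smul_apply, e2]
  have h2 : ∀ᵐ ω ∂P, ∀ i ∈ s, (c i • (hX i).toLp : Lp ℂ 2 P) ω = (c i • X i) ω :=
    (Filter.eventually_all_finset s).2 fun i _ => h1 i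
  filter_upwards [h2] with ω h2
  rw [Finset.sum_apply]
  exact (Finset.sum_congr rfl h2).symm

namespace ObservedModel

variable (h : ObservedModel P γ ξ η f g)
include h

theorem admissible : AdmissibleDensities γ f g :=
  ⟨h.hξ.posSemidef, h.hξ.integrable, h.hη.posSemidef, h.hη.integrable, h.hmin⟩

theorem memLp_incr_noise (m : ℤ) (l : Fin T) : MemLp (γ.incr η m l) 2 P := by
  rw [incr_eq_sum_fun]
  exact memLp_finsetSum' _ fun j _ => (h.hη.memLp _ _).const_smul _

theorem memLp_incr (m : ℤ) (l : Fin T) : MemLp (γ.incr (ξ + η) m l) 2 P := by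
  rw [incr_add]
  exact (h.hξ.memLp m l).add (h.memLp_incr_noise m l)

theorem incr_toLp (m : ℤ) (l : Fin T) : (h.memLp_incr m l).toLp =
    (h.hξ.memLp m l).toLp +
      ∑ j ∈ Finset.range (γ.n + 1), γ.e j • (h.hη.memLp (m - j) l).toLp := by
  have h1 : MemLp (∑ j ∈ Finset.range (γ.n + 1), γ.e j • η (m - j) l) 2 P := by
    rw [← incr_eq_sum_fun]; exact h.memLp_incr_noise m l
  rw [← toLp_sum _ _ (fun j : ℕ => h.hη.memLp (m - j) l) h1, ← MemLp.toLp_add]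
  congr 1
  rw [incr_add, ← incr_eq_sum_fun]

theorem inner_noise (m k : ℤ) (l q : Fin T) :
    inner ℂ (h.hη.memLp m l).toLp (h.hη.memLp k q).toLp = ∫ θ, ex (k - m) θ * g θ q l ∂circle := by
  rw [inner_toLp, ← h.hη.cov, sub_add_cancel]

theorem inner_noise_signal (m k : ℤ) (l q : Fin T) :
    inner ℂ (h.hη.memLp m l).toLp (h.hξ.memLp k q).toLp = 0 := by
  rw [inner_toLp]; exact h.hξη k m q l

theorem inner_signal_noise (m k : ℤ) (l q : Fin T) :
    inner ℂ (h.hξ.memLp m l).toLp (h.hη.memLp k q).toLp = 0 := by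
  rw [← inner_conj_symm, h.inner_noise_signal, map_zero]

theorem inner_incr_noise (m k : ℤ) (l q : Fin T) :
    inner ℂ (h.memLp_incr m l).toLp (h.hη.memLp k q).toLp =
      ∫ θ, ex (k - m) θ * star (γ.chi θ) * g θ q l ∂circle := by
  rw [h.incr_toLp, inner_add_left, h.inner_signal_noise, zero_add, sum_inner]
  simp only [inner_smul_left, h.inner_noise, γ.chi_eq_sum, star_sum, star_mul', star_ex,
    Finset.mul_sum, Finset.sum_mul, neg_neg]
  rw [integral_finsetSum]
  · refine Finset.sum_congr rfl fun j _ => ?_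
    rw [← integral_const_mul]
    congr 1; ext θ
    rw [show k - (m - j) = (k - m) + j by ring, ex_add, Complex.star_def]
    ring
  · intro j _
    refine ((integrable_ex_mul (integrable_ex_mul (h.hη.integrable q l) j) (k - m)).const_mul
      (star (γ.e j))).congr (Filter.Eventually.of_forall fun θ => ?_)
    simp only; ring

theorem inner_incr_incr (m k : ℤ) (l q : Fin T) :
    inner ℂ (h.memLp_incr m l).toLp (h.memLp_incr k q).toLp =
      ∫ θ, ex (k - m) θ * (((‖γ.chi θ‖ ^ 2 / ‖γ.beta θ‖ ^ 2 : ℝ) : ℂ) * f θ q l) ∂circle +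
      ∫ θ, ex (k - m) θ * (γ.chi θ * star (γ.chi θ) * g θ q l) ∂circle := by
  rw [h.incr_toLp k q, inner_add_right, inner_sum]
  congr 1
  · rw [h.incr_toLp, inner_add_left, sum_inner, Finset.sum_eq_zero, add_zero, inner_toLp]
    · have := h.hξ.cov (k - m) m q l
      rw [sub_add_cancel] at this
      rw [this]
      congr 1; ext θ; ring
    · intro j _
      rw [inner_smul_left, h.inner_noise_signal, mul_zero]
  · simp only [inner_smul_right, h.inner_incr_noise]
    have hs : ∀ θ, ex (k - m) θ * (γ.chi θ * star (γ.chi θ) * g θ q l) =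
        ∑ j ∈ Finset.range (γ.n + 1), γ.e j * (ex (k - j - m) θ * star (γ.chi θ) * g θ q l) := by
      intro θ
      have hj : ∀ j ∈ Finset.range (γ.n + 1),
          γ.e j * (ex (k - j - m) θ * star (γ.chi θ) * g θ q l) =
            γ.e j * ex (-(j : ℤ)) θ * (ex (k - m) θ * star (γ.chi θ) * g θ q l) := by
        intro j _
        rw [show k - j - m = -(j : ℤ) + (k - m) by ring, ex_add]
        ring
      rw [Finset.sum_congr rfl hj, ← Finset.sum_mul, ← γ.chi_eq_sum]
      ring
    simp only [hs]
    rw [integral_finsetSum]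
    · exact Finset.sum_congr rfl fun j _ => (integral_const_mul _ _).symm
    · intro j _
      exact (integrable_continuous_mul (by fun_prop) (h.hη.integrable q l)).const_mul _

/-- The spectral isometry, from the total family of spectral characteristics to the increments. -/
theorem exists_isometry : ∃ U : VecL2 T →ₗᵢ[ℂ] Lp ℂ 2 P, ∀ m l,
    U (emb (obsDensity γ f g) (incrVec γ m l)) = (h.memLp_incr m l).toLp := by
  obtain ⟨U, hU⟩ := exists_linearIsometry_of_gram_eq
    (fun i : ℤ × Fin T => emb (obsDensity γ f g) (incrVec γ i.1 i.2))
    (fun i => (h.memLp_incr i.1 i.2).toLp) h.admissible.span_incrVec_dense (by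
      intro i j
      rw [h.admissible.inner_incr_incr, h.inner_incr_incr])
  exact ⟨U, fun m l => hU (m, l)⟩

variable {U : VecL2 T →ₗᵢ[ℂ] Lp ℂ 2 P}
  (hU : ∀ m l, U (emb (obsDensity γ f g) (incrVec γ m l)) = (h.memLp_incr m l).toLp)
include hU

/-- The adjoint of the spectral isometry takes `η_q(k)` to `noiseVec γ f g k q`. Both sides are
antilinear and continuous in `z`, so it suffices to compare covariances with the increments. -/
theorem inner_isometry_noise (z : VecL2 T) (k : ℤ) (q : Fin T) :
    inner ℂ (U z) (h.hη.memLp k q).toLp =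
      inner ℂ z (emb (obsDensity γ f g) (noiseVec γ f g k q)) := by
  have hext : (innerSL ℂ (h.hη.memLp k q).toLp).comp U.toContinuousLinearMap =
      innerSL ℂ (emb (obsDensity γ f g) (noiseVec γ f g k q)) := by
    refine ContinuousLinearMap.ext_on (Submodule.dense_iff_topologicalClosure_eq_top.2
      h.admissible.span_incrVec_dense) ?_
    rintro _ ⟨⟨m, l⟩, rfl⟩
    simp only [ContinuousLinearMap.comp_apply, LinearIsometry.coe_toContinuousLinearMap,
      innerSL_apply_apply, hU]
    rw [← inner_conj_symm, h.inner_incr_noise, ← inner_conj_symm (emb _ (noiseVec γ f g k q)),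
      h.admissible.inner_incr_noise]
  have := congrArg (fun L : VecL2 T →L[ℂ] ℂ => L z) hext
  simp only [ContinuousLinearMap.comp_apply, LinearIsometry.coe_toContinuousLinearMap,
    innerSL_apply_apply] at this
  rw [← inner_conj_symm, this, inner_conj_symm]

/-- Centredness passes from the increments to the whole range of the isometry. -/
theorem integral_isometry_eq_zero [IsProbabilityMeasure P] (z : VecL2 T) : ∫ ω, U z ω ∂P = 0 := by
  have h1 : MemLp (fun _ : Ω => (1 : ℂ)) 2 P := memLp_const 1
  have hint : ∀ y : Lp ℂ 2 P, inner ℂ h1.toLp y = ∫ ω, y ω ∂P := by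
    intro y
    conv_lhs => rw [← Lp.toLp_coeFn y (Lp.memLp y)]
    rw [inner_toLp]; simp
  have hη : ∀ m l, ∫ ω, γ.incr η m l ω ∂P = 0 := by
    intro m l
    simp only [γ.incr_eq_sum]
    rw [integral_finsetSum _ fun (j : ℕ) _ =>
      ((h.hη.memLp (m - j) l).integrable (by norm_num)).const_mul _]
    refine Finset.sum_eq_zero fun j _ => ?_
    rw [integral_const_mul, h.hη.mean, mul_zero]
  have hext : (innerSL ℂ h1.toLp).comp U.toContinuousLinearMap = 0 := by
    refine ContinuousLinearMap.ext_on (Submodule.dense_iff_topologicalClosure_eq_top.2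
      h.admissible.span_incrVec_dense) ?_
    rintro _ ⟨⟨m, l⟩, rfl⟩
    simp only [ContinuousLinearMap.comp_apply, LinearIsometry.coe_toContinuousLinearMap,
      innerSL_apply_apply, hU, _root_.zero_apply]
    rw [inner_toLp]
    simp only [star_one, mul_one, incr_add, Pi.add_apply]
    rw [integral_add ((h.hξ.memLp m l).integrable (by norm_num))
      ((h.memLp_incr_noise m l).integrable (by norm_num)), h.hξ.mean, hη, add_zero]
  rw [← hint]
  exact congrArg (fun L : VecL2 T →L[ℂ] ℂ => L z) hext

theorem exists_isSpectralMeasure [IsProbabilityMeasure P] :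
    ∃ Z, IsSpectralMeasure P γ (ξ + η) (obsDensity γ f g) Z := by
  classical
  have hp := h.admissible.isRegularDensity
  let Z : Set ℝ → Fin T → Ω → ℂ := fun A k =>
    if FiniteMass (obsDensity γ f g) A then
      U (emb (obsDensity γ f g) (A.indicator fun _ => Pi.single k 1)) else 0
  have hZ : ∀ A, FiniteMass (obsDensity γ f g) A → ∀ k,
      Z A k = U (emb (obsDensity γ f g) (A.indicator fun _ => Pi.single k 1)) :=
    fun A hA k => if_pos hA
  have hrep : Represents P (obsDensity γ f g) U Z := fun A hA k => by rw [hZ A hA]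
  refine ⟨Z, ⟨fun A hA k => ?_, fun A hA k => ?_, fun A B hA hB k l => ?_⟩, fun m l => ?_⟩
  · rw [hZ A hA]; exact Lp.memLp _
  · rw [hZ A hA]; exact h.integral_isometry_eq_zero hU _
  · rw [hZ A hA, hZ B hB, ← inner_indicatorEmb hp hB hA l k,
      ← U.inner_map_map, L2.inner_def]
    rfl
  · rw [← incrVec_eq]
    refine hrep.isStochasticIntegral hp (fun i => ?_) (h.admissible.memWeighted_incrVec m l) ?_
    · exact ((measurable_coeff_incr γ m).mul measurable_const).aemeasurable
    · rw [hU]; exact MemLp.coeFn_toLp _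

/-- Integration against any spectral measure of the increments is the spectral isometry. -/
theorem represents_of_isSpectralMeasure {Z : Set ℝ → Fin T → Ω → ℂ}
    (hZ : IsSpectralMeasure P γ (ξ + η) (obsDensity γ f g) Z) :
    Represents P (obsDensity γ f g) U Z := by
  have hp := h.admissible.isRegularDensity
  obtain ⟨V, hV⟩ := hZ.1.exists_represents hp
  have : U = V := by
    refine linearIsometry_ext_of_dense h.admissible.span_incrVec_dense ?_
    rintro ⟨m, l⟩
    simp only
    rw [hU]
    have h1 := hZ.2 m l
    rw [← incrVec_eq] at h1
    exact (Lp.ext ((hV.ae_eq_of_isStochasticIntegral hp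
      (h.admissible.memWeighted_incrVec m l) h1).trans (h.memLp_incr m l).coeFn_toLp.symm)).symm
  rwa [this]

end ObservedModel

theorem mem_closedSpan_range_iff {I : Type*} {X : I → Ω → ℂ} (hX : ∀ i, MemLp (X i) 2 P)
    {H : Ω → ℂ} : H ∈ closedSpan P (Set.range X) ↔ ∃ hH : MemLp H 2 P,
      hH.toLp ∈ (Submodule.span ℂ (Set.range fun i => (hX i).toLp)).topologicalClosure := by
  have hc : ∀ c : I →₀ ℂ, MemLp (∑ i ∈ c.support, c i • X i) 2 P := fun c =>
    memLp_finsetSum' _ fun i _ => (hX i).const_smul _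
  have hdist : ∀ (hH : MemLp H 2 P) (c : I →₀ ℂ),
      edist hH.toLp (∑ i ∈ c.support, c i • (hX i).toLp) =
        eLpNorm (H - ∑ i ∈ c.support, c i • X i) 2 P := by
    intro hH c
    rw [← toLp_sum _ _ hX (hc c), Lp.edist_toLp_toLp]
  constructor
  · rintro ⟨hH, happ⟩
    refine ⟨hH, ?_⟩
    rw [← SetLike.mem_coe, Submodule.topologicalClosure_coe, EMetric.mem_closure_iff]
    intro ε hε
    obtain ⟨x, hx, hlt⟩ := happ ε hε
    obtain ⟨c, rfl⟩ := (Finsupp.mem_span_range_iff_exists_finsupp).1 hx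
    refine ⟨∑ i ∈ c.support, c i • (hX i).toLp, ?_, ?_⟩
    · exact Submodule.sum_mem _ fun i _ => Submodule.smul_mem _ _ (Submodule.subset_span ⟨i, rfl⟩)
    · rw [hdist hH]; exact hlt
  · rintro ⟨hH, hmem⟩
    refine ⟨hH, fun ε hε => ?_⟩
    rw [← SetLike.mem_coe, Submodule.topologicalClosure_coe, EMetric.mem_closure_iff] at hmem
    obtain ⟨x, hx, hlt⟩ := hmem ε hε
    obtain ⟨c, rfl⟩ := (Finsupp.mem_span_range_iff_exists_finsupp).1 hx
    refine ⟨∑ i ∈ c.support, c i • X i, ?_, ?_⟩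
    · exact Submodule.sum_mem _ fun i _ => Submodule.smul_mem _ _ (Submodule.subset_span ⟨i, rfl⟩)
    · rw [← hdist hH]; exact hlt

end ObservedSequence

/-! ### The normal equations -/

section Projection

variable {T r : ℕ} {γ : Pattern r} {f g : ℝ → Matrix (Fin T) (Fin T) ℂ} (N : ℕ)
  (a : ℕ → Fin T → ℂ)

theorem mulVec_apply_eq_sum {ι : Type*} [Fintype ι] (M : Matrix ι ι ℂ) (v : ι → ℂ) (x : ι) :
    (M *ᵥ v) x = ∑ y, v y * M x y :=
  Finset.sum_congr rfl fun _ _ => mul_comm _ _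

theorem sum_scaledRow {M : ℕ} (s : ℂ) (e : Fin M → ℂ) (x : Fin M → Fin T → ℂ)
    (L : Matrix (Fin T) (Fin T) ℂ) :
    s • ((fun l => ∑ k, e k * x k l) ᵥ* L) =
      ∑ y : Fin M × Fin T, x y.1 y.2 • ((s * e y.1) • L y.2) := by
  rw [vecMul_eq_sum, Fintype.sum_prod_type_right, Finset.smul_sum]
  refine Finset.sum_congr rfl fun l _ => ?_
  rw [Finset.sum_smul, Finset.smul_sum]
  refine Finset.sum_congr rfl fun k _ => ?_
  simp only [smul_smul]
  congr 1; ring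

theorem sum_ex_smul_eq (x : ℕ → Fin T → ℂ) (θ : ℝ) :
    ∑ k ∈ Finset.range (N + 1), ex k θ • x k =
      fun l => ∑ k : Fin (N + 1), ex (k : ℕ) θ * x k l := by
  ext l
  rw [Finset.sum_apply, ← Finset.sum_range fun k => ex k θ * x k l]
  rfl

theorem sum_padded {V : Type*} [AddCommGroup V] [Module ℂ V] (n : ℕ) (x : ℕ → Fin T → ℂ)
    (F : ℕ → Fin T → V) :
    ∑ y : Fin (N + n + 1) × Fin T, (if (y.1 : ℕ) ≤ N then x y.1 y.2 else 0) • F y.1 y.2 =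
      ∑ y : Fin (N + 1) × Fin T, x y.1 y.2 • F y.1 y.2 := by
  rw [Fintype.sum_prod_type, Fintype.sum_prod_type,
    ← Finset.sum_range fun k => ∑ l, (if k ≤ N then x k l else 0) • F k l,
    ← Finset.sum_range fun k => ∑ l, x k l • F k l]
  symm
  refine (Finset.sum_congr rfl fun k hk => ?_).trans (Finset.sum_subset (fun k hk => ?_)
    fun k _ hk => ?_)
  · simp only [if_pos (Nat.lt_succ_iff.1 (Finset.mem_range.1 hk))]
  · simp only [Finset.mem_range] at hk ⊢; omega
  · simp only [Finset.mem_range] at hk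
    simp [show ¬ k ≤ N by omega]

theorem specChar_eq : specChar γ f g N a =
    ∑ y : Fin (N + 1) × Fin T, bvec γ N a y.1 y.2 • incrVec γ (y.1 : ℕ) y.2 -
      ∑ y : Fin (N + 1) × Fin T, a y.1 y.2 • noiseVec γ f g (y.1 : ℕ) y.2 -
      ∑ x : Fin (N + γ.n + 1) × Fin T, cvec γ f g N a x • dualRow γ f g (x.1 : ℕ) x.2 := by
  ext1 θ
  simp only [Pi.sub_apply, Finset.sum_apply, Pi.smul_apply]
  have h1 : (γ.chi θ / γ.beta θ) • polyB γ N a θ =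
      ∑ y : Fin (N + 1) × Fin T, bvec γ N a y.1 y.2 • incrVec γ (y.1 : ℕ) y.2 θ := by
    have := sum_scaledRow (γ.chi θ / γ.beta θ) (fun k : Fin (N + 1) => ex (k : ℕ) θ)
      (fun k l => bvec γ N a k l) 1
    rw [vecMul_one] at this
    rw [polyB, sum_ex_smul_eq, this]
    refine Finset.sum_congr rfl fun y _ => ?_
    rw [incrVec, scaledRow]
    congr 2; ring
  have h2 : star (γ.beta θ) • (polyA N a θ ᵥ* (g θ * (obsDensity γ f g θ)⁻¹)) =
      ∑ y : Fin (N + 1) × Fin T, a y.1 y.2 • noiseVec γ f g (y.1 : ℕ) y.2 θ := by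
    rw [polyA, sum_ex_smul_eq]
    exact sum_scaledRow _ _ (fun k l => a k l) _
  have h3 : (star (γ.beta θ) / star (γ.chi θ)) •
      (polyC γ f g N a θ ᵥ* (obsDensity γ f g θ)⁻¹) =
      ∑ x : Fin (N + γ.n + 1) × Fin T, cvec γ f g N a x • dualRow γ f g (x.1 : ℕ) x.2 θ :=
    sum_scaledRow _ _ (fun k l => cvec γ f g N a (k, l)) _
  rw [specChar, h1, h2, h3]

/-- The term `Bᵀ χ / β` of the spectral characteristic, as an element of `L₂(p)`. -/
def incrPart (γ : Pattern r) (f g : ℝ → Matrix (Fin T) (Fin T) ℂ) (N : ℕ) (a : ℕ → Fin T → ℂ) :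
    VecL2 T :=
  ∑ y : Fin (N + 1) × Fin T, bvec γ N a y.1 y.2 • emb (obsDensity γ f g) (incrVec γ (y.1 : ℕ) y.2)

/-- The term `Aᵀ g conj(β) p⁻¹` of the spectral characteristic, as an element of `L₂(p)`. -/
def noisePart (γ : Pattern r) (f g : ℝ → Matrix (Fin T) (Fin T) ℂ) (N : ℕ) (a : ℕ → Fin T → ℂ) :
    VecL2 T :=
  ∑ y : Fin (N + 1) × Fin T, a y.1 y.2 • emb (obsDensity γ f g) (noiseVec γ f g (y.1 : ℕ) y.2)

/-- The term `Cᵀ p⁻¹ conj(β) / conj(χ)` of the spectral characteristic, as an element of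
`L₂(p)`. -/
def dualPart (γ : Pattern r) (f g : ℝ → Matrix (Fin T) (Fin T) ℂ) (N : ℕ) (a : ℕ → Fin T → ℂ) :
    VecL2 T :=
  ∑ x : Fin (N + γ.n + 1) × Fin T, cvec γ f g N a x •
    emb (obsDensity γ f g) (dualRow γ f g (x.1 : ℕ) x.2)

namespace AdmissibleDensities

variable (h : AdmissibleDensities γ f g)
include h

theorem memWeighted_specChar : MemWeighted (obsDensity γ f g) (specChar γ f g N a) := by
  rw [specChar_eq]
  exact ((memWeighted_sum _ fun y _ => (h.memWeighted_incrVec _ _).smul _).sub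
    (memWeighted_sum _ fun y _ => (h.memWeighted_noiseVec _ _).smul _)).sub
    (memWeighted_sum _ fun y _ => (h.memWeighted_dualRow _ _).smul _)

theorem emb_specChar : emb (obsDensity γ f g) (specChar γ f g N a) =
    incrPart γ f g N a - noisePart γ f g N a - dualPart γ f g N a := by
  have h1 : ∀ y : Fin (N + 1) × Fin T, MemWeighted (obsDensity γ f g)
      (bvec γ N a y.1 y.2 • incrVec γ (y.1 : ℕ) y.2) :=
    fun y => (h.memWeighted_incrVec _ _).smul _
  have h2 : ∀ y : Fin (N + 1) × Fin T, MemWeighted (obsDensity γ f g)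
      (a y.1 y.2 • noiseVec γ f g (y.1 : ℕ) y.2) :=
    fun y => (h.memWeighted_noiseVec _ _).smul _
  have h3 : ∀ x : Fin (N + γ.n + 1) × Fin T, MemWeighted (obsDensity γ f g)
      (cvec γ f g N a x • dualRow γ f g (x.1 : ℕ) x.2) :=
    fun x => (h.memWeighted_dualRow _ _).smul _
  rw [specChar_eq, emb_sub ((memWeighted_sum _ fun y _ => h1 y).sub
      (memWeighted_sum _ fun y _ => h2 y)) (memWeighted_sum _ fun x _ => h3 x),
    emb_sub (memWeighted_sum _ fun y _ => h1 y) (memWeighted_sum _ fun y _ => h2 y),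
    emb_sum _ fun y _ => h1 y, emb_sum _ fun y _ => h2 y, emb_sum _ fun x _ => h3 x]
  simp only [emb_smul _ (h.memWeighted_incrVec _ _), emb_smul _ (h.memWeighted_noiseVec _ _),
    emb_smul _ (h.memWeighted_dualRow _ _)]
  rfl

theorem aestronglyMeasurable_specChar : AEStronglyMeasurable (specChar γ f g N a) circle := by
  rw [specChar_eq]
  refine ((Finset.aestronglyMeasurable_sum _ fun y _ => ?_).sub
    (Finset.aestronglyMeasurable_sum _ fun y _ => ?_)).sub
    (Finset.aestronglyMeasurable_sum _ fun y _ => ?_)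
  · exact (aestronglyMeasurable_scaledRow (measurable_coeff_incr γ _).aestronglyMeasurable
      aestronglyMeasurable_const _).const_smul _
  · exact (aestronglyMeasurable_scaledRow (continuous_coeff_noise γ _).aestronglyMeasurable
      (aestronglyMeasurable_mul h.aesm_g h.aesm_inv) _).const_smul _
  · exact (aestronglyMeasurable_scaledRow (measurable_coeff_dual γ _).aestronglyMeasurable
      h.aesm_inv _).const_smul _

theorem matP_apply (x y : Fin (N + γ.n + 1) × Fin T) : matP γ f g N x y =
    inner ℂ (emb (obsDensity γ f g) (dualRow γ f g (x.1 : ℕ) x.2))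
      (emb (obsDensity γ f g) (dualRow γ f g (y.1 : ℕ) y.2)) :=
  (h.inner_dual_dual _ _ _ _).symm

theorem matT_apply (x y : Fin (N + γ.n + 1) × Fin T) : matT γ f g N x y =
    inner ℂ (emb (obsDensity γ f g) (dualRow γ f g (x.1 : ℕ) x.2))
      (emb (obsDensity γ f g) (noiseVec γ f g (y.1 : ℕ) y.2)) :=
  (h.inner_dual_noise _ _ _ _).symm

/-- The Gram matrix `P` is nonsingular, because biorthogonality to the increments makes the dual
rows linearly independent. -/
theorem isUnit_det_matP : IsUnit (matP γ f g N).det := by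
  rw [isUnit_iff_ne_zero]
  intro hdet
  obtain ⟨v, hv, hPv⟩ := Matrix.exists_mulVec_eq_zero_iff.2 hdet
  set z : VecL2 T := ∑ x, v x • emb (obsDensity γ f g) (dualRow γ f g (x.1 : ℕ) x.2) with hz
  have h1 : ∀ x : Fin (N + γ.n + 1) × Fin T,
      inner ℂ (emb (obsDensity γ f g) (dualRow γ f g (x.1 : ℕ) x.2)) z = 0 := by
    intro x
    rw [hz, inner_sum]
    refine Eq.trans (Finset.sum_congr rfl fun y _ => ?_)
      ((mulVec_apply_eq_sum _ v x).symm.trans (congrFun hPv x))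
    rw [inner_smul_right, h.matP_apply]
  have h2 : z = 0 := by
    rw [← inner_self_eq_zero (𝕜 := ℂ)]
    conv_lhs => arg 2; rw [hz]
    rw [sum_inner]
    exact Finset.sum_eq_zero fun x _ => by rw [inner_smul_left, h1, mul_zero]
  apply hv
  ext y
  have h3 : inner ℂ (emb (obsDensity γ f g) (incrVec γ (y.1 : ℕ) y.2)) z = v y := by
    rw [hz, inner_sum, Finset.sum_eq_single y]
    · rw [inner_smul_right, h.inner_incr_dual]; simp
    · intro x _ hxy
      rw [inner_smul_right, h.inner_incr_dual, if_neg, mul_zero]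
      rintro ⟨e1, e2⟩
      exact hxy (Prod.ext (Fin.ext (by exact_mod_cast e1)) e2)
    · simp
  rw [← h3, h2, inner_zero_right]; rfl

theorem matP_mulVec_cvec : matP γ f g N *ᵥ cvec γ f g N a = rhs γ f g N a := by
  rw [cvec, mulVec_mulVec, mul_nonsing_inv _ (h.isUnit_det_matP N), one_mulVec]

theorem inner_dual_dualPart (x : Fin (N + γ.n + 1) × Fin T) :
    inner ℂ (emb (obsDensity γ f g) (dualRow γ f g (x.1 : ℕ) x.2)) (dualPart γ f g N a) =
      rhs γ f g N a x := by
  rw [← h.matP_mulVec_cvec, dualPart, inner_sum, mulVec_apply_eq_sum]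
  refine Finset.sum_congr rfl fun y _ => ?_
  rw [inner_smul_right, h.matP_apply]

theorem inner_dual_noisePart (x : Fin (N + γ.n + 1) × Fin T) :
    inner ℂ (emb (obsDensity γ f g) (dualRow γ f g (x.1 : ℕ) x.2)) (noisePart γ f g N a) =
      (matT γ f g N *ᵥ aPadded γ N a) x := by
  rw [noisePart, ← sum_padded N γ.n a fun k l => emb (obsDensity γ f g) (noiseVec γ f g k l),
    inner_sum, mulVec_apply_eq_sum]
  refine Finset.sum_congr rfl fun y _ => ?_
  rw [inner_smul_right, h.matT_apply]
  rfl

theorem inner_dual_incrPart (x : Fin (N + γ.n + 1) × Fin T) :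
    inner ℂ (emb (obsDensity γ f g) (dualRow γ f g (x.1 : ℕ) x.2)) (incrPart γ f g N a) =
      bPadded γ N a x := by
  rw [incrPart, ← sum_padded N γ.n (bvec γ N a) fun k l => emb (obsDensity γ f g) (incrVec γ k l),
    inner_sum, Finset.sum_eq_single x]
  · rw [inner_smul_right, ← inner_conj_symm, h.inner_incr_dual]
    simp [bPadded]
  · intro y _ hxy
    have hne : ¬(((x.1 : ℕ) : ℤ) = ((y.1 : ℕ) : ℤ) ∧ x.2 = y.2) := by
      rintro ⟨e1, e2⟩
      exact hxy (Prod.ext (Fin.ext (by exact_mod_cast e1.symm)) e2.symm)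
    rw [inner_smul_right, ← inner_conj_symm, h.inner_incr_dual, if_neg hne, map_zero, mul_zero]
  · simp

/-- The equation `P c = [Da] - T a` expresses that `h` is orthogonal to the dual rows. -/
theorem inner_dual_specChar (x : Fin (N + γ.n + 1) × Fin T) :
    inner ℂ (emb (obsDensity γ f g) (dualRow γ f g (x.1 : ℕ) x.2))
      (emb (obsDensity γ f g) (specChar γ f g N a)) = 0 := by
  rw [h.emb_specChar, inner_sub_right, inner_sub_right, h.inner_dual_incrPart,
    h.inner_dual_noisePart, h.inner_dual_dualPart, rhs, Pi.sub_apply, sub_self]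

/-- The spectral characteristic is a limit of combinations of the observed increments, being
orthogonal to their orthogonal complement. -/
theorem emb_specChar_mem : emb (obsDensity γ f g) (specChar γ f g N a) ∈
    (Submodule.span ℂ (Set.range
      fun i : {i : ℤ × Fin T // i.1 ≤ -1 ∨ (N : ℤ) + γ.n + 1 ≤ i.1} =>
        emb (obsDensity γ f g) (incrVec γ i.1.1 i.1.2))).topologicalClosure := by
  rw [← Submodule.orthogonal_orthogonal_eq_closure, Submodule.mem_orthogonal]
  intro ρ hρ
  obtain ⟨c, rfl⟩ := h.exists_eq_sum_dualRow (N + γ.n + 1) ρ fun m hm l =>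
    (Submodule.mem_orthogonal _ _).1 hρ _
      (Submodule.subset_span ⟨⟨(m, l), by push_cast at hm; exact hm⟩, rfl⟩)
  rw [sum_inner]
  exact Finset.sum_eq_zero fun x _ => by rw [inner_smul_left, h.inner_dual_specChar, mul_zero]

theorem inner_incr_dualPart {m : ℤ} (hm : m ≤ -1 ∨ (N : ℤ) + γ.n + 1 ≤ m) (l : Fin T) :
    inner ℂ (emb (obsDensity γ f g) (incrVec γ m l)) (dualPart γ f g N a) = 0 := by
  rw [dualPart, inner_sum]
  refine Finset.sum_eq_zero fun x _ => ?_
  rw [inner_smul_right, h.inner_incr_dual, if_neg, mul_zero]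
  rintro ⟨e1, -⟩
  have := x.1.2
  omega

theorem inner_dualPart_self : inner ℂ (dualPart γ f g N a) (dualPart γ f g N a) =
    rhs γ f g N a ⬝ᵥ star (cvec γ f g N a) := by
  conv_lhs => arg 2; rw [dualPart]
  rw [sum_inner]
  refine Finset.sum_congr rfl fun x _ => ?_
  rw [inner_smul_left, h.inner_dual_dualPart, mul_comm]
  rfl

end AdmissibleDensities

end Projection

/-! ### The spectral density of the error -/

section ErrorDensity

variable {T r : ℕ} {γ : Pattern r} {f g : ℝ → Matrix (Fin T) (Fin T) ℂ}

theorem vecMul_dotProduct_star_expand (s : ℂ) (x c : Fin T → ℂ) {G : Matrix (Fin T) (Fin T) ℂ}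
    (M : Matrix (Fin T) (Fin T) ℂ) (hG : Gᴴ = G) :
    ((s • (x ᵥ* G) + c) ᵥ* M) ⬝ᵥ star (s • (x ᵥ* G) + c) =
      s * star s * ((x ᵥ* (G * M * G)) ⬝ᵥ star x) + s * ((x ᵥ* (G * M)) ⬝ᵥ star c) +
        star s * ((c ᵥ* (M * G)) ⬝ᵥ star x) + (c ᵥ* M) ⬝ᵥ star c := by
  simp only [add_vecMul, smul_vecMul, star_add, star_smul, star_vecMul, hG, dotProduct_add,
    add_dotProduct, vecMul_vecMul, dotProduct_mulVec, dotProduct_smul, smul_dotProduct, smul_eq_mul]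
  ring

theorem vecMul_dotProduct_star_nonneg {M : Matrix (Fin T) (Fin T) ℂ} (hM : M.PosSemidef)
    (x : Fin T → ℂ) : 0 ≤ (x ᵥ* M) ⬝ᵥ star x := by
  have := hM.dotProduct_mulVec_nonneg (star x)
  rwa [star_star, dotProduct_mulVec] at this

namespace GoodPoint

variable {θ : ℝ} (h : GoodPoint γ f g θ) (N : ℕ) (a : ℕ → Fin T → ℂ)
include h

theorem errXi_nonneg : 0 ≤ errXi γ f g N a θ := by
  refine mul_nonneg (by rw [Pattern.weight, Complex.zero_le_real]; positivity) ?_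
  refine vecMul_dotProduct_star_nonneg ?_ _
  have := h.posSemidef_f.mul_mul_conjTranspose_same (obsDensity γ f g θ)⁻¹
  rwa [h.isHermitian_inv] at this

theorem errEta_nonneg : 0 ≤ errEta γ f g N a θ := by
  refine mul_nonneg (by rw [Complex.zero_le_real]; positivity) ?_
  refine vecMul_dotProduct_star_nonneg ?_ _
  have := h.posSemidef_g.mul_mul_conjTranspose_same (obsDensity γ f g θ)⁻¹
  rwa [h.isHermitian_inv] at this

/-- In the sum of the two error densities the terms mixing `A` and `C` cancel, as
`g p⁻¹ f = f p⁻¹ g`. -/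
theorem errXi_add_errEta : errXi γ f g N a θ + errEta γ f g N a θ =
    (polyC γ f g N a θ ᵥ* kernelP γ f g θ) ⬝ᵥ star (polyC γ f g N a θ) +
      (polyA N a θ ᵥ* kernelQ γ f g θ) ⬝ᵥ star (polyA N a θ) := by
  set x := polyA N a θ
  set c := polyC γ f g N a θ
  set R := (obsDensity γ f g θ)⁻¹ with hR
  set b : ℂ := ((‖γ.beta θ‖ ^ 2 : ℝ) : ℂ) with hb
  set k : ℂ := ((‖γ.chi θ‖ ^ 2 : ℝ) : ℂ) with hk
  have hbs : star b = b := Complex.conj_ofReal _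
  have hk0 : k ≠ 0 := by
    rw [hk]; exact_mod_cast pow_ne_zero 2 (norm_ne_zero_iff.2 h.chi_ne)
  have hs : star (γ.chi θ) * star (star (γ.chi θ)) = k := by
    rw [star_star, mul_comm]; exact mul_star_self _
  have hw : γ.weight θ = b / k := by rw [Pattern.weight, Complex.ofReal_div]
  have hk1 : ((1 / ‖γ.chi θ‖ ^ 2 : ℝ) : ℂ) = 1 / k := by
    rw [Complex.ofReal_div, Complex.ofReal_one]
  have e1 : errXi γ f g N a θ = b / k * (k * ((x ᵥ* (g θ * (R * f θ * R) * g θ)) ⬝ᵥ star x) +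
      star (γ.chi θ) * ((x ᵥ* (g θ * (R * f θ * R))) ⬝ᵥ star c) +
      star (star (γ.chi θ)) * ((c ᵥ* ((R * f θ * R) * g θ)) ⬝ᵥ star x) +
      (c ᵥ* (R * f θ * R)) ⬝ᵥ star c) := by
    rw [errXi, hw, ← hs, ← vecMul_dotProduct_star_expand _ _ _ _ h.posSemidef_g.1.eq]
  have e2 : errEta γ f g N a θ = 1 / k * (k * ((x ᵥ* (f θ * (R * g θ * R) * f θ)) ⬝ᵥ star x) -
      b * (star (γ.chi θ) * ((x ᵥ* (f θ * (R * g θ * R))) ⬝ᵥ star c)) -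
      b * (star (star (γ.chi θ)) * ((c ᵥ* ((R * g θ * R) * f θ)) ⬝ᵥ star x)) +
      b * b * ((c ᵥ* (R * g θ * R)) ⬝ᵥ star c)) := by
    rw [errEta, hk1]
    rw [sub_eq_add_neg, vecMul_dotProduct_star_expand _ _ _ _ h.posSemidef_f.1.eq, hs]
    simp only [star_neg, star_smul, hbs, neg_vecMul, smul_vecMul, dotProduct_neg, neg_dotProduct,
      dotProduct_smul, smul_dotProduct, smul_eq_mul, ← hb]
    ring
  have hAA := congrArg (fun M => (x ᵥ* M) ⬝ᵥ star x) h.kernelQ_split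
  have hCC := congrArg (fun M => (c ᵥ* M) ⬝ᵥ star c) h.inv_split
  simp only [vecMul_add, vecMul_smul, add_dotProduct, smul_dotProduct, smul_eq_mul, ← hb, ← hR]
    at hAA hCC
  have hAC : g θ * (R * f θ * R) = f θ * (R * g θ * R) := by
    have := congrArg (fun M => M * R) h.kernelQ_comm
    simpa only [mul_assoc] using this
  have hCA : R * f θ * R * g θ = R * g θ * R * f θ := by
    have := congrArg (fun M => R * M) h.kernelQ_comm.symm
    simpa only [mul_assoc] using this
  have hP : (c ᵥ* kernelP γ f g θ) ⬝ᵥ star c = b / k * ((c ᵥ* R) ⬝ᵥ star c) := by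
    rw [kernelP, hw, vecMul_smul, smul_dotProduct, smul_eq_mul]
  rw [e1, e2, hP, kernelQ, ← hAA, ← hCC, ← hAC, ← hCA]
  field_simp
  ring

end GoodPoint

theorem trigPoly_quadratic {M : ℕ} (v : Fin M × Fin T → ℂ) (K : Matrix (Fin T) (Fin T) ℂ) (θ : ℝ) :
    ((fun l => ∑ k : Fin M, ex (k : ℕ) θ * v (k, l)) ᵥ* K) ⬝ᵥ
      star (fun l => ∑ k : Fin M, ex (k : ℕ) θ * v (k, l)) =
    ∑ x : Fin M × Fin T, ∑ y : Fin M × Fin T,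
      v y * star (v x) * (ex ((y.1 : ℕ) - (x.1 : ℕ)) θ * K y.2 x.2) := by
  rw [Fintype.sum_prod_type_right]
  refine Finset.sum_congr rfl fun i _ => ?_
  rw [Pi.star_apply, star_sum, Finset.mul_sum]
  refine Finset.sum_congr rfl fun k' _ => ?_
  rw [Fintype.sum_prod_type_right, vecMul, dotProduct, Finset.sum_mul]
  refine Finset.sum_congr rfl fun j _ => ?_
  rw [Finset.sum_mul, Finset.sum_mul]
  refine Finset.sum_congr rfl fun k _ => ?_
  rw [← ex_mul_star_ex, star_mul']
  ring

theorem integral_trigPoly_quadratic {M : ℕ} (v : Fin M × Fin T → ℂ)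
    {K : ℝ → Matrix (Fin T) (Fin T) ℂ} (hK : ∀ i j, Integrable (fun θ => K θ i j) circle) :
    Integrable (fun θ => ((fun l => ∑ k : Fin M, ex (k : ℕ) θ * v (k, l)) ᵥ* K θ) ⬝ᵥ
      star (fun l => ∑ k : Fin M, ex (k : ℕ) θ * v (k, l))) circle ∧
    ∫ θ, ((fun l => ∑ k : Fin M, ex (k : ℕ) θ * v (k, l)) ᵥ* K θ) ⬝ᵥ
      star (fun l => ∑ k : Fin M, ex (k : ℕ) θ * v (k, l)) ∂circle =
      (blockFourier K M *ᵥ v) ⬝ᵥ star v := by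
  simp only [trigPoly_quadratic]
  have hint : ∀ x y : Fin M × Fin T, Integrable (fun θ => v y * star (v x) *
      (ex ((y.1 : ℕ) - (x.1 : ℕ)) θ * K θ y.2 x.2)) circle := fun x y =>
    (integrable_ex_mul (hK _ _) _).const_mul _
  refine ⟨integrable_finsetSum _ fun x _ => integrable_finsetSum _ fun y _ => hint x y, ?_⟩
  rw [integral_finsetSum _ fun x _ => integrable_finsetSum _ fun y _ => hint x y]
  refine Finset.sum_congr rfl fun x _ => ?_
  rw [integral_finsetSum _ fun y _ => hint x y, mulVec_apply_eq_sum, Finset.sum_mul]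
  refine Finset.sum_congr rfl fun y _ => ?_
  rw [integral_const_mul, Pi.star_apply, blockFourier]
  ring

namespace AdmissibleDensities

variable (h : AdmissibleDensities γ f g) (N : ℕ) (a : ℕ → Fin T → ℂ)
include h

theorem integral_errors : Integrable (errXi γ f g N a) circle ∧
    Integrable (errEta γ f g N a) circle ∧
    ∫ θ, errXi γ f g N a θ ∂circle + ∫ θ, errEta γ f g N a θ ∂circle =
      rhs γ f g N a ⬝ᵥ star (cvec γ f g N a) +
        (matQ γ f g N *ᵥ aStack N a) ⬝ᵥ star (aStack N a) := by
  have hC := integral_trigPoly_quadratic (cvec γ f g N a) h.integrable_kernelP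
  have hA := integral_trigPoly_quadratic (aStack N a) h.integrable_kernelQ
  have hpA : ∀ θ, (fun l => ∑ k : Fin (N + 1), ex (k : ℕ) θ * aStack N a (k, l)) = polyA N a θ :=
    fun θ => (sum_ex_smul_eq N a θ).symm
  have hpC : ∀ θ, (fun l => ∑ k : Fin (N + γ.n + 1), ex (k : ℕ) θ * cvec γ f g N a (k, l)) =
      polyC γ f g N a θ := fun θ => rfl
  simp only [hpA] at hA
  simp only [hpC] at hC
  have hsum : (fun θ => errXi γ f g N a θ + errEta γ f g N a θ) =ᵐ[circle] _ :=
    h.ae_goodPoint.mono fun θ hθ => hθ.errXi_add_errEta N a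
  have hint : Integrable (fun θ => errXi γ f g N a θ + errEta γ f g N a θ) circle :=
    (hC.1.add hA.1).congr hsum.symm
  have hA' : AEStronglyMeasurable (polyA N a) circle := by
    have hc : Continuous (polyA N a) :=
      continuous_finsetSum _ fun k _ => (continuous_ex k).smul continuous_const
    exact hc.aestronglyMeasurable
  have hC' : AEStronglyMeasurable (polyC γ f g N a) circle := by
    refine aestronglyMeasurable_vec fun l => Continuous.aestronglyMeasurable ?_
    exact continuous_finsetSum _ fun k _ => (continuous_ex _).mul continuous_const
  have hchi : AEStronglyMeasurable (fun θ => star (γ.chi θ)) circle :=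
    γ.continuous_chi.star.aestronglyMeasurable
  have hm1 : AEStronglyMeasurable (errXi γ f g N a) circle := by
    have hU : AEStronglyMeasurable (fun θ => star (γ.chi θ) • (polyA N a θ ᵥ* g θ) +
        polyC γ f g N a θ) circle := (hchi.smul (aestronglyMeasurable_vecMul hA' h.aesm_g)).add hC'
    refine AEStronglyMeasurable.mul (Measurable.aestronglyMeasurable ?_)
      (aestronglyMeasurable_dotProduct_star (aestronglyMeasurable_vecMul hU
        (aestronglyMeasurable_mul (aestronglyMeasurable_mul h.aesm_inv h.aesm_f) h.aesm_inv)) hU)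
    exact Complex.measurable_ofReal.comp
      (((γ.continuous_beta.norm.pow 2).measurable).div ((γ.continuous_chi.norm.pow 2).measurable))
  have hm2 : AEStronglyMeasurable (errEta γ f g N a) circle := by
    have hW : AEStronglyMeasurable (fun θ => star (γ.chi θ) • (polyA N a θ ᵥ* f θ) -
        ((‖γ.beta θ‖ ^ 2 : ℝ) : ℂ) • polyC γ f g N a θ) circle :=
      (hchi.smul (aestronglyMeasurable_vecMul hA' h.aesm_f)).sub
        ((by fun_prop : Continuous fun θ => ((‖γ.beta θ‖ ^ 2 : ℝ) : ℂ)
          ).aestronglyMeasurable.smul hC')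
    refine AEStronglyMeasurable.mul (Measurable.aestronglyMeasurable ?_)
      (aestronglyMeasurable_dotProduct_star (aestronglyMeasurable_vecMul hW
        (aestronglyMeasurable_mul (aestronglyMeasurable_mul h.aesm_inv h.aesm_g) h.aesm_inv)) hW)
    exact Complex.measurable_ofReal.comp
      (measurable_const.div ((γ.continuous_chi.norm.pow 2).measurable))
  have hi1 : Integrable (errXi γ f g N a) circle := by
    refine Integrable.mono' hint.norm hm1 (h.ae_goodPoint.mono fun θ hθ => ?_)
    exact norm_le_norm_of_nonneg (hθ.errXi_nonneg N a)
      (le_add_of_nonneg_right (hθ.errEta_nonneg N a))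
  have hi2 : Integrable (errEta γ f g N a) circle := by
    refine Integrable.mono' hint.norm hm2 (h.ae_goodPoint.mono fun θ hθ => ?_)
    exact norm_le_norm_of_nonneg (hθ.errEta_nonneg N a)
      (le_add_of_nonneg_left (hθ.errXi_nonneg N a))
  refine ⟨hi1, hi2, ?_⟩
  rw [← integral_add hi1 hi2, integral_congr_ae hsum, integral_add hC.1 hA.1, hC.2, hA.2]
  rw [← h.matP_mulVec_cvec]
  rfl

end AdmissibleDensities

end ErrorDensity

/-! ### The optimal estimate and its error -/

section Optimality

variable {T r : ℕ} {Ω : Type*} [MeasurableSpace Ω] {P : Measure Ω}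
  {γ : Pattern r} {ξ η : ℤ → Fin T → Ω → ℂ} {f g : ℝ → Matrix (Fin T) (Fin T) ℂ}

omit [MeasurableSpace Ω] in
theorem sum_range_dotProduct (N : ℕ) (x : ℕ → Fin T → ℂ) (X : ℕ → Fin T → Ω → ℂ) :
    (fun ω => ∑ k ∈ Finset.range (N + 1), x k ⬝ᵥ fun l => X k l ω) =
      ∑ y : Fin (N + 1) × Fin T, x y.1 y.2 • X y.1 y.2 := by
  ext ω
  rw [Finset.sum_apply, Fintype.sum_prod_type,
    ← Finset.sum_range fun k => ∑ l, (x k l • X k l) ω]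
  rfl

omit [MeasurableSpace Ω] in
/-- The variable to be approximated by observed increments has finite variance, although `A_N ξ` and
`V_N ζ` separately need not have any moments. -/
theorem target_eq (N : ℕ) (a : ℕ → Fin T → ℂ) (ξ η : ℤ → Fin T → Ω → ℂ) :
    (fun ω => functional N a ξ ω + initialTerm γ N a (ξ + η) ω) =
      ∑ y : Fin (N + 1) × Fin T, bvec γ N a y.1 y.2 • γ.incr (ξ + η) (y.1 : ℕ) y.2 -
        ∑ y : Fin (N + 1) × Fin T, a y.1 y.2 • η (y.1 : ℕ) y.2 := by
  rw [← sum_range_dotProduct N (bvec γ N a) fun k l => γ.incr (ξ + η) k l,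
    ← sum_range_dotProduct N a fun k l => η k l]
  ext ω
  have h1 := functional_add_initialTerm γ N a (ξ + η) ω
  have h2 : functional N a (ξ + η) ω = functional N a ξ ω + functional N a η ω := by
    simp only [functional, ← Finset.sum_add_distrib, ← dotProduct_add]
    rfl
  rw [Pi.sub_apply, ← h1, h2, functional, functional]
  ring

namespace ObservedModel

variable (h : ObservedModel P γ ξ η f g) (N : ℕ) (a : ℕ → Fin T → ℂ)
include h

theorem memLp_target :
    MemLp (fun ω => functional N a ξ ω + initialTerm γ N a (ξ + η) ω) 2 P := by
  rw [target_eq]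
  exact (memLp_finsetSum' _ fun y _ => (h.memLp_incr _ _).const_smul _).sub
    (memLp_finsetSum' _ fun y _ => (h.hη.memLp _ _).const_smul _)

/-- The functional `A_N η` of the noise in `L₂(P)`. -/
def noiseLp : Lp ℂ 2 P :=
  ∑ y : Fin (N + 1) × Fin T, a y.1 y.2 • (h.hη.memLp (y.1 : ℕ) y.2).toLp

/-- The matrix `Q` measures the part of `A_N η` orthogonal to all increments of `ζ`, whether observed or
not. -/
theorem noiseLp_inner_self : inner ℂ (h.noiseLp N a) (h.noiseLp N a) =
    inner ℂ (noisePart γ f g N a) (noisePart γ f g N a) +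
      (matQ γ f g N *ᵥ aStack N a) ⬝ᵥ star (aStack N a) := by
  rw [noiseLp, noisePart, sum_inner, sum_inner, dotProduct, ← Finset.sum_add_distrib]
  refine Finset.sum_congr rfl fun x _ => ?_
  rw [inner_sum, inner_sum, mulVec_apply_eq_sum, Finset.sum_mul, ← Finset.sum_add_distrib]
  refine Finset.sum_congr rfl fun y _ => ?_
  rw [inner_smul_left, inner_smul_right, inner_smul_left, inner_smul_right, h.inner_noise,
    h.admissible.inner_noise_noise, matQ, blockFourier, Pi.star_apply, aStack, aStack,
    Complex.star_def]
  ring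

variable {U : VecL2 T →ₗᵢ[ℂ] Lp ℂ 2 P}
  (hU : ∀ m l, U (emb (obsDensity γ f g) (incrVec γ m l)) = (h.memLp_incr m l).toLp)
include hU

theorem target_toLp : (h.memLp_target N a).toLp = U (incrPart γ f g N a) - h.noiseLp N a := by
  have h1 : MemLp (∑ y : Fin (N + 1) × Fin T,
      bvec γ N a y.1 y.2 • γ.incr (ξ + η) (y.1 : ℕ) y.2) 2 P :=
    memLp_finsetSum' _ fun y _ => (h.memLp_incr _ _).const_smul _
  have h2 : MemLp (∑ y : Fin (N + 1) × Fin T, a y.1 y.2 • η (y.1 : ℕ) y.2) 2 P :=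
    memLp_finsetSum' _ fun y _ => (h.hη.memLp _ _).const_smul _
  rw [noiseLp, ← toLp_sum _ _ (fun y : Fin (N + 1) × Fin T => h.hη.memLp (y.1 : ℕ) y.2) h2,
    incrPart, map_sum]
  simp only [map_smul, hU]
  rw [← toLp_sum _ _ (fun y : Fin (N + 1) × Fin T => h.memLp_incr (y.1 : ℕ) y.2) h1,
    ← MemLp.toLp_sub]
  congr 1
  exact target_eq N a ξ η

/-- The residual of the candidate estimate: the increments cancel, and what remains is the dual term
together with the negative of the part of `A_N η` orthogonal to the range of `U`. -/
theorem residual_eq : (h.memLp_target N a).toLp - U (emb (obsDensity γ f g) (specChar γ f g N a)) =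
    U (noisePart γ f g N a + dualPart γ f g N a) - h.noiseLp N a := by
  rw [h.target_toLp N a hU, h.admissible.emb_specChar, map_sub, map_sub, map_add]
  abel

theorem inner_isometry_noiseLp (z : VecL2 T) :
    inner ℂ (U z) (h.noiseLp N a) = inner ℂ z (noisePart γ f g N a) := by
  rw [noiseLp, noisePart, inner_sum, inner_sum]
  simp only [inner_smul_right, h.inner_isometry_noise hU]

theorem inner_residual_self :
    inner ℂ (U (noisePart γ f g N a + dualPart γ f g N a) - h.noiseLp N a)
      (U (noisePart γ f g N a + dualPart γ f g N a) - h.noiseLp N a) =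
      rhs γ f g N a ⬝ᵥ star (cvec γ f g N a) +
        (matQ γ f g N *ᵥ aStack N a) ⬝ᵥ star (aStack N a) := by
  have h1 : ∀ z, inner ℂ (h.noiseLp N a) (U z) = inner ℂ (noisePart γ f g N a) z := fun z => by
    rw [← inner_conj_symm, h.inner_isometry_noiseLp N a hU, inner_conj_symm]
  rw [inner_sub_left, inner_sub_right, inner_sub_right, U.inner_map_map, h1,
    h.inner_isometry_noiseLp N a hU, h.noiseLp_inner_self, ← h.admissible.inner_dualPart_self]
  simp only [inner_add_left, inner_add_right]
  ring

/-- The closed linear span in `L₂(P)` of the observed increments. -/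
def observedSubspace : Submodule ℂ (Lp ℂ 2 P) :=
  (Submodule.span ℂ (Set.range fun i : {i : ℤ × Fin T // i.1 ≤ -1 ∨ (N : ℤ) + γ.n + 1 ≤ i.1} =>
    (h.memLp_incr i.1.1 i.1.2).toLp)).topologicalClosure

omit hU in
theorem isLinearEstimate_iff (X : Ω → ℂ) : IsLinearEstimate P γ N a (ξ + η) X ↔
    ∃ z ∈ h.observedSubspace N, X =ᵐ[P] fun ω => z ω - initialTerm γ N a (ξ + η) ω := by
  have hobs : observedIncrements γ N (ξ + η) =
      Set.range fun i : {i : ℤ × Fin T // i.1 ≤ -1 ∨ (N : ℤ) + γ.n + 1 ≤ i.1} =>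
        γ.incr (ξ + η) i.1.1 i.1.2 := by
    ext X
    constructor
    · rintro ⟨k, l, hk, rfl⟩
      exact ⟨⟨(k, l), hk⟩, rfl⟩
    · rintro ⟨⟨⟨k, l⟩, hk⟩, rfl⟩
      exact ⟨k, l, hk, rfl⟩
  have hX : ∀ i : {i : ℤ × Fin T // i.1 ≤ -1 ∨ (N : ℤ) + γ.n + 1 ≤ i.1},
      MemLp (γ.incr (ξ + η) i.1.1 i.1.2) 2 P := fun i => h.memLp_incr _ _
  rw [IsLinearEstimate, hobs]
  constructor
  · rintro ⟨H, hH, hXH⟩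
    obtain ⟨hH, hmem⟩ := (mem_closedSpan_range_iff hX).1 hH
    refine ⟨hH.toLp, hmem, hXH.trans ?_⟩
    filter_upwards [hH.coeFn_toLp] with ω e
    rw [e]
  · rintro ⟨z, hz, hXz⟩
    refine ⟨z, (mem_closedSpan_range_iff hX).2 ⟨Lp.memLp z, ?_⟩, hXz⟩
    rw [Lp.toLp_coeFn]
    exact hz

theorem isometry_specChar_mem :
    U (emb (obsDensity γ f g) (specChar γ f g N a)) ∈ h.observedSubspace N := by
  have h1 := h.admissible.emb_specChar_mem N a
  rw [← SetLike.mem_coe, Submodule.topologicalClosure_coe] at h1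
  rw [observedSubspace, ← SetLike.mem_coe, Submodule.topologicalClosure_coe]
  refine map_mem_closure U.continuous h1 fun x hx => ?_
  refine Submodule.span_induction (p := fun x _ => U x ∈ Submodule.span ℂ (Set.range
    fun i : {i : ℤ × Fin T // i.1 ≤ -1 ∨ (N : ℤ) + γ.n + 1 ≤ i.1} =>
      (h.memLp_incr i.1.1 i.1.2).toLp)) ?_ ?_ ?_ ?_ hx
  · rintro _ ⟨i, rfl⟩
    simp only [hU]
    exact Submodule.subset_span ⟨i, rfl⟩
  · rw [map_zero]; exact Submodule.zero_mem _
  · intro x y _ _ hx hy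
    rw [map_add]; exact Submodule.add_mem _ hx hy
  · intro c x _ hx
    rw [map_smul]; exact Submodule.smul_mem _ _ hx

theorem inner_residual_eq_zero {z : Lp ℂ 2 P} (hz : z ∈ h.observedSubspace N) :
    inner ℂ z ((h.memLp_target N a).toLp - U (emb (obsDensity γ f g) (specChar γ f g N a))) = 0 := by
  set E := (h.memLp_target N a).toLp - U (emb (obsDensity γ f g) (specChar γ f g N a)) with hE
  have hle : h.observedSubspace N ≤ (Submodule.span ℂ {E})ᗮ := by
    refine Submodule.topologicalClosure_minimal _ (Submodule.span_le.2 ?_)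
      (Submodule.isClosed_orthogonal _)
    rintro _ ⟨⟨⟨m, l⟩, hm⟩, rfl⟩
    rw [SetLike.mem_coe, Submodule.mem_orthogonal_singleton_iff_inner_left, hE,
      h.residual_eq N a hU]
    simp only
    rw [← hU, inner_sub_right, U.inner_map_map, h.inner_isometry_noiseLp N a hU, inner_add_right,
      h.admissible.inner_incr_dualPart N a hm, add_zero, sub_self]
  exact Submodule.mem_orthogonal_singleton_iff_inner_left.1 (hle hz)

/-- Pythagoras for the projection on the span of the observed increments. -/
theorem norm_sq_target_sub {z : Lp ℂ 2 P} (hz : z ∈ h.observedSubspace N) :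
    ‖(h.memLp_target N a).toLp - z‖ ^ 2 =
      ‖(h.memLp_target N a).toLp - U (emb (obsDensity γ f g) (specChar γ f g N a))‖ ^ 2 +
        ‖U (emb (obsDensity γ f g) (specChar γ f g N a)) - z‖ ^ 2 := by
  have h1 := h.inner_residual_eq_zero N a hU
    (Submodule.sub_mem _ (h.isometry_specChar_mem N a hU) hz)
  have h2 := norm_add_sq_eq_norm_sq_add_norm_sq_of_inner_eq_zero _ _ (inner_eq_zero_symm.1 h1)
  rw [sub_add_sub_cancel] at h2
  rw [pow_two, pow_two, pow_two, h2]

omit hU in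
theorem functional_sub_ae {X : Ω → ℂ} {z : Lp ℂ 2 P}
    (hX : X =ᵐ[P] fun ω => z ω - initialTerm γ N a (ξ + η) ω) :
    (functional N a ξ - X) =ᵐ[P] ((h.memLp_target N a).toLp - z : Lp ℂ 2 P) := by
  filter_upwards [hX, Lp.coeFn_sub (h.memLp_target N a).toLp z, (h.memLp_target N a).coeFn_toLp]
    with ω e1 e2 e3
  rw [Pi.sub_apply, e1, e2, Pi.sub_apply, e3]
  ring

omit hU in
theorem eLpNorm_functional_sub {X : Ω → ℂ} {z : Lp ℂ 2 P}
    (hX : X =ᵐ[P] fun ω => z ω - initialTerm γ N a (ξ + η) ω) :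
    eLpNorm (functional N a ξ - X) 2 P = ‖(h.memLp_target N a).toLp - z‖ₑ := by
  rw [eLpNorm_congr_ae (h.functional_sub_ae N a hX), Lp.enorm_def]

theorem isOptimalEstimate_iff (X : Ω → ℂ) : IsOptimalEstimate P γ N a ξ (ξ + η) X ↔
    X =ᵐ[P] fun ω => U (emb (obsDensity γ f g) (specChar γ f g N a)) ω -
      initialTerm γ N a (ξ + η) ω := by
  have hmem := h.isometry_specChar_mem N a hU
  constructor
  · rintro ⟨hX, hmin⟩
    obtain ⟨z, hz, hXz⟩ := (h.isLinearEstimate_iff N a X).1 hX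
    have h1 := hmin _ ((h.isLinearEstimate_iff N a _).2 ⟨_, hmem, Filter.EventuallyEq.rfl⟩)
    rw [h.eLpNorm_functional_sub N a hXz, h.eLpNorm_functional_sub N a Filter.EventuallyEq.rfl,
      enorm_le_iff_norm_le] at h1
    have h2 := h.norm_sq_target_sub N a hU hz
    have h3 := pow_le_pow_left₀ (norm_nonneg _) h1 2
    have h4 : ‖U (emb (obsDensity γ f g) (specChar γ f g N a)) - z‖ = 0 := by
      have := sq_nonneg ‖U (emb (obsDensity γ f g) (specChar γ f g N a)) - z‖
      exact pow_eq_zero_iff two_ne_zero |>.1 (by linarith)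
    rw [norm_eq_zero, sub_eq_zero] at h4
    rwa [h4]
  · intro hX
    refine ⟨(h.isLinearEstimate_iff N a X).2 ⟨_, hmem, hX⟩, fun X' hX' => ?_⟩
    obtain ⟨z, hz, hXz⟩ := (h.isLinearEstimate_iff N a X').1 hX'
    rw [h.eLpNorm_functional_sub N a hX, h.eLpNorm_functional_sub N a hXz, enorm_le_iff_norm_le]
    refine le_of_sq_le_sq ?_ (norm_nonneg _)
    rw [h.norm_sq_target_sub N a hU hz]
    exact le_add_of_nonneg_right (sq_nonneg _)

theorem error_eq {X : Ω → ℂ} (hX : X =ᵐ[P] fun ω =>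
      U (emb (obsDensity γ f g) (specChar γ f g N a)) ω - initialTerm γ N a (ξ + η) ω) :
    MemLp (functional N a ξ - X) 2 P ∧
      ((∫ ω, ‖functional N a ξ ω - X ω‖ ^ 2 ∂P : ℝ) : ℂ) =
        rhs γ f g N a ⬝ᵥ star (cvec γ f g N a) +
          (matQ γ f g N *ᵥ aStack N a) ⬝ᵥ star (aStack N a) := by
  have hae := h.functional_sub_ae N a hX
  refine ⟨(memLp_congr_ae hae).2 (Lp.memLp _), ?_⟩
  rw [← h.inner_residual_self N a hU, ← h.residual_eq N a hU, L2.inner_def]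
  refine (integral_ofReal (𝕜 := ℂ)).symm.trans (integral_congr_ae ?_)
  filter_upwards [hae] with ω e
  rw [← e, Pi.sub_apply, inner_self_eq_norm_sq_to_K]
  push_cast
  rfl

end ObservedModel

end Optimality

end GMInterpolation

end

open GMInterpolation in
theorem theorem2p1 {Ω : Type*} [MeasurableSpace Ω] (P : Measure Ω) [IsProbabilityMeasure P]
    {T r : ℕ} (γ : Pattern r) (ξ η : ℤ → Fin T → Ω → ℂ)
    (f g : ℝ → Matrix (Fin T) (Fin T) ℂ)
    (hξ : HasIncrementDensity P γ ξ f) (hη : HasDensity P η g)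
    (hξη : Uncorrelated P γ ξ η) (hmin : Minimality γ f g)
    (N : ℕ) (a : ℕ → Fin T → ℂ) :
    -- the Fourier coefficients exist and the block matrix `P` is invertible
    ((∀ p q, Integrable (fun θ => kernelT γ f g θ p q) circle) ∧
      (∀ p q, Integrable (fun θ => kernelP γ f g θ p q) circle) ∧
      (∀ p q, Integrable (fun θ => kernelQ γ f g θ p q) circle) ∧
      IsUnit (matP γ f g N).det) ∧
    -- the increments of `ξ + η` have a spectral representation
    (∃ Z, IsSpectralMeasure P γ (ξ + η) (obsDensity γ f g) Z) ∧
    -- the optimal estimate is `∫ hᵀ dZ - V_N (ξ + η)`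
    (∀ Z, IsSpectralMeasure P γ (ξ + η) (obsDensity γ f g) Z →
      ∃ H, IsStochasticIntegral P (obsDensity γ f g) Z (specChar γ f g N a) H ∧
        ∀ X, IsOptimalEstimate P γ N a ξ (ξ + η) X ↔
          X =ᵐ[P] fun ω => H ω - initialTerm γ N a (ξ + η) ω) ∧
    -- its mean square error
    (∀ X, IsOptimalEstimate P γ N a ξ (ξ + η) X →
      MemLp (functional N a ξ - X) 2 P ∧
      Integrable (errXi γ f g N a) circle ∧ Integrable (errEta γ f g N a) circle ∧
      ((∫ ω, ‖functional N a ξ ω - X ω‖ ^ 2 ∂P : ℝ) : ℂ) =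
        ∫ θ, errXi γ f g N a θ ∂circle + ∫ θ, errEta γ f g N a θ ∂circle ∧
      ((∫ ω, ‖functional N a ξ ω - X ω‖ ^ 2 ∂P : ℝ) : ℂ) =
        rhs γ f g N a ⬝ᵥ star (cvec γ f g N a) +
          (matQ γ f g N *ᵥ aStack N a) ⬝ᵥ star (aStack N a)) := by
  have h : ObservedModel P γ ξ η f g := ⟨hξ, hη, hξη, hmin⟩
  have had := h.admissible
  obtain ⟨U, hU⟩ := h.exists_isometry
  refine ⟨⟨had.integrable_kernelT, had.integrable_kernelP, had.integrable_kernelQ,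
    had.isUnit_det_matP N⟩, h.exists_isSpectralMeasure hU, fun Z hZ => ?_, fun X hX => ?_⟩
  · refine ⟨U (emb (obsDensity γ f g) (specChar γ f g N a)), ?_, h.isOptimalEstimate_iff N a hU⟩
    exact (h.represents_of_isSpectralMeasure hU hZ).isStochasticIntegral had.isRegularDensity
      (aemeasurable_pi_iff.1 (had.aestronglyMeasurable_specChar N a).aemeasurable)
      (had.memWeighted_specChar N a) Filter.EventuallyEq.rfl
  · obtain ⟨hmem, herr⟩ := h.error_eq N a hU ((h.isOptimalEstimate_iff N a hU X).1 hX)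
    obtain ⟨hi1, hi2, hsum⟩ := had.integral_errors N a
    exact ⟨hmem, hi1, hi2, herr.trans hsum.symm, herr⟩
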